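/- **Setting.** Let $F=\mathbb R^n$ with its Euclidean inner product. The *one-particle space* $\mathcal H_{0,F}$ is the completion of $C^\infty(S^1,F)/F$ for the norm $\|f\|^2=\sum_{k\ge1}k\|\hat f_k\|^2$ with complex structure $(\mathfrak J f)^\wedge_k=-i\,\mathrm{sign}(k)\hat f_k$, so that $\operatorname{Im}\langle [f],[g]\rangle=\omega(f,g)=\tfrac12\int_0^{2\pi}\langle f,g'\rangle\frac{d\theta}{2\pi}$. On the bosonic Fock space $e^{\mathcal H_{0,F}}$ let $W(\xi)$ be the Weyl unitaries, $W(\xi)e^{\eta}=e^{-\|\xi\|^2/2-\langle\xi,\eta\rangle}e^{\xi+\eta}$, so that $W(\xi)W(\eta)=e^{-i\operatorname{Im}\langle\xi,\eta\rangle}W(\xi+\eta)$. Let $\mathcal I$ be the set of proper intervals of $S^1$ (non-empty, non-dense, connected, open subsets), and for $K\in\mathcal I$ let $\mathcal A_F(K)=\{W([f]):f\in C^\infty(S^1,F),\ \operatorname{supp}f\subset K\}''$. Let $L=\mathbb Z e_1+\dots+\mathbb Z e_n$, where $(e_1,\dots,e_n)$ is a basis of $F$, be an even lattice, i.e. $\langle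 x,x\rangle\in2\mathbb Z$ for all $x\in L$. Let $b\colon L\times L\to U(1)$ be the $\mathbb Z$-bilinear extension (a bicharacter, hence a 2-cocycle) of $b(e_i,e_j)=(-1)^{\langle e_i,e_j\rangle}$ if $i<j$ and $b(e_i,e_j)=1$ otherwise. Let $I\in\mathcal I$ and let $\ell_1\colon S^1\to\mathbb R$ be smooth of charge $\int_0^{2\pi}\ell_1\frac{d\theta}{2\pi}=1$ and localized in $I$, i.e. $\ell_1$ vanishes on $I'=S^1\setminus\bar I$. For $q\in F$ put $\ell_q=\ell_1 q$, and for $K\in\mathcal I$ let $\rho_q=\rho_{q,K}=\operatorname{Ad}W([M])\in\operatorname{Aut}(\mathcal A_F(K))$, where $M\in C^\infty(S^1,F)$ is such that $M'=\ell_q$ on $K$. On $\bigoplus_{x\in L}e^{\mathcal H_{0,F}}$ let $(\iota_K(a)\xi)_x=\rho_{-x,K}(a)\xi_x$ for $a\in\mathcal A_F(K)$ and $(\psi_q\xi)_x=b(q,x-q)\xi_{x-q}$ for $q\in L$. The twisted crossed product $\mathcal A_F(I)\rtimes_bL$ is the von Neumann algebra generated by $\iota_I(\mathcal A_F(I))$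 and all $\psi_q$, $q\in L$. Fix a point $p\in I'$ at which the circle is cut. For $J\in\mathcal I$, *transport data to $J$* are an interval $K\in\mathcal I$ with $p\notin K$ and a smooth $\Lambda\colon S^1\to\mathbb R$ with $\operatorname{supp}\Lambda\subset K$ such that $\Lambda'+\ell_1$ is localized in some interval $J_0\subset J$ with $p\notin J_0$; the corresponding charge transporters are $z_q=W([\Lambda q])\in\mathcal A_F(K)$, $q\in F$. Let $\mathcal A_L(J)$ be the von Neumann algebra generated by $\iota_J(\mathcal A_F(J))$ and all charged fields $\iota_K(z_q)\psi_q$, where $q\in L$ and $(K,\Lambda)$ are transport data to $J$. **Proposition.** 1. For all $K\in\mathcal I$ and $q,r\in F$: $\rho_{q}(W([f]))=e^{i\int_0^{2\pi}\langle f,\ell_q\rangle\frac{d\theta}{2\pi}}W([f])$ whenever $\operatorname{supp}f\subset K$, and $\rho_{q+r}=\rho_q\rho_r$ on $\mathcal A_F(K)$. 2. For $q,r\in L$ the $\psi_q$ are unitary, $\psi_q\psi_r=b(q,r)\psi_{q+r}$, and $\psi_q\iota_K(a)=\iota_K(\rho_q(a))\psi_q$ for all $K\in\mathcal I$, $a\in\mathcal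 A_F(K)$. 3. Transport data to every $J\in\mathcal I$ exist, and for such data, every $q\in F$ and every $N\in\mathcal I$ disjoint from $J$ one has $z_q\rho_q(a)z_q^*=a$ for all $a\in\mathcal A_F(N)$. 4. If $J_1,J_2\in\mathcal I$ are disjoint and $(K,\Lambda_1)$, $(K,\Lambda_2)$ are transport data to $J_1$, $J_2$, with charge transporters $u_q$ and $v_r$, then for all $q,r\in L$ $$\psi_q\psi_r=\iota_K(\varepsilon(\rho_q,\rho_r))\,\psi_r\psi_q,\qquad \varepsilon(\rho_q,\rho_r)=\rho_r(u_q^*)\,v_r^*\,u_q\,\rho_q(v_r),$$ and $\psi_q\psi_r=e^{i\pi\langle q,r\rangle}\psi_r\psi_q$. 5. $\mathcal A_L(I)=\mathcal A_F(I)\rtimes_bL$, and $\mathcal A_L$ is a local extension of $\mathcal A_F$: both nets are isotone; the $\iota_J\colon\mathcal A_F(J)\to\mathcal A_L(J)$, $J\in\mathcal I$, are injective unital $*$-homomorphisms whose images are von Neumann algebras (so that they are normal), compatible with the inclusions of intervals; and $\mathcal A_L(J_1)$ and $\mathcal A_L(J_2)$ commute whenever $J_1,J_2\in\mathcal I$ are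 disjoint. -/

import Mathlib

open scoped ContDiff InnerProductSpace
open MeasureTheory

namespace LatticeNet

noncomputable section

/-- The complex Hilbert space `ℓ²(κ)`. -/
abbrev Ell2 (κ : Type*) : Type _ := lp (fun _ : κ => ℂ) 2

/-! ### Bosonic Fock space and Weyl operators -/

theorem hasSum_pow_pi {κ : Type*} (f : κ → ℂ) (hf : Summable fun i => ‖f i‖) (m : ℕ) :
    (Summable fun w : Fin m → κ => ‖∏ i, f (w i)‖) ∧
      HasSum (fun w : Fin m → κ => ∏ i, f (w i)) ((∑' i, f i) ^ m) := by
  induction m with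
  | zero =>
    refine ⟨(hasSum_fintype _).summable, ?_⟩
    convert hasSum_fintype (fun w : Fin 0 → κ => ∏ i, f (w i)) using 1
    simp
  | succ m ih =>
    have hs : Summable fun w : κ × (Fin m → κ) => ‖f w.1 * ∏ i, f (w.2 i)‖ :=
      Summable.mul_norm (f := f) (g := fun w : Fin m → κ => ∏ i, f (w i)) hf ih.1
    have h2 : HasSum (fun w : κ × (Fin m → κ) => f w.1 * ∏ i, f (w.2 i))
        ((∑' i, f i) * (∑' i, f i) ^ m) :=
      HasSum.mul (f := f) (g := fun w : Fin m → κ => ∏ i, f (w i)) hf.of_norm.hasSum ih.2 hs.of_norm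
    rw [← (Fin.consEquiv (fun _ : Fin (m + 1) => κ)).summable_iff,
      ← (Fin.consEquiv (fun _ : Fin (m + 1) => κ)).hasSum_iff, pow_succ']
    constructor
    · refine hs.congr fun w => ?_
      simp [Fin.consEquiv, Fin.prod_univ_succ]
    · convert h2 using 2 with w
      simp [Fin.consEquiv, Fin.prod_univ_succ]

theorem memlp_coherentSym {κ : Type*} (ξ : Ell2 κ) :
    Memℓp (fun x : (Σ m : ℕ, Fin m → κ) =>
      ((Real.sqrt (x.1.factorial : ℝ) : ℂ))⁻¹ * ∏ i, ξ (x.2 i)) 2 := by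
  apply memℓp_gen
  have hξ : Summable fun i => ‖((‖ξ i‖ ^ 2 : ℝ) : ℂ)‖ := by
    have := (lp.memℓp ξ).summable (by norm_num)
    refine this.congr fun i => ?_
    rw [Complex.norm_real]; simp
  have key : ∀ x : (Σ m : ℕ, Fin m → κ),
      ‖((Real.sqrt (x.1.factorial : ℝ) : ℂ))⁻¹ * ∏ i, ξ (x.2 i)‖ ^ (2 : ENNReal).toReal
        = ((x.1.factorial : ℝ))⁻¹ * ‖∏ i, ((‖ξ (x.2 i)‖ ^ 2 : ℝ) : ℂ)‖ := by
    intro x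
    simp only [ENNReal.toReal_ofNat, Real.rpow_ofNat, norm_mul, mul_pow, norm_inv, inv_pow,
      Complex.norm_real, norm_prod, Real.norm_eq_abs, sq_abs]
    rw [Real.sq_sqrt (by positivity), ← Finset.prod_pow]
    simp
  simp_rw [key]
  rw [summable_sigma_of_nonneg (fun x => by positivity)]
  refine ⟨fun m => ?_, ?_⟩
  · have h := ((hasSum_pow_pi (fun i => ((‖ξ i‖ ^ 2 : ℝ) : ℂ)) hξ m).1).mul_left
      ((m.factorial : ℝ))⁻¹
    convert h
  have h3 : ∀ m : ℕ, ∑' w : Fin m → κ, ((m.factorial : ℝ))⁻¹ * ‖∏ i, ((‖ξ (w i)‖ ^ 2 : ℝ) : ℂ)‖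
      = (∑' i, ‖ξ i‖ ^ 2) ^ m / m.factorial := by
    intro m
    rw [tsum_mul_left, div_eq_inv_mul]
    congr 1
    have h := (hasSum_pow_pi (fun i => ((‖ξ i‖ ^ 2 : ℝ) : ℂ)) hξ m).2.tsum_eq
    have h4 : ∀ w : Fin m → κ, (∏ i, ((‖ξ (w i)‖ ^ 2 : ℝ) : ℂ))
        = ((‖∏ i, ((‖ξ (w i)‖ ^ 2 : ℝ) : ℂ)‖ : ℝ) : ℂ) := by
      intro w
      rw [norm_prod, Complex.ofReal_prod]
      refine Finset.prod_congr rfl fun i _ => ?_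
      rw [Complex.norm_real]; simp
    rw [tsum_congr h4, ← Complex.ofReal_tsum, ← Complex.ofReal_tsum] at h
    exact_mod_cast h
  simp_rw [h3]
  exact Real.summable_pow_div_factorial (∑' i, ‖ξ i‖ ^ 2)

/-- The subspace `⨁ₘ Pₘ ℋ^{⊗m}` of the full Fock space `⨁ₘ ℋ^{⊗m}` of `ℋ = ℓ²(κ)`. The full
Fock space is realized as `ℓ²` of the disjoint union of the index sets `κ^m` (a Hilbert basis of
`ℋ^{⊗m}` is indexed by `κ^m`), and `Pₘ ℋ^{⊗m}` consists of the tensors that are invariant under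
permutation of the `m` tensor factors. -/
def SymTensors (κ : Type*) : Submodule ℂ (Ell2 (Σ m : ℕ, Fin m → κ)) where
  carrier := {v | ∀ (m : ℕ) (w : Fin m → κ) (σ : Equiv.Perm (Fin m)), v ⟨m, w ∘ σ⟩ = v ⟨m, w⟩}
  add_mem' {u v} hu hv m w σ := by simp [hu m w σ, hv m w σ]
  zero_mem' m w σ := by simp
  smul_mem' c v hv m w σ := by simp [hv m w σ]

theorem isClosed_SymTensors (κ : Type*) :
    IsClosed (SymTensors κ : Set (Ell2 (Σ m : ℕ, Fin m → κ))) := by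
  have h : (SymTensors κ : Set (Ell2 (Σ m : ℕ, Fin m → κ))) =
      ⋂ (m : ℕ) (w : Fin m → κ) (σ : Equiv.Perm (Fin m)),
        {v | lp.evalCLM ℂ (fun _ : (Σ m : ℕ, Fin m → κ) => ℂ) 2 ⟨m, w ∘ σ⟩ v
          = lp.evalCLM ℂ (fun _ : (Σ m : ℕ, Fin m → κ) => ℂ) 2 ⟨m, w⟩ v} := by
    ext v
    simp only [Set.mem_iInter]
    rfl
  rw [h]
  exact isClosed_iInter fun m => isClosed_iInter fun w => isClosed_iInter fun σ =>
    isClosed_eq (ContinuousLinearMap.continuous _) (ContinuousLinearMap.continuous _)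

instance (κ : Type*) : CompleteSpace (SymTensors κ) := (isClosed_SymTensors κ).completeSpace_coe

/-- The coherent vector `e^ξ = ⨁ₘ (m!)^{-1/2} ξ^{⊗m}`. -/
def coherentSym {κ : Type*} (ξ : Ell2 κ) : SymTensors κ :=
  ⟨⟨_, memlp_coherentSym ξ⟩, fun m w σ => by
    show _ * _ = _ * _
    congr 1
    exact Equiv.prod_comp σ (fun i => ξ (w i))⟩

theorem coherentSym_apply {κ : Type*} (ξ : Ell2 κ) (m : ℕ) (w : Fin m → κ) :
    (coherentSym ξ : Ell2 (Σ m : ℕ, Fin m → κ)) ⟨m, w⟩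
      = ((Real.sqrt (m.factorial : ℝ) : ℂ))⁻¹ * ∏ i, ξ (w i) := rfl

theorem inner_coherentSym {κ : Type*} (ξ η : Ell2 κ) :
    inner ℂ (coherentSym ξ) (coherentSym η) = Complex.exp (inner ℂ ξ η) := by
  have h1 := lp.hasSum_inner (𝕜 := ℂ) (G := fun _ => ℂ) (coherentSym ξ : Ell2 (Σ m : ℕ, Fin m → κ))
    (coherentSym η : Ell2 (Σ m : ℕ, Fin m → κ))
  have hs : Summable fun i => ‖inner ℂ (ξ i) (η i)‖ :=
    (lp.summable_inner (𝕜 := ℂ) (G := fun _ => ℂ) ξ η).norm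
  have h2 : ∀ m : ℕ, HasSum (fun w : Fin m → κ =>
      inner ℂ ((coherentSym ξ : Ell2 (Σ m : ℕ, Fin m → κ)) ⟨m, w⟩)
        ((coherentSym η : Ell2 (Σ m : ℕ, Fin m → κ)) ⟨m, w⟩))
      ((inner ℂ ξ η) ^ m / m.factorial) := by
    intro m
    have h := ((hasSum_pow_pi (fun i => inner ℂ (ξ i) (η i)) hs m).2).mul_left ((m.factorial : ℂ))⁻¹
    rw [← lp.inner_eq_tsum, ← div_eq_inv_mul] at h
    refine h.congr_fun ?_
    intro w
    rw [coherentSym_apply, coherentSym_apply]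
    have h5 : ((Real.sqrt (m.factorial : ℝ) : ℂ)) * (Real.sqrt (m.factorial : ℝ) : ℂ)
        = m.factorial := by
      rw [← Complex.ofReal_mul, Real.mul_self_sqrt (by positivity)]; simp
    simp only [RCLike.inner_apply, map_mul, map_prod, map_inv₀, Complex.conj_ofReal,
      Finset.prod_mul_distrib]
    rw [← h5, mul_inv]
    ring
  have h3 := h1.sigma h2
  have h4 : HasSum (fun m : ℕ => (inner ℂ ξ η) ^ m / m.factorial)
      (Complex.exp (inner ℂ ξ η)) := by
    rw [Complex.exp_eq_exp_ℂ]
    exact NormedSpace.expSeries_div_hasSum_exp (inner ℂ ξ η)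
  exact h3.unique h4

theorem coeff_eq_zero_of_hasSum (c : ℕ → ℂ)
    (h : ∀ z : ℂ, HasSum (fun m => z ^ m * c m) 0) (n : ℕ) : c n = 0 := by
  have hp : HasFPowerSeriesOnBall (0 : ℂ → ℂ) (FormalMultilinearSeries.ofScalars ℂ c) 0 1 := by
    refine ⟨?_, one_pos, ?_⟩
    · have := FormalMultilinearSeries.le_radius_of_summable
        (p := FormalMultilinearSeries.ofScalars ℂ c) (r := 1) ?_
      · simpa using this
      · refine ((h 1).summable.norm).congr fun m => ?_
        simp
    · intro y _
      simp only [Pi.zero_apply]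
      refine (h y).congr_fun fun m => ?_
      simp [mul_comm]
  have h0 := hp.hasFPowerSeriesAt.eq_zero
  have h1 := congrArg (fun p => p.coeff n) h0
  rw [FormalMultilinearSeries.coeff_ofScalars] at h1
  rw [h1]
  simp [FormalMultilinearSeries.coeff]

/-- Inclusion-exclusion: only surjections survive the alternating sum. -/
theorem alternating_sum_surjective {n : ℕ} (g : (Fin n → Fin n) → ℂ) :
    ∑ S : Finset (Fin n), (-1 : ℂ) ^ (Sᶜ).card *
        ∑ φ : Fin n → Fin n, (if ∀ i, φ i ∈ S then g φ else 0)
      = ∑ φ : Fin n → Fin n, if Function.Surjective φ then g φ else 0 := by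
  simp_rw [Finset.mul_sum]
  rw [Finset.sum_comm]
  refine Finset.sum_congr rfl fun φ _ => ?_
  have h := Finset.prod_add (fun _ : Fin n => (1 : ℂ))
    (fun j => if ∃ i, φ i = j then (0 : ℂ) else -1) Finset.univ
  have hl : ∏ j : Fin n, ((1 : ℂ) + (if ∃ i, φ i = j then (0 : ℂ) else -1))
      = if Function.Surjective φ then 1 else 0 := by
    split_ifs with hs
    · refine Finset.prod_eq_one fun j _ => ?_
      rw [if_pos (hs j)]; simp
    · simp only [Function.Surjective, not_forall] at hs
      obtain ⟨j, hj⟩ := hs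
      refine Finset.prod_eq_zero (Finset.mem_univ j) ?_
      rw [if_neg hj]; simp
  rw [hl] at h
  have h' : (if Function.Surjective φ then g φ else 0)
      = (if Function.Surjective φ then 1 else 0) * g φ := by split_ifs <;> simp
  rw [h', h, Finset.sum_mul]
  rw [Finset.powerset_univ]
  refine Finset.sum_congr rfl fun S _ => ?_
  simp only [Finset.prod_const_one, one_mul]
  rw [← Finset.compl_eq_univ_sdiff]
  split_ifs with hS
  · congr 1
    rw [Finset.prod_congr rfl (g := fun _ => (-1 : ℂ)), Finset.prod_const]
    intro j hj
    rw [if_neg]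
    rintro ⟨i, rfl⟩
    exact (Finset.mem_compl.1 hj) (hS i)
  · rw [not_forall] at hS
    obtain ⟨i, hi⟩ := hS
    rw [Finset.prod_eq_zero (Finset.mem_compl.2 hi)]
    · simp
    · rw [if_pos ⟨i, rfl⟩]

theorem eq_zero_of_inner_coherentSym {κ : Type*} (v : SymTensors κ)
    (hv : ∀ ξ : Ell2 κ, inner ℂ (coherentSym ξ) v = 0) : v = 0 := by
  classical
  have hom : ∀ (ξ : Ell2 κ) (n : ℕ),
      ∑' u : Fin n → κ, inner ℂ ((coherentSym ξ : Ell2 (Σ m : ℕ, Fin m → κ)) ⟨n, u⟩)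
        ((v : Ell2 (Σ m : ℕ, Fin m → κ)) ⟨n, u⟩) = 0 := by
    intro ξ
    refine coeff_eq_zero_of_hasSum _ fun z => ?_
    have h1 := lp.hasSum_inner (𝕜 := ℂ) (G := fun _ => ℂ)
      (coherentSym ((starRingEnd ℂ z) • ξ) : Ell2 (Σ m : ℕ, Fin m → κ))
      (v : Ell2 (Σ m : ℕ, Fin m → κ))
    have h0 : inner ℂ (coherentSym ((starRingEnd ℂ z) • ξ) : Ell2 (Σ m : ℕ, Fin m → κ))
      (v : Ell2 (Σ m : ℕ, Fin m → κ)) = 0 := hv _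
    rw [h0] at h1
    refine h1.sigma fun m => ?_
    have h2 := (lp.summable_inner (𝕜 := ℂ) (G := fun _ => ℂ)
      (coherentSym ξ : Ell2 (Σ m : ℕ, Fin m → κ)) (v : Ell2 (Σ m : ℕ, Fin m → κ)))
    have h3 := (h2.comp_injective (sigma_mk_injective (i := m))).hasSum.mul_left (z ^ m)
    refine h3.congr_fun fun u => ?_
    simp only [Function.comp, coherentSym_apply, RCLike.inner_apply, lp.coeFn_smul, Pi.smul_apply,
      smul_eq_mul, Finset.prod_mul_distrib, map_mul, map_prod, map_pow,
      Complex.conj_conj, Finset.prod_const, Finset.card_univ, Fintype.card_fin]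
    ring
  apply Subtype.ext
  apply lp.ext
  funext x
  obtain ⟨n, w⟩ := x
  have hS : ∀ S : Finset (Fin n), ∑ φ : Fin n → Fin n,
      (if ∀ i, φ i ∈ S then (v : Ell2 (Σ m : ℕ, Fin m → κ)) ⟨n, w ∘ φ⟩ else 0) = 0 := by
    intro S
    have h := hom (∑ j ∈ S, lp.single 2 (w j) (1 : ℂ)) n
    have e1 : ∀ u : Fin n → κ,
        inner ℂ ((coherentSym (∑ j ∈ S, lp.single 2 (w j) (1 : ℂ)) :
          Ell2 (Σ m : ℕ, Fin m → κ)) ⟨n, u⟩) ((v : Ell2 (Σ m : ℕ, Fin m → κ)) ⟨n, u⟩)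
        = ((Real.sqrt (n.factorial : ℝ) : ℂ))⁻¹ * ∑ φ : Fin n → Fin n,
          if u = w ∘ φ then (if ∀ i, φ i ∈ S then
            (v : Ell2 (Σ m : ℕ, Fin m → κ)) ⟨n, w ∘ φ⟩ else 0) else 0 := by
      intro u
      have e2 : ∏ i, ((∑ j ∈ S, lp.single 2 (w j) (1 : ℂ) : Ell2 κ) : κ → ℂ) (u i)
          = ∑ φ : Fin n → Fin n, if u = w ∘ φ then (if ∀ i, φ i ∈ S then (1 : ℂ) else 0)
            else 0 := by
        have e3 : ∀ i, ((∑ j ∈ S, lp.single 2 (w j) (1 : ℂ) : Ell2 κ) : κ → ℂ) (u i)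
            = ∑ j : Fin n, if u i = w j ∧ j ∈ S then (1 : ℂ) else 0 := by
          intro i
          rw [lp.coeFn_sum, Finset.sum_apply, ← Finset.sum_filter_add_sum_filter_not
            Finset.univ (· ∈ S)]
          rw [Finset.sum_eq_zero (s := Finset.univ.filter (· ∉ S)), add_zero]
          · refine Finset.sum_congr (by ext; simp) fun j hj => ?_
            rw [Finset.mem_filter] at hj
            simp [lp.single_apply, Pi.single_apply, hj.2]
          · intro j hj
            rw [if_neg]
            simp at hj; tauto
        simp_rw [e3]
        rw [Finset.prod_univ_sum, Fintype.piFinset_univ]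
        refine Finset.sum_congr rfl fun φ _ => ?_
        rw [← ite_and, Finset.prod_ite_zero]
        simp [funext_iff, forall_and]
      rw [coherentSym_apply, e2]
      simp only [RCLike.inner_apply, map_mul, map_inv₀, Complex.conj_ofReal, map_sum]
      rw [mul_comm, mul_assoc, Finset.sum_mul]
      congr 1
      refine Finset.sum_congr rfl fun φ _ => ?_
      by_cases hu : u = w ∘ φ
      · subst hu; simp only [if_true]; split_ifs <;> simp
      · simp [hu]
    rw [tsum_congr e1, tsum_mul_left] at h
    have h4 : ((Real.sqrt (n.factorial : ℝ) : ℂ))⁻¹ ≠ 0 := by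
      rw [ne_eq, inv_eq_zero, Complex.ofReal_eq_zero, Real.sqrt_eq_zero (by positivity)]
      positivity
    have h5 := (mul_eq_zero.1 h).resolve_left h4
    rw [Summable.tsum_finsetSum] at h5
    · simpa [tsum_ite_eq] using h5
    · intro φ _
      exact (hasSum_ite_eq (w ∘ φ) _).summable
  have key := alternating_sum_surjective
    (fun φ => (v : Ell2 (Σ m : ℕ, Fin m → κ)) ⟨n, w ∘ φ⟩)
  simp only [hS, mul_zero, Finset.sum_const_zero] at key
  have h6 : ∀ φ : Fin n → Fin n, (if Function.Surjective φ then
      (v : Ell2 (Σ m : ℕ, Fin m → κ)) ⟨n, w ∘ φ⟩ else 0)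
      = (if Function.Surjective φ then 1 else 0) * (v : Ell2 (Σ m : ℕ, Fin m → κ)) ⟨n, w⟩ := by
    intro φ
    split_ifs with hφ
    · have := v.2 n w (Equiv.ofBijective φ (Finite.surjective_iff_bijective.1 hφ))
      simpa using this
    · simp
  simp_rw [h6] at key
  rw [← Finset.sum_mul, eq_comm, mul_eq_zero] at key
  refine key.resolve_left ?_
  rw [Finset.sum_boole]
  exact_mod_cast Finset.card_ne_zero.2 ⟨id, by simp [Function.surjective_id]⟩

/-- The bosonic Fock space `e^ℋ = ⨁ₘ Pₘ ℋ^{⊗m}` of `ℋ = ℓ²(κ)`, as a Hilbert space. -/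
def Fock (κ : Type*) : Type _ := SymTensors κ

instance (κ : Type*) : NormedAddCommGroup (Fock κ) :=
  inferInstanceAs (NormedAddCommGroup (SymTensors κ))

instance (κ : Type*) : InnerProductSpace ℂ (Fock κ) :=
  inferInstanceAs (InnerProductSpace ℂ (SymTensors κ))

instance (κ : Type*) : CompleteSpace (Fock κ) :=
  inferInstanceAs (CompleteSpace (SymTensors κ))

/-- The coherent vector `e^ξ = ⨁ₘ (m!)^{-1/2} ξ^{⊗m}`. -/
def coherent {κ : Type*} (ξ : Ell2 κ) : Fock κ := coherentSym ξ

theorem inner_coherent {κ : Type*} (ξ η : Ell2 κ) :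
    inner ℂ (coherent ξ) (coherent η) = Complex.exp (inner ℂ ξ η) :=
  inner_coherentSym ξ η

theorem eq_zero_of_inner_coherent {κ : Type*} (v : Fock κ)
    (hv : ∀ ξ : Ell2 κ, inner ℂ (coherent ξ) v = 0) : v = 0 :=
  eq_zero_of_inner_coherentSym v hv

/-- The linear map `δ_ξ ↦ e^ξ` on finite formal combinations. -/
def coherentComb (κ : Type*) : (Ell2 κ →₀ ℂ) →ₗ[ℂ] Fock κ :=
  Finsupp.linearCombination ℂ coherent

/-- The linear map `δ_η ↦ e^{-‖ξ‖²/2 - ⟪ξ, η⟫} e^{ξ+η}` on finite formal combinations. -/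
def weylComb {κ : Type*} (ξ : Ell2 κ) : (Ell2 κ →₀ ℂ) →ₗ[ℂ] Fock κ :=
  Finsupp.linearCombination ℂ fun η =>
    Complex.exp (-(‖ξ‖ ^ 2 : ℝ) / 2 - inner ℂ ξ η) • coherent (ξ + η)

/-- The Weyl operator `W(ξ)` on the bosonic Fock space: the bounded operator with
`W(ξ) e^η = e^{-‖ξ‖²/2 - ⟪ξ, η⟫} e^{ξ+η}`; in particular `W(ξ) e^0 = e^{-‖ξ‖²/2} e^ξ`. -/
def weyl {κ : Type*} (ξ : Ell2 κ) : Fock κ →L[ℂ] Fock κ :=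
  (weylComb ξ).extendOfNorm (coherentComb κ)

theorem denseRange_coherentComb (κ : Type*) : DenseRange (coherentComb κ) := by
  have h : (LinearMap.range (coherentComb κ)).topologicalClosure = ⊤ := by
    rw [Submodule.topologicalClosure_eq_top_iff, Submodule.eq_bot_iff]
    intro v hv
    refine eq_zero_of_inner_coherent v fun ξ => ?_
    refine (Submodule.mem_orthogonal _ _).1 hv _ ⟨Finsupp.single ξ 1, ?_⟩
    simp [coherentComb]
  rw [DenseRange, ← LinearMap.coe_range]
  exact (Submodule.dense_iff_topologicalClosure_eq_top).2 h

theorem inner_weyl_coherent {κ : Type*} (ξ η ζ : Ell2 κ) :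
    inner ℂ (Complex.exp (-(‖ξ‖ ^ 2 : ℝ) / 2 - inner ℂ ξ η) • coherent (ξ + η))
      (Complex.exp (-(‖ξ‖ ^ 2 : ℝ) / 2 - inner ℂ ξ ζ) • coherent (ξ + ζ))
      = inner ℂ (coherent η) (coherent ζ) := by
  have aux : ∀ (a b : ℂ) (x y : Fock κ),
      inner ℂ (a • x) (b • y) = (starRingEnd ℂ) a * (b * inner ℂ x y) := fun a b x y => by
    rw [inner_smul_left (𝕜 := ℂ) (E := Fock κ), inner_smul_right (𝕜 := ℂ) (E := Fock κ)]
  rw [aux, inner_coherent, inner_coherent, ← Complex.exp_conj,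
    ← Complex.exp_add, ← Complex.exp_add]
  congr 1
  have h : inner ℂ ξ ξ = ((‖ξ‖ ^ 2 : ℝ) : ℂ) := by
    rw [inner_self_eq_norm_sq_to_K]; simp
  simp only [inner_add_left, inner_add_right, map_sub, map_neg, map_div₀, inner_conj_symm, h,
    Complex.conj_ofReal, Complex.conj_ofNat]
  ring

theorem norm_weylComb {κ : Type*} (ξ : Ell2 κ) (c : Ell2 κ →₀ ℂ) :
    ‖weylComb ξ c‖ = ‖coherentComb κ c‖ := by
  have h : inner ℂ (weylComb ξ c) (weylComb ξ c)
      = inner ℂ (coherentComb κ c) (coherentComb κ c) := by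
    simp only [weylComb, coherentComb, Finsupp.linearCombination_apply, Finsupp.sum,
      sum_inner, inner_sum]
    refine Finset.sum_congr rfl fun η _ => Finset.sum_congr rfl fun ζ _ => ?_
    rw [inner_smul_left (𝕜 := ℂ), inner_smul_right, inner_weyl_coherent,
      inner_smul_left (𝕜 := ℂ), inner_smul_right]
  rw [@norm_eq_sqrt_re_inner ℂ, @norm_eq_sqrt_re_inner ℂ _ _ _ _ (coherentComb κ c), h]

theorem weyl_coherent {κ : Type*} (ξ η : Ell2 κ) :
    weyl ξ (coherent η)
      = Complex.exp (-(‖ξ‖ ^ 2 : ℝ) / 2 - inner ℂ ξ η) • coherent (ξ + η) := by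
  have h := LinearMap.extendOfNorm_eq (f := weylComb ξ) (denseRange_coherentComb κ)
    ⟨1, fun c => by rw [norm_weylComb, one_mul]⟩ (Finsupp.single η 1)
  simpa [coherentComb, weylComb, weyl] using h

theorem ext_coherent {κ : Type*} {S T : Fock κ →L[ℂ] Fock κ}
    (h : ∀ ξ, S (coherent ξ) = T (coherent ξ)) : S = T := by
  refine ContinuousLinearMap.coeFn_injective
    ((denseRange_coherentComb κ).equalizer S.continuous T.continuous (funext fun c => ?_))
  simp [coherentComb, Finsupp.linearCombination_apply, Finsupp.sum, map_sum, h]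

/-- The Weyl relations `W(ξ) W(η) = e^{-i Im⟪ξ, η⟫} W(ξ + η)`. -/
theorem weyl_mul {κ : Type*} (ξ η : Ell2 κ) :
    weyl ξ * weyl η = Complex.exp (-Complex.I * (inner ℂ ξ η).im) • weyl (ξ + η) := by
  refine ext_coherent fun ζ => ?_
  rw [mul_apply_eq_comp, weyl_coherent, map_smul, weyl_coherent,
    smul_apply, weyl_coherent, smul_smul, smul_smul, ← Complex.exp_add,
    ← Complex.exp_add, add_assoc]
  congr 2
  have h : ((‖ξ + η‖ ^ 2 : ℝ) : ℂ)
      = (‖ξ‖ ^ 2 : ℝ) + 2 * ((inner ℂ ξ η).re : ℂ) + (‖η‖ ^ 2 : ℝ) := by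
    rw [@norm_add_sq ℂ]; simp
  rw [h]
  simp only [inner_add_left, inner_add_right]
  have h2 := Complex.re_add_im (inner ℂ ξ η)
  linear_combination h2

theorem weyl_zero (κ : Type*) : weyl (0 : Ell2 κ) = 1 := by
  refine ext_coherent fun ζ => ?_
  simp [weyl_coherent]

theorem weyl_mul_weyl_neg {κ : Type*} (ξ : Ell2 κ) : weyl ξ * weyl (-ξ) = 1 := by
  have h : (inner ℂ ξ ξ).im = 0 := inner_self_im (𝕜 := ℂ) ξ
  rw [weyl_mul, inner_neg_right, Complex.neg_im, h]
  simp [weyl_zero]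

theorem star_weyl {κ : Type*} (ξ : Ell2 κ) : star (weyl ξ) = weyl (-ξ) := by
  have hiso : star (weyl ξ) * weyl ξ = 1 := by
    rw [ContinuousLinearMap.star_eq_adjoint]
    refine (ContinuousLinearMap.norm_map_iff_adjoint_comp_self (weyl ξ)).1 fun x => ?_
    refine (denseRange_coherentComb κ).induction_on x
      (isClosed_eq (by fun_prop) (by fun_prop)) fun c => ?_
    rw [weyl, LinearMap.extendOfNorm_eq (denseRange_coherentComb κ)
      ⟨1, fun c => by rw [norm_weylComb, one_mul]⟩, norm_weylComb]
  calc star (weyl ξ) = star (weyl ξ) * (weyl ξ * weyl (-ξ)) := by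
        rw [weyl_mul_weyl_neg, mul_one]
    _ = weyl (-ξ) := by rw [← mul_assoc, hiso, one_mul]

/-! ### Smooth loops and the one-particle space -/

/-- Smooth functions `S¹ → E`, regarded as smooth `2π`-periodic functions `θ ↦ f(e^{iθ})`. -/
structure SmoothLoop (E : Type*) [NormedAddCommGroup E] [NormedSpace ℝ E] where
  /-- The underlying `2π`-periodic function. -/
  toFun : ℝ → E
  smooth : ContDiff ℝ ∞ toFun
  periodic : Function.Periodic toFun (2 * Real.pi)

instance (E : Type*) [NormedAddCommGroup E] [NormedSpace ℝ E] :
    CoeFun (SmoothLoop E) (fun _ => ℝ → E) := ⟨SmoothLoop.toFun⟩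

/-- For a scalar loop `h` and a vector `q`, the loop `h · q`. -/
def SmoothLoop.smulVec {E : Type*} [NormedAddCommGroup E] [NormedSpace ℝ E]
    (h : SmoothLoop ℝ) (q : E) : SmoothLoop E where
  toFun θ := h θ • q
  smooth := h.smooth.smul contDiff_const
  periodic θ := by simp [h.periodic θ]

/-- The charge `(2π)⁻¹ ∫₀^{2π} h(θ) dθ` of a loop. -/
def SmoothLoop.charge (h : SmoothLoop ℝ) : ℝ := (2 * Real.pi)⁻¹ * ∫ θ in (0)..(2 * Real.pi), h θ

/-- The `n`-dimensional Euclidean space `F`. -/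
abbrev Euc (n : ℕ) : Type := EuclideanSpace ℝ (Fin n)

/-- The `j`-th component of the Fourier coefficient
`f̂_k = (2π)⁻¹ ∫₀^{2π} f(θ) e^{-ikθ} dθ ∈ F ⊗ ℂ = ℂⁿ`. -/
def SmoothLoop.coeff {n : ℕ} (f : SmoothLoop (Euc n)) (k : ℤ) (j : Fin n) : ℂ :=
  (2 * Real.pi : ℂ)⁻¹ *
    ∫ θ in (0)..(2 * Real.pi), (f θ j : ℂ) * Complex.exp (-Complex.I * k * θ)

theorem integral_mul_exp_eq (g g' : ℝ → ℂ) (hg : ∀ θ, HasDerivAt g (g' θ) θ)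
    (hg' : Continuous g') (hp : g (2 * Real.pi) = g 0) (k : ℤ) (hk : k ≠ 0) :
    ∫ θ in (0)..(2 * Real.pi), g θ * Complex.exp (-Complex.I * k * θ)
      = (Complex.I * k)⁻¹ *
        ∫ θ in (0)..(2 * Real.pi), g' θ * Complex.exp (-Complex.I * k * θ) := by
  have hI : Complex.I * k ≠ 0 := mul_ne_zero Complex.I_ne_zero (by exact_mod_cast hk)
  have hv : ∀ θ : ℝ, HasDerivAt
      (fun θ : ℝ => -(Complex.I * k)⁻¹ * Complex.exp (-Complex.I * k * θ))
      (Complex.exp (-Complex.I * k * θ)) θ := by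
    intro θ
    have h1 : HasDerivAt (fun θ : ℝ => -Complex.I * k * (θ : ℂ)) (-Complex.I * k * 1) θ :=
      (Complex.ofRealCLM.hasDerivAt (x := θ)).const_mul _
    refine ((h1.cexp).const_mul (-(Complex.I * k)⁻¹)).congr_deriv ?_
    rw [mul_one, show ∀ x : ℂ, -(Complex.I * (k : ℂ))⁻¹ * (x * (-Complex.I * k))
      = (Complex.I * (k : ℂ))⁻¹ * (Complex.I * k) * x from fun x => by ring,
      inv_mul_cancel₀ hI, one_mul]
  have he : Complex.exp (-Complex.I * k * ((2 * Real.pi : ℝ) : ℂ)) = 1 := by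
    rw [Complex.exp_eq_one_iff]
    exact ⟨-k, by push_cast; ring⟩
  rw [intervalIntegral.integral_mul_deriv_eq_deriv_mul (fun θ _ => hg θ) (fun θ _ => hv θ)
    (hg'.intervalIntegrable _ _) (Continuous.intervalIntegrable (by fun_prop) _ _)]
  rw [he, hp]
  simp only [Complex.ofReal_zero, mul_zero, Complex.exp_zero, sub_self, zero_sub]
  rw [← intervalIntegral.integral_const_mul, ← intervalIntegral.integral_neg]
  congr 1
  funext θ
  ring

theorem SmoothLoop.exists_coeff_bound {n : ℕ} (f : SmoothLoop (Euc n)) (j : Fin n) :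
    ∃ C : ℝ, 0 ≤ C ∧ ∀ k : ℤ, k ≠ 0 → ‖f.coeff k j‖ ≤ C / (k : ℝ) ^ 2 := by
  have hg : ContDiff ℝ ∞ (fun θ => (f θ j : ℂ)) := by
    have h1 : ContDiff ℝ ∞ (fun θ => f θ j) :=
      (EuclideanSpace.proj (𝕜 := ℝ) j).contDiff.comp f.smooth
    exact Complex.ofRealCLM.contDiff.comp h1
  have hgp : Function.Periodic (fun θ => (f θ j : ℂ)) (2 * Real.pi) := fun θ => by
    simp [f.periodic θ]
  set g : ℝ → ℂ := fun θ => (f θ j : ℂ) with hgdef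
  have hper : ∀ u : ℝ → ℂ, Function.Periodic u (2 * Real.pi) →
      Function.Periodic (deriv u) (2 * Real.pi) := fun u hu θ => by
    rw [← deriv_comp_add_const, funext hu]
  have hd1 : ContDiff ℝ ∞ (deriv g) := (contDiff_infty_iff_deriv.1 hg).2
  have hd2 : ContDiff ℝ ∞ (deriv (deriv g)) := (contDiff_infty_iff_deriv.1 hd1).2
  obtain ⟨B, hB⟩ := (isCompact_Icc (a := (0 : ℝ)) (b := 2 * Real.pi)).exists_bound_of_continuousOn
    hd2.continuous.continuousOn
  have hpi : (0 : ℝ) ≤ 2 * Real.pi := by positivity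
  have hB0 : 0 ≤ B := (norm_nonneg _).trans (hB 0 ⟨le_rfl, hpi⟩)
  refine ⟨B, hB0, fun k hk => ?_⟩
  have e1 := integral_mul_exp_eq g (deriv g)
    (fun θ => (hg.differentiable (by simp) θ).hasDerivAt) hd1.continuous
    (by simpa using hgp 0) k hk
  have e2 := integral_mul_exp_eq (deriv g) (deriv (deriv g))
    (fun θ => (hd1.differentiable (by simp) θ).hasDerivAt) hd2.continuous
    (by simpa using hper g hgp 0) k hk
  have e3 : ‖∫ θ in (0)..(2 * Real.pi), deriv (deriv g) θ * Complex.exp (-Complex.I * k * θ)‖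
      ≤ B * |2 * Real.pi - 0| := by
    refine intervalIntegral.norm_integral_le_of_norm_le_const fun θ hθ => ?_
    rw [Set.uIoc_of_le hpi] at hθ
    rw [norm_mul]
    have : ‖Complex.exp (-Complex.I * k * θ)‖ = 1 := by
      rw [Complex.norm_exp]; simp
    rw [this, mul_one]
    exact hB θ ⟨hθ.1.le, hθ.2⟩
  rw [sub_zero, abs_of_nonneg hpi] at e3
  rw [SmoothLoop.coeff, e1, e2]
  simp only [norm_mul, norm_inv, Complex.norm_I, one_mul, Complex.norm_intCast,
    Complex.norm_real, Complex.norm_ofNat, Real.norm_eq_abs, abs_of_pos Real.pi_pos]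
  have hk' : (0 : ℝ) < |(k : ℝ)| := abs_pos.2 (by exact_mod_cast hk)
  calc (2 * Real.pi)⁻¹ * (|(k : ℝ)|⁻¹ * (|(k : ℝ)|⁻¹ *
        ‖∫ θ in (0)..(2 * Real.pi), deriv (deriv g) θ * Complex.exp (-Complex.I * k * θ)‖))
      ≤ (2 * Real.pi)⁻¹ * (|(k : ℝ)|⁻¹ * (|(k : ℝ)|⁻¹ * (B * (2 * Real.pi)))) := by
        gcongr
    _ = B / (k : ℝ) ^ 2 := by
        rw [← sq_abs (k : ℝ)]
        have := Real.pi_pos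
        field_simp

theorem SmoothLoop.memlp_vec {n : ℕ} (f : SmoothLoop (Euc n)) :
    Memℓp (fun x : ℕ × Fin n =>
      (Real.sqrt ((x.1 : ℝ) + 1) : ℂ) * f.coeff (-((x.1 : ℤ) + 1)) x.2) 2 := by
  apply memℓp_gen
  choose C hC0 hC using f.exists_coeff_bound
  have hs1 : Summable fun k : ℕ => (((k : ℝ) + 1) ^ 2)⁻¹ := by
    have := (summable_nat_add_iff 1).2 (Real.summable_nat_pow_inv.2 one_lt_two)
    exact_mod_cast this
  have hs2 : Summable fun j : Fin n => C j ^ 2 := (hasSum_fintype _).summable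
  have hs := hs1.mul_of_nonneg hs2 (fun k => by positivity) (fun j => by positivity)
  refine Summable.of_nonneg_of_le (fun x => by positivity) (fun x => ?_) hs
  obtain ⟨k, j⟩ := x
  simp only [ENNReal.toReal_ofNat, Real.rpow_ofNat, norm_mul, mul_pow, Complex.norm_real,
    Real.norm_eq_abs, sq_abs]
  have h1 : (0 : ℝ) < (k : ℝ) + 1 := by positivity
  have h2 := hC j (-((k : ℤ) + 1)) (by omega)
  rw [Real.sq_sqrt h1.le]
  push_cast at h2
  rw [neg_sq] at h2
  calc ((k : ℝ) + 1) * ‖f.coeff (-((k : ℤ) + 1)) j‖ ^ 2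
      ≤ ((k : ℝ) + 1) * (C j / ((k : ℝ) + 1) ^ 2) ^ 2 := by gcongr
    _ = (((k : ℝ) + 1) ^ 3)⁻¹ * C j ^ 2 := by field_simp
    _ ≤ (((k : ℝ) + 1) ^ 2)⁻¹ * C j ^ 2 := by
        gcongr
        · linarith [(Nat.cast_nonneg k : (0 : ℝ) ≤ k)]
        · norm_num

/-- Index set of a Hilbert basis of the one-particle space: the pair `(k, j)` stands for the
Fourier mode of degree `k + 1 ≥ 1` and the `j`-th coordinate of `F = ℝⁿ`. -/
abbrev Mode (n : ℕ) : Type := ℕ × Fin n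

/-- The class `[f]` of a loop `f` in the one-particle space, the Hilbert space completion of
`C^∞(S¹, F)/F` for the norm `‖f‖² = ∑_{k ≥ 1} k ‖f̂_k‖²` and the complex structure
`(𝔍f)^_k = -i sign(k) f̂_k`.  As `f̂_k` is the complex conjugate of `f̂_{-k}`, the map
`f ↦ (√k f̂_{-k})_{k ≥ 1}` is norm preserving, has dense range, and intertwines `𝔍` with
multiplication by `i`, so that the completion is `ℓ²({1, 2, …} × {1, …, n})`. -/
def SmoothLoop.vec {n : ℕ} (f : SmoothLoop (Euc n)) : Ell2 (Mode n) := ⟨_, f.memlp_vec⟩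

/-! ### Intervals of the circle -/

/-- A proper interval of `S¹`: a non-empty, non-dense, connected open subset. -/
structure ProperInterval where
  /-- The underlying set. -/
  carrier : Set Circle
  isOpen : IsOpen carrier
  isConnected : IsConnected carrier
  not_dense : ¬ Dense carrier

/-- The closed support of the loop `f` is contained in the subset `K` of the circle. -/
def SmoothLoop.SupportedIn {E : Type*} [NormedAddCommGroup E] [NormedSpace ℝ E]
    (f : SmoothLoop E) (K : Set Circle) : Prop :=
  tsupport f.toFun ⊆ Circle.exp ⁻¹' K

/-- The function `h` on the circle is localized in `J`: it vanishes on the complementary interval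
`J' = S¹ ∖ closure J`. -/
def LocalizedIn {E : Type*} [Zero E] (h : ℝ → E) (J : ProperInterval) : Prop :=
  ∀ θ, Circle.exp θ ∉ closure J.carrier → h θ = 0

/-- On a proper interval every loop has a primitive which extends to a smooth loop. -/
theorem exists_primitive {E : Type*} [NormedAddCommGroup E] [NormedSpace ℝ E] [CompleteSpace E]
    (ℓ : SmoothLoop E) (K : ProperInterval) :
    ∃ M : SmoothLoop E, ∀ θ, Circle.exp θ ∈ K.carrier → deriv M.toFun θ = ℓ θ := by
  obtain ⟨z, hz⟩ : ∃ z, z ∉ closure K.carrier := by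
    by_contra! h
    exact K.not_dense h
  obtain ⟨t, rfl⟩ := Circle.exp_surjective z
  have hopen : IsOpen (Circle.exp ⁻¹' (closure K.carrier)ᶜ) :=
    isClosed_closure.isOpen_compl.preimage Circle.exp.continuous
  obtain ⟨ε, hε, hball⟩ := Metric.isOpen_iff.1 hopen t hz
  set δ := min (ε / 2) 1 with hδ
  have hδ0 : 0 < δ := lt_min (by positivity) one_pos
  have hδ1 : δ < Real.pi := (min_le_right _ _).trans_lt (by linarith [Real.pi_gt_three])
  have hδε : δ < ε := (min_le_left _ _).trans_lt (by linarith)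
  let β : ℝ → ℝ := fun θ => expNegInvGlue (Real.cos (θ - t) - Real.cos δ)
  have hβs : ContDiff ℝ ∞ β := expNegInvGlue.contDiff.comp (by fun_prop)
  have hβp : Function.Periodic β (2 * Real.pi) := fun θ => by
    have : θ + 2 * Real.pi - t = θ - t + 2 * Real.pi := by ring
    simp only [β, this, Real.cos_add_two_pi]
  have hβ0 : ∀ θ, 0 ≤ β θ := fun θ => expNegInvGlue.nonneg _
  have hβt : 0 < β t := by
    apply expNegInvGlue.pos_of_pos
    have := Real.cos_lt_cos_of_nonneg_of_le_pi le_rfl hδ1.le hδ0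
    simp only [sub_self]
    linarith
  have hβK : ∀ θ, Circle.exp θ ∈ K.carrier → β θ = 0 := by
    intro θ hθ
    apply expNegInvGlue.zero_of_nonpos
    by_contra! hcon
    obtain ⟨m, hm⟩ : ∃ m : ℤ, |θ - t - m * (2 * Real.pi)| ≤ Real.pi := by
      refine ⟨round ((θ - t) / (2 * Real.pi)), ?_⟩
      have h := abs_sub_round ((θ - t) / (2 * Real.pi))
      have h2 : θ - t - round ((θ - t) / (2 * Real.pi)) * (2 * Real.pi)
          = ((θ - t) / (2 * Real.pi) - round ((θ - t) / (2 * Real.pi))) * (2 * Real.pi) := by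
        field_simp
      rw [h2, abs_mul, abs_of_pos (by positivity : (0 : ℝ) < 2 * Real.pi)]
      nlinarith [Real.pi_pos]
    set s := θ - t - m * (2 * Real.pi) with hs
    have hcos : Real.cos s = Real.cos (θ - t) := Real.cos_sub_int_mul_two_pi _ _
    have hlt : |s| < δ := by
      by_contra! hle
      have := Real.cos_le_cos_of_nonneg_of_le_pi hδ0.le hm hle
      rw [Real.cos_abs, hcos] at this
      linarith
    have hmem : t + s ∈ Metric.ball t ε := by
      rw [Metric.mem_ball, Real.dist_eq]
      simpa using hlt.trans hδε
    have := hball hmem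
    have hexp : Circle.exp (t + s) = Circle.exp θ :=
      Circle.exp_eq_exp.2 ⟨-m, by rw [hs]; push_cast; ring⟩
    rw [Set.mem_preimage, hexp] at this
    exact this (subset_closure hθ)
  set c : ℝ := ∫ θ in (t)..(t + 2 * Real.pi), β θ with hc
  have hc0 : 0 < c := by
    refine intervalIntegral.integral_pos (by linarith [Real.pi_pos]) hβs.continuous.continuousOn
      (fun θ _ => hβ0 θ) ⟨t, ⟨le_rfl, by linarith [Real.pi_pos]⟩, hβt⟩
  set v : E := ∫ θ in (t)..(t + 2 * Real.pi), ℓ θ with hv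
  let g : ℝ → E := fun θ => ℓ θ - (β θ * c⁻¹) • v
  have hgs : ContDiff ℝ ∞ g :=
    ℓ.smooth.sub ((hβs.mul contDiff_const).smul contDiff_const)
  have hgp : Function.Periodic g (2 * Real.pi) := fun θ => by
    simp only [g, ℓ.periodic θ, hβp θ]
  have hg0 : ∫ θ in (t)..(t + 2 * Real.pi), g θ = 0 := by
    have hi1 : IntervalIntegrable ℓ.toFun volume t (t + 2 * Real.pi) :=
      ℓ.smooth.continuous.intervalIntegrable _ _
    have hi2 : IntervalIntegrable (fun θ => (β θ * c⁻¹) • v) volume t (t + 2 * Real.pi) :=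
      Continuous.intervalIntegrable
        ((hβs.continuous.mul continuous_const).smul continuous_const) _ _
    rw [intervalIntegral.integral_sub hi1 hi2, intervalIntegral.integral_smul_const,
      intervalIntegral.integral_mul_const, ← hc, mul_inv_cancel₀ hc0.ne', one_smul, ← hv,
      sub_self]
  have hderiv : ∀ θ, HasDerivAt (fun x => ∫ y in (t)..x, g y) (g θ) θ := fun θ =>
    intervalIntegral.integral_hasDerivAt_right (hgs.continuous.intervalIntegrable _ _)
      (hgs.continuous.stronglyMeasurableAtFilter _ _) hgs.continuous.continuousAt
  have hder : deriv (fun x => ∫ y in (t)..x, g y) = g := funext fun θ => (hderiv θ).deriv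
  refine ⟨⟨fun x => ∫ y in (t)..x, g y, ?_, ?_⟩, fun θ hθ => ?_⟩
  · rw [contDiff_infty_iff_deriv, hder]
    exact ⟨fun θ => (hderiv θ).differentiableAt, hgs⟩
  · intro x
    have h1 := intervalIntegral.integral_add_adjacent_intervals
      (hgs.continuous.intervalIntegrable (μ := volume) t x)
      (hgs.continuous.intervalIntegrable (μ := volume) x (x + 2 * Real.pi))
    simp only
    rw [← h1, hgp.intervalIntegral_add_eq x t, hg0, add_zero]
  · show deriv (fun x => ∫ y in (t)..x, g y) θ = ℓ θ
    rw [hder]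
    simp [g, hβK θ hθ]

/-- A smooth loop which is a primitive of `ℓ` on the interval `K`. -/
def primitive {E : Type*} [NormedAddCommGroup E] [NormedSpace ℝ E] [CompleteSpace E]
    (ℓ : SmoothLoop E) (K : ProperInterval) : SmoothLoop E := (exists_primitive ℓ K).choose

/-! ### Von Neumann algebras generated by sets, and the conformal net `𝒜_F` -/

/-- The von Neumann algebra generated by a set `S` of bounded operators: the double commutant of
`S ∪ S*`. -/
def vonNeumannGenerated {H : Type*} [NormedAddCommGroup H] [InnerProductSpace ℂ H]
    [CompleteSpace H] (S : Set (H →L[ℂ] H)) : VonNeumannAlgebra H where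
  toStarSubalgebra := StarSubalgebra.centralizer ℂ
    (StarSubalgebra.centralizer ℂ S : Set (H →L[ℂ] H))
  centralizer_centralizer' := by
    change Set.centralizer (Set.centralizer
      ((StarSubalgebra.centralizer ℂ (StarSubalgebra.centralizer ℂ S : Set (H →L[ℂ] H)) :
        StarSubalgebra ℂ (H →L[ℂ] H)) : Set (H →L[ℂ] H))) = _
    rw [StarSubalgebra.coe_centralizer_centralizer]
    simp only [Set.centralizer_centralizer_centralizer]
    exact (StarSubalgebra.coe_centralizer_centralizer ℂ S).symm

theorem subset_vonNeumannGenerated {H : Type*} [NormedAddCommGroup H] [InnerProductSpace ℂ H]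
    [CompleteSpace H] (S : Set (H →L[ℂ] H)) :
    S ⊆ (vonNeumannGenerated S : Set (H →L[ℂ] H)) := by
  intro s hs
  show s ∈ ((StarSubalgebra.centralizer ℂ (StarSubalgebra.centralizer ℂ S : Set (H →L[ℂ] H)) :
    StarSubalgebra ℂ (H →L[ℂ] H)) : Set (H →L[ℂ] H))
  rw [StarSubalgebra.coe_centralizer_centralizer]
  exact Set.subset_centralizer_centralizer (Or.inl hs)

theorem mem_vonNeumannGenerated_iff {H : Type*} [NormedAddCommGroup H] [InnerProductSpace ℂ H]
    [CompleteSpace H] (S : Set (H →L[ℂ] H)) (a : H →L[ℂ] H) :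
    a ∈ vonNeumannGenerated S ↔
      ∀ y : H →L[ℂ] H, (∀ s ∈ S, s * y = y * s ∧ star s * y = y * star s) → y * a = a * y := by
  change a ∈ ((StarSubalgebra.centralizer ℂ (StarSubalgebra.centralizer ℂ S :
    Set (H →L[ℂ] H)) : StarSubalgebra ℂ (H →L[ℂ] H)) : Set (H →L[ℂ] H)) ↔ _
  rw [StarSubalgebra.coe_centralizer_centralizer, Set.mem_centralizer_iff]
  refine forall_congr' fun y => imp_congr_left ?_
  rw [← StarSubalgebra.coe_centralizer ℂ, SetLike.mem_coe, StarSubalgebra.mem_centralizer_iff]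

instance {H : Type*} [NormedAddCommGroup H] [InnerProductSpace ℂ H] [CompleteSpace H] :
    SMulMemClass (VonNeumannAlgebra H) ℂ (H →L[ℂ] H) where
  smul_mem {M} c _ ha := M.toStarSubalgebra.smul_mem ha c

instance {H : Type*} [NormedAddCommGroup H] [InnerProductSpace ℂ H] [CompleteSpace H]
    (M : VonNeumannAlgebra H) : IsClosed (M : Set (H →L[ℂ] H)) := by
  rw [← M.centralizer_centralizer]
  exact Set.isClosed_centralizer _

/-- The Hilbert space on which the net `𝒜_F`, `F = ℝⁿ`, acts: the bosonic Fock space of the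
one-particle space. -/
abbrev FockF (n : ℕ) : Type := Fock (Mode n)

/-- The local algebra `𝒜_F(K) = {W([f]) : f ∈ C^∞(S¹, F), supp f ⊆ K}''`. -/
def localAlg (n : ℕ) (K : ProperInterval) : VonNeumannAlgebra (FockF n) :=
  vonNeumannGenerated {T | ∃ f : SmoothLoop (Euc n), f.SupportedIn K.carrier ∧ T = weyl f.vec}

/-- The Weyl unitary `W([f])` with `supp f ⊆ K` as an element of `𝒜_F(K)`. -/
def localWeyl {n : ℕ} (K : ProperInterval) (f : SmoothLoop (Euc n))
    (hf : f.SupportedIn K.carrier) : localAlg n K :=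
  ⟨weyl f.vec, subset_vonNeumannGenerated _ ⟨f, hf, rfl⟩⟩

/-- `Ad W(ξ)` maps each local algebra into itself. -/
theorem weyl_conj_mem {n : ℕ} (K : ProperInterval) (ξ : Ell2 (Mode n))
    {a : FockF n →L[ℂ] FockF n} (ha : a ∈ localAlg n K) :
    weyl ξ * a * weyl (-ξ) ∈ localAlg n K := by
  have h1 : weyl ξ * weyl (-ξ) = 1 := weyl_mul_weyl_neg ξ
  have h2 : weyl (-ξ) * weyl ξ = 1 := by simpa using weyl_mul_weyl_neg (-ξ)
  have hcomm : ∀ η : Ell2 (Mode n), ∃ c : ℂ, c ≠ 0 ∧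
      weyl ξ * weyl η = c • (weyl η * weyl ξ) := by
    intro η
    refine ⟨Complex.exp (-Complex.I * (inner ℂ ξ η).im) *
      (Complex.exp (-Complex.I * (inner ℂ η ξ).im))⁻¹, by simp, ?_⟩
    rw [weyl_mul, weyl_mul η ξ, smul_smul, mul_assoc, inv_mul_cancel₀ (Complex.exp_ne_zero _),
      mul_one, add_comm]
  rw [localAlg, mem_vonNeumannGenerated_iff] at ha ⊢
  intro y hy
  have key : ∀ η : Ell2 (Mode n), weyl η * y = y * weyl η →
      weyl η * (weyl (-ξ) * y * weyl ξ) = (weyl (-ξ) * y * weyl ξ) * weyl η := by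
    intro η hη
    obtain ⟨c, hc, hcη⟩ := hcomm η
    have e1 : weyl η * weyl (-ξ) = c • (weyl (-ξ) * weyl η) := by
      calc weyl η * weyl (-ξ) = weyl (-ξ) * (weyl ξ * weyl η) * weyl (-ξ) := by
            rw [← mul_assoc, h2, one_mul]
        _ = c • (weyl (-ξ) * weyl η) := by
            rw [hcη, mul_smul_comm, smul_mul_assoc, mul_assoc, mul_assoc, h1, mul_one]
    calc weyl η * (weyl (-ξ) * y * weyl ξ)
        = (weyl η * weyl (-ξ)) * y * weyl ξ := by simp only [mul_assoc]
      _ = weyl (-ξ) * (weyl η * y) * (c • weyl ξ) := by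
          rw [e1]; simp only [smul_mul_assoc, mul_smul_comm, mul_assoc]
      _ = weyl (-ξ) * y * (c • (weyl η * weyl ξ)) := by
          rw [hη]; simp only [mul_smul_comm, mul_assoc]
      _ = weyl (-ξ) * y * weyl ξ * weyl η := by
          rw [← hcη]; simp only [mul_assoc]
  have hy' := ha (weyl (-ξ) * y * weyl ξ) ?_
  · calc y * (weyl ξ * a * weyl (-ξ))
        = weyl ξ * ((weyl (-ξ) * y * weyl ξ) * a) * weyl (-ξ) := by
          simp only [← mul_assoc]; rw [h1, one_mul]
      _ = weyl ξ * (a * (weyl (-ξ) * y * weyl ξ)) * weyl (-ξ) := by rw [hy']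
      _ = weyl ξ * a * weyl (-ξ) * y := by
          simp only [mul_assoc]; rw [h1, mul_one]
  · rintro _ ⟨f, hf, rfl⟩
    obtain ⟨q1, q2⟩ := hy _ ⟨f, hf, rfl⟩
    rw [star_weyl] at q2 ⊢
    exact ⟨key _ q1, key _ q2⟩

/-- The automorphism `Ad W(ξ)` of the local algebra `𝒜_F(K)`. -/
def weylAd {n : ℕ} (K : ProperInterval) (ξ : Ell2 (Mode n)) :
    localAlg n K ≃⋆ₐ[ℂ] localAlg n K where
  toFun a := ⟨weyl ξ * a * weyl (-ξ), weyl_conj_mem K ξ a.2⟩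
  invFun a := ⟨weyl (-ξ) * a * weyl ξ, by simpa using weyl_conj_mem K (-ξ) a.2⟩
  left_inv a := by
    have h2 : weyl (-ξ) * weyl ξ = 1 := by simpa using weyl_mul_weyl_neg (-ξ)
    apply Subtype.ext
    show weyl (-ξ) * (weyl ξ * (a : FockF n →L[ℂ] FockF n) * weyl (-ξ)) * weyl ξ = a
    rw [← mul_assoc, ← mul_assoc, h2, one_mul, mul_assoc, h2, mul_one]
  right_inv a := by
    have h1 : weyl ξ * weyl (-ξ) = 1 := weyl_mul_weyl_neg ξ
    apply Subtype.ext
    show weyl ξ * (weyl (-ξ) * (a : FockF n →L[ℂ] FockF n) * weyl ξ) * weyl (-ξ) = a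
    rw [← mul_assoc, ← mul_assoc, h1, one_mul, mul_assoc, h1, mul_one]
  map_mul' a b := by
    have h2 : weyl (-ξ) * weyl ξ = 1 := by simpa using weyl_mul_weyl_neg (-ξ)
    apply Subtype.ext
    show weyl ξ * ((a : FockF n →L[ℂ] FockF n) * b) * weyl (-ξ)
      = weyl ξ * a * weyl (-ξ) * (weyl ξ * b * weyl (-ξ))
    simp only [mul_assoc]
    rw [← mul_assoc (weyl (-ξ)) (weyl ξ), h2, one_mul]
  map_add' a b := by
    apply Subtype.ext
    show weyl ξ * ((a : FockF n →L[ℂ] FockF n) + b) * weyl (-ξ) = _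
    rw [mul_add, add_mul]; rfl
  map_star' a := by
    apply Subtype.ext
    show weyl ξ * star (a : FockF n →L[ℂ] FockF n) * weyl (-ξ)
      = star (weyl ξ * (a : FockF n →L[ℂ] FockF n) * weyl (-ξ))
    rw [star_mul, star_mul, star_weyl, star_weyl, neg_neg, mul_assoc]
  map_smul' c a := by
    apply Subtype.ext
    show weyl ξ * (c • (a : FockF n →L[ℂ] FockF n)) * weyl (-ξ) = c • _
    rw [mul_smul_comm, smul_mul_assoc]

/-- The localized automorphism `ρ_{ℓ,K} = Ad W([M])` of `𝒜_F(K)`, where `M` is a smooth loop with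
`M' = ℓ` on `K`. On Weyl unitaries it acts as `W([f]) ↦ e^{i ∫ ⟨f, ℓ⟩} W([f])`. -/
def gaugeAut {n : ℕ} (ℓ : SmoothLoop (Euc n)) (K : ProperInterval) :
    localAlg n K ≃⋆ₐ[ℂ] localAlg n K :=
  weylAd K (primitive ℓ K).vec

/-! ### Twisted crossed products -/

/-- The Hilbert space `⨁_{x ∈ G} H`. -/
abbrev CrossedSpace (G H : Type*) [NormedAddCommGroup H] : Type _ := lp (fun _ : G => H) 2

/-- The diagonal operator `(ξ_x)_x ↦ (T_x ξ_x)_x` of a uniformly bounded family `T`. -/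
def diagOp {G H : Type*} [NormedAddCommGroup H] [InnerProductSpace ℂ H]
    (T : G → (H →L[ℂ] H)) (C : ℝ) (hC : 0 ≤ C) (hT : ∀ x, ‖T x‖ ≤ C) :
    CrossedSpace G H →L[ℂ] CrossedSpace G H :=
  LinearMap.mkContinuous
    { toFun := fun ξ => ⟨fun x => T x (ξ x), by
        apply memℓp_gen
        have h := (lp.memℓp ξ).summable (by norm_num)
        simp only [ENNReal.toReal_ofNat, Real.rpow_ofNat] at h ⊢
        refine Summable.of_nonneg_of_le (fun x => by positivity) (fun x => ?_) (h.mul_left (C ^ 2))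
        rw [← mul_pow]
        gcongr
        exact (T x).le_of_opNorm_le (hT x) _⟩
      map_add' := fun ξ η => lp.ext (funext fun x => map_add (T x) (ξ x) (η x))
      map_smul' := fun c ξ => lp.ext (funext fun x => map_smul (T x) c (ξ x)) } C (by
    intro ξ
    refine lp.norm_le_of_forall_sum_le (p := 2) (by norm_num) (by positivity) fun s => ?_
    simp only [ENNReal.toReal_ofNat, Real.rpow_ofNat]
    have h := lp.sum_rpow_le_norm_rpow (p := 2) (by norm_num) ξ s
    simp only [ENNReal.toReal_ofNat, Real.rpow_ofNat] at h
    calc ∑ x ∈ s, ‖T x (ξ x)‖ ^ 2 ≤ ∑ x ∈ s, C ^ 2 * ‖ξ x‖ ^ 2 := by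
          refine Finset.sum_le_sum fun x _ => ?_
          rw [← mul_pow]
          gcongr
          exact (T x).le_of_opNorm_le (hT x) _
      _ ≤ (C * ‖ξ‖) ^ 2 := by rw [← Finset.mul_sum, mul_pow]; gcongr)

theorem diagOp_apply {G H : Type*} [NormedAddCommGroup H] [InnerProductSpace ℂ H]
    (T : G → (H →L[ℂ] H)) (C : ℝ) (hC : 0 ≤ C) (hT : ∀ x, ‖T x‖ ≤ C)
    (ξ : CrossedSpace G H) (x : G) : diagOp T C hC hT ξ x = T x (ξ x) := rfl

/-- The unitary `ψ_g` implementing `g` in the crossed product twisted by `b`: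
`(ψ_g ξ)_x = b(g, x - g) ξ_{x - g}`. -/
def implementer {G H : Type*} [AddCommGroup G] [NormedAddCommGroup H] [InnerProductSpace ℂ H]
    (b : G → G → Circle) (g : G) : CrossedSpace G H →L[ℂ] CrossedSpace G H :=
  LinearMap.mkContinuous
    { toFun := fun ξ => ⟨fun x => (b g (x - g) : ℂ) • ξ (x - g), by
        apply memℓp_gen
        have h := (lp.memℓp ξ).summable (by norm_num)
        refine ((Equiv.subRight g).summable_iff.2 h).congr fun x => ?_
        show ‖ξ (x - g)‖ ^ _ = ‖(b g (x - g) : ℂ) • ξ (x - g)‖ ^ _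
        rw [norm_smul, Circle.norm_coe, one_mul]⟩
      map_add' := fun ξ η => lp.ext (funext fun x => smul_add _ (ξ (x - g)) (η (x - g)))
      map_smul' := fun c ξ => lp.ext (funext fun x => smul_comm _ c (ξ (x - g))) } 1 (by
    intro ξ
    rw [one_mul, lp.norm_eq_tsum_rpow (by norm_num), lp.norm_eq_tsum_rpow (by norm_num) ξ]
    apply le_of_eq
    congr 1
    rw [← (Equiv.subRight g).tsum_eq (fun x => ‖ξ x‖ ^ (2 : ENNReal).toReal)]
    refine tsum_congr fun x => ?_
    show ‖(b g (x - g) : ℂ) • ξ (x - g)‖ ^ _ = ‖ξ (x - g)‖ ^ _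
    rw [norm_smul, Circle.norm_coe, one_mul])

/-- The representation `ι` of `M` on `⨁_{x ∈ G} H` belonging to an action `α` of `G` by
automorphisms: `(ι(a) ξ)_x = α_{-x}(a) ξ_x`. -/
def crossedRep {G H : Type*} [AddCommGroup G] [NormedAddCommGroup H] [InnerProductSpace ℂ H]
    [CompleteSpace H] (M : VonNeumannAlgebra H) (α : G → (M ≃⋆ₐ[ℂ] M)) :
    M →⋆ₐ[ℂ] (CrossedSpace G H →L[ℂ] CrossedSpace G H) where
  toFun a := diagOp (fun x => (α (-x) a : H →L[ℂ] H)) ‖a‖ (norm_nonneg a)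
    (fun x => NonUnitalStarAlgHom.norm_apply_le (α (-x)) a)
  map_one' := by
    refine ContinuousLinearMap.ext fun ξ => lp.ext (funext fun x => ?_)
    simp [diagOp_apply]
  map_mul' a b := by
    refine ContinuousLinearMap.ext fun ξ => lp.ext (funext fun x => ?_)
    simp [diagOp_apply]
  map_zero' := by
    refine ContinuousLinearMap.ext fun ξ => lp.ext (funext fun x => ?_)
    simp [diagOp_apply]
  map_add' a b := by
    refine ContinuousLinearMap.ext fun ξ => lp.ext (funext fun x => ?_)
    simp [diagOp_apply]
  commutes' c := by
    refine ContinuousLinearMap.ext fun ξ => lp.ext (funext fun x => ?_)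
    simp [diagOp_apply, Algebra.algebraMap_eq_smul_one]
  map_star' a := by
    rw [ContinuousLinearMap.star_eq_adjoint, ContinuousLinearMap.eq_adjoint_iff]
    intro ξ η
    rw [lp.inner_eq_tsum, lp.inner_eq_tsum]
    refine tsum_congr fun x => ?_
    show inner ℂ ((α (-x) (star a) : H →L[ℂ] H) (ξ x)) (η x)
      = inner ℂ (ξ x) ((α (-x) a : H →L[ℂ] H) (η x))
    rw [map_star]
    exact ContinuousLinearMap.adjoint_inner_left _ _ _

/-- The twisted crossed product `M ⋊_{α,b} G`: the von Neumann algebra on `⨁_{x ∈ G} H` generated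
by `ι(M)` and the unitaries `ψ_g`. -/
def twistedCrossedProduct {G H : Type*} [AddCommGroup G] [NormedAddCommGroup H] [InnerProductSpace ℂ H]
    [CompleteSpace H] (M : VonNeumannAlgebra H) (α : G → (M ≃⋆ₐ[ℂ] M))
    (b : G → G → Circle) : VonNeumannAlgebra (CrossedSpace G H) :=
  vonNeumannGenerated (Set.range (crossedRep M α) ∪ Set.range (implementer b))


/-! ### Local extensions of nets -/

/-- `(ℬ, ι)` is a local extension of the net `𝒜` of von Neumann algebras on the circle: the
`ι_J : 𝒜(J) → ℬ(J)` form a compatible family of faithful unital `*`-homomorphisms whose images are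
von Neumann algebras (so they are normal), the net `ℬ` is isotone, and `ℬ(J₁)` and `ℬ(J₂)` commute
whenever `J₁` and `J₂` are disjoint. -/
structure IsLocalExtension {H K : Type*} [NormedAddCommGroup H] [InnerProductSpace ℂ H]
    [CompleteSpace H] [NormedAddCommGroup K] [InnerProductSpace ℂ K] [CompleteSpace K]
    (A : ProperInterval → VonNeumannAlgebra H) (B : ProperInterval → VonNeumannAlgebra K)
    (ι : ∀ J, A J →⋆ₐ[ℂ] (K →L[ℂ] K)) : Prop where
  base_isotony : ∀ J₁ J₂ : ProperInterval, J₁.carrier ⊆ J₂.carrier →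
    (A J₁ : Set (H →L[ℂ] H)) ⊆ A J₂
  injective : ∀ J, Function.Injective (ι J)
  normal : ∀ J, ∃ N : VonNeumannAlgebra K, (N : Set (K →L[ℂ] K)) = Set.range (ι J)
  compatible : ∀ J₁ J₂ : ProperInterval, J₁.carrier ⊆ J₂.carrier →
    ∀ (a₁ : A J₁) (a₂ : A J₂), (a₁ : H →L[ℂ] H) = a₂ → ι J₁ a₁ = ι J₂ a₂
  embeds : ∀ J (a : A J), ι J a ∈ B J
  isotony : ∀ J₁ J₂ : ProperInterval, J₁.carrier ⊆ J₂.carrier →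
    (B J₁ : Set (K →L[ℂ] K)) ⊆ B J₂
  locality : ∀ J₁ J₂ : ProperInterval, Disjoint J₁.carrier J₂.carrier →
    ∀ x ∈ B J₁, ∀ y ∈ B J₂, x * y = y * x

/-! ### The lattice extension -/

/-- The lattice `L = ℤ e₁ + ⋯ + ℤ e_n` in `F`. -/
abbrev lattice {n : ℕ} (e : Module.Basis (Fin n) ℝ (Euc n)) : Submodule ℤ (Euc n) :=
  Submodule.span ℤ (Set.range e)

/-- The lattice is even: `⟨x, x⟩ ∈ 2ℤ` for all `x ∈ L`. -/
def IsEvenLattice {n : ℕ} (e : Module.Basis (Fin n) ℝ (Euc n)) : Prop :=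
  ∀ x ∈ lattice e, ∃ m : ℤ, inner ℝ x x = 2 * (m : ℝ)

/-- The `ℤ`-bilinear extension to `L × L` of the function with values
`(-1)^⟨e_i, e_j⟩ = e^{iπ⟨e_i, e_j⟩}` for `i < j` and `1` otherwise. -/
def latticeBicharacter {n : ℕ} (e : Module.Basis (Fin n) ℝ (Euc n)) :
    lattice e →ₗ[ℤ] lattice e →ₗ[ℤ] Additive Circle :=
  (e.restrictScalars ℤ).constr ℤ fun i => (e.restrictScalars ℤ).constr ℤ fun j =>
    Additive.ofMul (if i < j then Circle.exp (Real.pi * inner ℝ (e i) (e j)) else 1)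

/-- The `U(1)`-valued 2-cocycle `b` on `L`, written multiplicatively. -/
def latticeCocycle {n : ℕ} (e : Module.Basis (Fin n) ℝ (Euc n)) (x y : lattice e) : Circle :=
  (latticeBicharacter e x y).toMul

theorem latticeCocycle_add_left {n : ℕ} (e : Module.Basis (Fin n) ℝ (Euc n)) (x y z : lattice e) :
    latticeCocycle e (x + y) z = latticeCocycle e x z * latticeCocycle e y z := by
  simp [latticeCocycle]

theorem latticeCocycle_add_right {n : ℕ} (e : Module.Basis (Fin n) ℝ (Euc n)) (x y z : lattice e) :
    latticeCocycle e x (y + z) = latticeCocycle e x y * latticeCocycle e x z := by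
  simp [latticeCocycle]

theorem latticeCocycle_basis {n : ℕ} (e : Module.Basis (Fin n) ℝ (Euc n)) (i j : Fin n) :
    latticeCocycle e ⟨e i, Submodule.subset_span ⟨i, rfl⟩⟩ ⟨e j, Submodule.subset_span ⟨j, rfl⟩⟩
      = if i < j then Circle.exp (Real.pi * inner ℝ (e i) (e j)) else 1 := by
  have h : ∀ k : Fin n, (⟨e k, Submodule.subset_span ⟨k, rfl⟩⟩ : lattice e)
      = e.restrictScalars ℤ k := fun k => Subtype.ext (e.restrictScalars_apply ℤ k).symm
  rw [h, h, latticeCocycle, latticeBicharacter, Module.Basis.constr_basis,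
    Module.Basis.constr_basis, toMul_ofMul]

/-- The localized automorphisms `ρ_q = ρ_{ℓ₁ · q, K}` of `𝒜_F(K)`, `q ∈ F`. -/
def rho {n : ℕ} (ℓ₁ : SmoothLoop ℝ) (K : ProperInterval) (q : Euc n) :
    localAlg n K ≃⋆ₐ[ℂ] localAlg n K :=
  gaugeAut (ℓ₁.smulVec q) K

/-- The Hilbert space `⨁_{x ∈ L} e^{ℋ_{0,F}}` of the extension. -/
abbrev ExtSpace {n : ℕ} (e : Module.Basis (Fin n) ℝ (Euc n)) : Type :=
  CrossedSpace (lattice e) (FockF n)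

/-- The embedding `ι_K` of `𝒜_F(K)` into the extension: `(ι_K(a) ξ)_x = ρ_x⁻¹(a) ξ_x`. -/
def extRep {n : ℕ} (e : Module.Basis (Fin n) ℝ (Euc n)) (ℓ₁ : SmoothLoop ℝ) (K : ProperInterval) :
    localAlg n K →⋆ₐ[ℂ] (ExtSpace e →L[ℂ] ExtSpace e) :=
  crossedRep (localAlg n K) fun x : lattice e => rho ℓ₁ K (x : Euc n)

/-- The unitaries `ψ_q`, `q ∈ L`, implementing the crossed product twisted by `b`. -/
def psi {n : ℕ} (e : Module.Basis (Fin n) ℝ (Euc n)) (q : lattice e) :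
    ExtSpace e →L[ℂ] ExtSpace e :=
  implementer (latticeCocycle e) q

/-- Data transporting charges to `J` in the circle cut at the point `p`: a real loop `Λ`, supported
in a proper interval `K ∌ p`, such that the density `Λ' + ℓ₁` (which has the same charge as `ℓ₁`)
is localized in an interval `J₀ ⊆ J`, `p ∉ J₀`. Then `Ad W([Λ · q]) ∘ ρ_q` is localized in `J`. -/
structure IsTransport (ℓ₁ : SmoothLoop ℝ) (p : Circle) (J K : ProperInterval)
    (Λ : SmoothLoop ℝ) : Prop where
  cut : p ∉ K.carrier
  supported : Λ.SupportedIn K.carrier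
  localized : ∃ J₀ : ProperInterval, J₀.carrier ⊆ J.carrier ∧ p ∉ J₀.carrier ∧
    LocalizedIn (fun θ => deriv Λ.toFun θ + ℓ₁ θ) J₀

theorem SmoothLoop.SupportedIn.smulVec {E : Type*} [NormedAddCommGroup E] [NormedSpace ℝ E]
    {h : SmoothLoop ℝ} {K : Set Circle} (hK : h.SupportedIn K) (q : E) :
    (h.smulVec q).SupportedIn K :=
  (closure_mono (Function.support_smul_subset_left h.toFun fun _ => q)).trans hK

/-- The charge transporter `z = W([Λ · q]) ∈ 𝒜_F(K)`. -/
def transporter {n : ℕ} {ℓ₁ : SmoothLoop ℝ} {p : Circle} {J K : ProperInterval}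
    {Λ : SmoothLoop ℝ} (h : IsTransport ℓ₁ p J K Λ) (q : Euc n) : localAlg n K :=
  localWeyl K (Λ.smulVec q) (h.supported.smulVec q)

/-- The extended net: `𝒜_L(J)` is generated by `ι_J(𝒜_F(J))` and the charged fields `ι(z) ψ_q`,
where `q ∈ L` and `z` runs through the Weyl charge transporters such that `Ad z ∘ ρ_q` is localized
in `J`. The circle is cut at the point `p`. -/
def extNet {n : ℕ} (e : Module.Basis (Fin n) ℝ (Euc n)) (ℓ₁ : SmoothLoop ℝ) (p : Circle)
    (J : ProperInterval) : VonNeumannAlgebra (ExtSpace e) :=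
  vonNeumannGenerated (Set.range (extRep e ℓ₁ J) ∪
    {T | ∃ (q : lattice e) (K : ProperInterval) (Λ : SmoothLoop ℝ) (h : IsTransport ℓ₁ p J K Λ),
      T = extRep e ℓ₁ K (transporter h (q : Euc n)) * psi e q})

end

end LatticeNet

namespace LatticeNet

noncomputable section

/-! ### Fourier series and the symplectic form -/

/-! Everything rests on one computation. By Parseval, the imaginary part of the one-particle inner
product is half of `symp f g`, so the Weyl unitaries of `f` and `g` commute up to the phase `e^{-i
symp f g}` (`inner_vec_im`, `weyl_vec_comm`). Hence `ρ_q` multiplies `W([f])` by a phase linear in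
`q`. Automorphisms implemented by unitaries are determined by their values on the generating Weyl
unitaries (`conj_eq_on_localAlg`), so additivity of `q ↦ ρ_q`, compatibility with inclusions and the
effect of charge transport all reduce to comparing integrals. For transport the relevant integral
pairs `f` with `(Λ' + ℓ₁) q`, which vanishes away from `J`.

The heart is `braiding_phase`. On the circle cut at `p`, each density `λᵢ = Λᵢ' + ℓ₁` has a
primitive climbing from `0` to `2π`, because its charge is one. If the localization regions are
disjoint, the primitive of `λ₂` is constant on the region of `λ₁`, equal to `0` or `2π` according to
the order of the arcs. An integration by parts then shows that the phase exponent per unit of `⟨q,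
r⟩` is `-π` or `π`. As `⟨q, r⟩` is an integer, both orders give the sign `e^{iπ⟨q,r⟩}`. The
bicharacter `b` is built to have the same commutator (`latticeCocycle_comm`), evenness being what
makes this work on the diagonal. So the signs cancel, and charged fields localized in disjoint
intervals commute (`chargedField_commute`).

Two points are analytic. "Localized in `I`" only means vanishing off the closure of `I`, so
transporters within `I` have support in the closed arc; `weyl_mem_localAlg` puts their Weyl
unitaries into `𝒜_F(I)` by approximating with loops squeezed into the open arc, using continuity of
`ξ ↦ W(ξ)e^η`. This gives `𝒜_L(I) = 𝒜_F(I) ⋊_b L`. That the image of `ι_J` is a von Neumann algebra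
is a bicommutant argument with matrix entries, which works because `ρ_q` is implemented by
unitaries. -/

/-- The Fourier coefficient `(2π)⁻¹ ∫₀^{2π} u(θ) e^{-ikθ} dθ` of a function on the line. -/
def fourierC (u : ℝ → ℂ) (k : ℤ) : ℂ :=
  (2 * Real.pi : ℂ)⁻¹ * ∫ θ in (0)..(2 * Real.pi), u θ * Complex.exp (-Complex.I * k * θ)

/-- Bridge through which the Plancherel theorem for `fourierCoeffOn` on `[0, 2π]` is applied. -/
theorem fourierC_eq_fourierCoeffOn (u : ℝ → ℂ) (k : ℤ) :
    fourierC u k = fourierCoeffOn Real.two_pi_pos u k := by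
  rw [fourierCoeffOn_eq_integral, fourierC]
  simp only [sub_zero, one_div, Complex.real_smul]
  push_cast
  congr 1
  refine intervalIntegral.integral_congr fun θ _ => ?_
  simp only [fourier_coe_apply, smul_eq_mul]
  rw [mul_comm]
  congr 2
  have : (Real.pi : ℂ) ≠ 0 := by exact_mod_cast Real.pi_ne_zero
  push_cast
  field_simp
  ring

theorem fourierC_add {u v : ℝ → ℂ} (hu : Continuous u) (hv : Continuous v) (k : ℤ) :
    fourierC (fun θ => u θ + v θ) k = fourierC u k + fourierC v k := by
  simp only [fourierC, add_mul]
  rw [intervalIntegral.integral_add (Continuous.intervalIntegrable (by fun_prop) _ _)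
    (Continuous.intervalIntegrable (by fun_prop) _ _), mul_add]

theorem fourierC_const_mul (c : ℂ) (u : ℝ → ℂ) (k : ℤ) :
    fourierC (fun θ => c * u θ) k = c * fourierC u k := by
  simp only [fourierC, mul_assoc, intervalIntegral.integral_const_mul]
  ring

theorem hasSum_norm_sq_fourierC {u : ℝ → ℂ} (hu : Continuous u) :
    HasSum (fun k : ℤ => ‖fourierC u k‖ ^ 2)
      ((2 * Real.pi)⁻¹ * ∫ θ in (0)..(2 * Real.pi), ‖u θ‖ ^ 2) := by
  have hm : MemLp u 2 (volume.restrict (Set.Ioc 0 (2 * Real.pi))) := by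
    obtain ⟨C, hC⟩ := (isCompact_Icc (a := (0 : ℝ)) (b := 2 * Real.pi)).exists_bound_of_continuousOn
      hu.continuousOn
    refine MemLp.of_bound hu.aestronglyMeasurable C ?_
    exact (ae_restrict_iff' measurableSet_Ioc).2
      (Filter.Eventually.of_forall fun θ hθ => hC θ (Set.Ioc_subset_Icc_self hθ))
  have h := hasSum_sq_fourierCoeffOn Real.two_pi_pos hm
  simp only [← fourierC_eq_fourierCoeffOn, sub_zero, smul_eq_mul] at h
  exact h

/-- Parseval's identity. -/
theorem hasSum_inner_fourierC {u v : ℝ → ℂ} (hu : Continuous u) (hv : Continuous v) :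
    HasSum (fun k : ℤ => inner ℂ (fourierC u k) (fourierC v k))
      ((2 * Real.pi : ℂ)⁻¹ * ∫ θ in (0)..(2 * Real.pi), inner ℂ (u θ) (v θ)) := by
  have key : ∀ c : ℂ, HasSum (fun k : ℤ => ((‖fourierC u k + c * fourierC v k‖ ^ 2 : ℝ) : ℂ))
      ((2 * Real.pi : ℂ)⁻¹ * ∫ θ in (0)..(2 * Real.pi), ((‖u θ + c * v θ‖ ^ 2 : ℝ) : ℂ)) := by
    intro c
    have h := hasSum_norm_sq_fourierC (u := fun θ => u θ + c * v θ) (by fun_prop)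
    simp only [fourierC_add hu (by fun_prop : Continuous fun θ => c * v θ), fourierC_const_mul] at h
    have h2 := Complex.hasSum_ofReal.2 h
    rw [intervalIntegral.integral_ofReal]
    exact_mod_cast h2
  -- Polarization with every term written as `‖x + c y‖²`, `c ∈ {±1, ±i}`, so that each is an
  -- instance of `key`.
  have hpol : ∀ x y : ℂ, inner ℂ x y = (((‖x + 1 * y‖ ^ 2 : ℝ) : ℂ) - ((‖x + (-1) * y‖ ^ 2 : ℝ) : ℂ) +
      (((‖x + (-Complex.I) * y‖ ^ 2 : ℝ) : ℂ) - ((‖x + Complex.I * y‖ ^ 2 : ℝ) : ℂ)) * Complex.I) / 4 := by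
    intro x y
    rw [inner_eq_sum_norm_sq_div_four x y]
    simp [sub_eq_add_neg]
  have hint : ∀ c : ℂ, IntervalIntegrable (fun θ => ((‖u θ + c * v θ‖ ^ 2 : ℝ) : ℂ)) volume
      0 (2 * Real.pi) := fun c => Continuous.intervalIntegrable (by fun_prop) _ _
  have h := ((((key 1).sub (key (-1))).add (((key (-Complex.I)).sub (key Complex.I)).mul_right
    Complex.I))).div_const 4
  refine HasSum.congr_fun (Eq.subst (motive := HasSum _) ?_ h) fun k => hpol _ _
  symm
  simp only [hpol]
  rw [intervalIntegral.integral_div, intervalIntegral.integral_add, intervalIntegral.integral_sub,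
    intervalIntegral.integral_mul_const, intervalIntegral.integral_sub]
  · ring
  any_goals exact hint _
  · exact (hint _).sub (hint _)
  · exact ((hint _).sub (hint _)).mul_const _

theorem fourierC_deriv {u u' : ℝ → ℂ} (hu : ∀ θ, HasDerivAt u (u' θ) θ) (hu' : Continuous u')
    (hp : u (2 * Real.pi) = u 0) (k : ℤ) : fourierC u' k = Complex.I * k * fourierC u k := by
  -- Integration by parts against `e^{-ikθ}` divides by `ik`; at `k = 0` the integral of `u'`
  -- vanishes by periodicity.
  by_cases hk : k = 0
  · subst hk
    have : ∫ θ in (0)..(2 * Real.pi), u' θ = 0 := by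
      rw [intervalIntegral.integral_eq_sub_of_hasDerivAt (fun θ _ => hu θ)
        (hu'.intervalIntegrable _ _), hp, sub_self]
    simp [fourierC, this]
  · have hI : Complex.I * k ≠ 0 := mul_ne_zero Complex.I_ne_zero (by exact_mod_cast hk)
    rw [fourierC, fourierC, integral_mul_exp_eq u u' hu hu' hp k hk]
    field_simp

theorem conj_fourierC_ofReal (u : ℝ → ℝ) (k : ℤ) :
    (starRingEnd ℂ) (fourierC (fun θ => (u θ : ℂ)) k) = fourierC (fun θ => (u θ : ℂ)) (-k) := by
  rw [fourierC, fourierC, map_mul, intervalIntegral, intervalIntegral, map_sub, ← integral_conj,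
    ← integral_conj]
  congr 1
  · simp [map_ofNat]
  · congr 1 <;>
    · congr 1
      funext θ
      simp [← Complex.exp_conj]

/-- In Parseval's identity for `∫ u v'` the derivative contributes a factor `ik`. For real functions
the terms at `±(m+1)` are complex conjugate and add up to `2(m+1)` times the imaginary part at
`-(m+1)`. This explains the factor `2⁻¹` and why negative modes suffice. -/
theorem hasSum_im_fourierC {u v v' : ℝ → ℝ} (hu : Continuous u) (hv : ∀ θ, HasDerivAt v (v' θ) θ)
    (hv' : Continuous v') (hp : v (2 * Real.pi) = v 0) :
    HasSum (fun m : ℕ => ((m : ℝ) + 1) * (inner ℂ (fourierC (fun θ => (u θ : ℂ)) (-((m : ℤ) + 1)))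
        (fourierC (fun θ => (v θ : ℂ)) (-((m : ℤ) + 1)))).im)
      (2⁻¹ * ((2 * Real.pi)⁻¹ * ∫ θ in (0)..(2 * Real.pi), u θ * v' θ)) := by
  have h := hasSum_inner_fourierC (u := fun θ => (u θ : ℂ)) (v := fun θ => (v' θ : ℂ))
    (by fun_prop) (by fun_prop)
  have hd := fourierC_deriv (u := fun θ => (v θ : ℂ)) (u' := fun θ => (v' θ : ℂ))
    (fun θ => (hv θ).ofReal_comp) (by fun_prop) (by rw [hp])
  simp only [hd] at h
  -- Folding `k` with `-k` counts `k = 0` twice, which is harmless because that term carries the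
  -- factor `k`; dropping it shifts the index to `m + 1`.
  have h2 := h.nat_add_neg
  simp only [Int.cast_zero, mul_zero, zero_mul, inner_zero_right, add_zero] at h2
  rw [← hasSum_nat_add_iff' 1] at h2
  simp only [Finset.range_one, Finset.sum_singleton, Nat.cast_zero, neg_zero, Int.cast_zero,
    mul_zero, zero_mul, inner_zero_right, add_zero, sub_zero] at h2
  rw [← Complex.hasSum_ofReal]
  refine HasSum.congr_fun (Eq.subst (motive := HasSum _) ?_ (h2.mul_left (2⁻¹ : ℂ))) fun m => ?_
  rotate_left
  · have e1 := conj_fourierC_ofReal u (-((m : ℤ) + 1))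
    have e2 := conj_fourierC_ofReal v (-((m : ℤ) + 1))
    rw [neg_neg] at e1 e2
    push_cast
    rw [← e1, ← e2]
    set a := fourierC (fun θ => (u θ : ℂ)) (-((m : ℤ) + 1))
    set b := fourierC (fun θ => (v θ : ℂ)) (-((m : ℤ) + 1))
    simp only [RCLike.inner_apply]
    apply Complex.ext <;> simp <;> ring
  · push_cast
    rw [← intervalIntegral.integral_ofReal]
    congr 2
    refine intervalIntegral.integral_congr fun θ _ => ?_
    simp [RCLike.inner_apply, mul_comm]

/-- The symplectic form `(2π)⁻¹ ∫₀^{2π} ⟨f, g'⟩ dθ = 2 ω(f, g)` on loops. -/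
def symp {n : ℕ} (f g : SmoothLoop (Euc n)) : ℝ :=
  (2 * Real.pi)⁻¹ * ∫ θ in (0)..(2 * Real.pi), inner ℝ (f θ) (deriv g.toFun θ)

/-! ### Calculus of smooth loops, and the symplectic form as an imaginary part -/

theorem SmoothLoop.hasDerivAt {E : Type*} [NormedAddCommGroup E] [NormedSpace ℝ E]
    (f : SmoothLoop E) (θ : ℝ) : HasDerivAt f.toFun (deriv f.toFun θ) θ :=
  (f.smooth.differentiable (by simp) θ).hasDerivAt

theorem SmoothLoop.contDiff_deriv {E : Type*} [NormedAddCommGroup E] [NormedSpace ℝ E]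
    (f : SmoothLoop E) : ContDiff ℝ ∞ (deriv f.toFun) := (contDiff_infty_iff_deriv.1 f.smooth).2

theorem SmoothLoop.continuous_deriv {E : Type*} [NormedAddCommGroup E] [NormedSpace ℝ E]
    (f : SmoothLoop E) : Continuous (deriv f.toFun) := f.contDiff_deriv.continuous

theorem SmoothLoop.continuous {E : Type*} [NormedAddCommGroup E] [NormedSpace ℝ E]
    (f : SmoothLoop E) : Continuous f.toFun := f.smooth.continuous

theorem SmoothLoop.periodic_deriv {E : Type*} [NormedAddCommGroup E] [NormedSpace ℝ E]
    (f : SmoothLoop E) : Function.Periodic (deriv f.toFun) (2 * Real.pi) := fun θ => by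
  rw [← deriv_comp_add_const, funext f.periodic]

theorem SmoothLoop.hasDerivAt_apply {n : ℕ} (f : SmoothLoop (Euc n)) (j : Fin n) (θ : ℝ) :
    HasDerivAt (fun x => f x j) (deriv f.toFun θ j) θ :=
  (EuclideanSpace.proj (𝕜 := ℝ) j).hasFDerivAt.comp_hasDerivAt θ (f.hasDerivAt θ)

theorem SmoothLoop.vec_apply {n : ℕ} (f : SmoothLoop (Euc n)) (m : ℕ) (j : Fin n) :
    f.vec (m, j) = (Real.sqrt ((m : ℝ) + 1) : ℂ) *
      fourierC (fun θ => (f θ j : ℂ)) (-((m : ℤ) + 1)) := rfl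

/-- The imaginary part of the one-particle inner product is the symplectic form. -/
theorem inner_vec_im {n : ℕ} (f g : SmoothLoop (Euc n)) :
    (inner ℂ f.vec g.vec).im = 2⁻¹ * symp f g := by
  have h := lp.hasSum_inner (𝕜 := ℂ) (G := fun _ => ℂ) f.vec g.vec
  -- With the coordinate `j` as the outer index, each inner sum over frequencies is the scalar
  -- formula.
  have h1 := (Equiv.prodComm (Fin n) ℕ).hasSum_iff.2 (Complex.hasSum_im h)
  have h2 : ∀ j : Fin n, HasSum (fun m : ℕ => (inner ℂ (f.vec (m, j)) (g.vec (m, j))).im)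
      (2⁻¹ * ((2 * Real.pi)⁻¹ * ∫ θ in (0)..(2 * Real.pi), f θ j * deriv g.toFun θ j)) := by
    intro j
    have hf : Continuous fun θ => f θ j := continuous_iff_continuousAt.2 fun θ =>
      (f.hasDerivAt_apply j θ).continuousAt
    have hg : Continuous fun θ => deriv g.toFun θ j :=
      (EuclideanSpace.proj (𝕜 := ℝ) j).continuous.comp g.continuous_deriv
    have hp : g (2 * Real.pi) j = g 0 j := by
      have := g.periodic 0
      rw [zero_add] at this
      rw [this]
    refine (hasSum_im_fourierC hf (g.hasDerivAt_apply j) hg hp).congr_fun fun m => ?_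
    rw [SmoothLoop.vec_apply, SmoothLoop.vec_apply, ← smul_eq_mul, ← smul_eq_mul,
      inner_smul_left, inner_smul_right, Complex.conj_ofReal, ← mul_assoc, ← Complex.ofReal_mul,
      Real.mul_self_sqrt (by positivity)]
    simp
  have h3 := (h1.prod_fiberwise h2).unique (hasSum_fintype _)
  rw [h3, ← Finset.mul_sum, ← Finset.mul_sum, symp, ← intervalIntegral.integral_finsetSum]
  · congr 3
    funext θ
    simp [PiLp.inner_apply, mul_comm]
  · intro j _
    have hf : Continuous fun θ => f θ j := continuous_iff_continuousAt.2 fun θ =>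
      (f.hasDerivAt_apply j θ).continuousAt
    have hg : Continuous fun θ => deriv g.toFun θ j :=
      (EuclideanSpace.proj (𝕜 := ℝ) j).continuous.comp g.continuous_deriv
    exact (hf.mul hg).intervalIntegrable _ _

/-- Conjugate symmetry of the inner product stands in for an integration by parts. -/
theorem symp_antisymm {n : ℕ} (f g : SmoothLoop (Euc n)) : symp g f = -symp f g := by
  have h1 := inner_vec_im f g
  have h2 := inner_vec_im g f
  rw [← inner_conj_symm, Complex.conj_im] at h2
  linarith

/-- The commutation relations of the Weyl unitaries of loops. -/
theorem weyl_vec_comm {n : ℕ} (f g : SmoothLoop (Euc n)) :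
    weyl f.vec * weyl g.vec
      = Complex.exp (-Complex.I * symp f g) • (weyl g.vec * weyl f.vec) := by
  rw [weyl_mul, weyl_mul g.vec, smul_smul, ← Complex.exp_add, inner_vec_im, inner_vec_im,
    symp_antisymm f g, add_comm g.vec]
  congr 2
  push_cast
  ring

theorem weyl_vec_conj {n : ℕ} (f g : SmoothLoop (Euc n)) :
    weyl f.vec * weyl g.vec * weyl (-f.vec) = Complex.exp (-Complex.I * symp f g) • weyl g.vec := by
  rw [weyl_vec_comm, smul_mul_assoc, mul_assoc, weyl_mul_weyl_neg, mul_one]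

/-! ### Continuity of the Weyl operators -/

/-- The difference of two loops. -/
def SmoothLoop.sub {E : Type*} [NormedAddCommGroup E] [NormedSpace ℝ E] (f g : SmoothLoop E) :
    SmoothLoop E where
  toFun θ := f θ - g θ
  smooth := f.smooth.sub g.smooth
  periodic θ := by simp [f.periodic θ, g.periodic θ]

theorem SmoothLoop.continuous_apply {n : ℕ} (f : SmoothLoop (Euc n)) (j : Fin n) :
    Continuous fun θ => f θ j := (EuclideanSpace.proj (𝕜 := ℝ) j).continuous.comp f.continuous

theorem SmoothLoop.vec_sub {n : ℕ} (f g : SmoothLoop (Euc n)) :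
    (f.sub g).vec = f.vec - g.vec := by
  refine lp.ext (funext fun x => ?_)
  obtain ⟨m, j⟩ := x
  rw [lp.coeFn_sub, Pi.sub_apply, vec_apply, vec_apply, vec_apply, ← mul_sub]
  congr 1
  have hf := f.continuous_apply j
  have hg := g.continuous_apply j
  have h := fourierC_add (u := fun θ => (f θ j : ℂ)) (v := fun θ => (-1 : ℂ) * (g θ j : ℂ))
    (Complex.continuous_ofReal.comp hf)
    (continuous_const.mul (Complex.continuous_ofReal.comp hg)) (-((m : ℤ) + 1))
  rw [fourierC_const_mul, neg_one_mul, ← sub_eq_add_neg] at h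
  rw [← h]
  congr 1
  funext θ
  show ((f θ j - g θ j : ℝ) : ℂ) = _
  push_cast
  ring

/-- The weight `k` is at most `k²`, so the one-particle norm is dominated by the normalized `L²`
norm of `f'`, hence by its supremum. Approximation of loops in `C¹` therefore implies approximation
of their classes. -/
theorem SmoothLoop.norm_vec_le {n : ℕ} (f : SmoothLoop (Euc n)) {ε : ℝ} (hε : 0 ≤ ε)
    (hf : ∀ θ, ‖deriv f.toFun θ‖ ≤ ε) : ‖f.vec‖ ≤ ε := by
  have h := lp.hasSum_norm (p := 2) (by norm_num) f.vec
  simp only [ENNReal.toReal_ofNat, Real.rpow_ofNat] at h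
  have h1 := (Equiv.prodComm (Fin n) ℕ).hasSum_iff.2 h
  have hs : ∀ j : Fin n, Summable fun m : ℕ => ‖f.vec (m, j)‖ ^ 2 := fun j =>
    h1.summable.prod_factor j
  have h2 := (h1.prod_fiberwise fun j => (hs j).hasSum).unique (hasSum_fintype _)
  have hc : ∀ j : Fin n, Continuous fun θ => deriv f.toFun θ j := fun j =>
    (EuclideanSpace.proj (𝕜 := ℝ) j).continuous.comp f.continuous_deriv
  have h3 : ∀ j : Fin n, ∑' m : ℕ, ‖f.vec (m, j)‖ ^ 2
      ≤ (2 * Real.pi)⁻¹ * ∫ θ in (0)..(2 * Real.pi), (deriv f.toFun θ j) ^ 2 := by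
    intro j
    have hp := hasSum_norm_sq_fourierC (u := fun θ => (deriv f.toFun θ j : ℂ))
      (Complex.continuous_ofReal.comp (hc j))
    have hd := fourierC_deriv (u := fun θ => (f θ j : ℂ)) (u' := fun θ => (deriv f.toFun θ j : ℂ))
      (fun θ => (f.hasDerivAt_apply j θ).ofReal_comp) (Complex.continuous_ofReal.comp (hc j))
      (by have := f.periodic 0; rw [zero_add] at this; rw [this])
    simp only [Complex.norm_real, Real.norm_eq_abs, sq_abs] at hp
    -- The modes of `vec` inject into `ℤ` as negative frequencies; the remaining Parseval terms are
    -- nonnegative.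
    refine hasSum_le_inj (fun m : ℕ => -((m : ℤ) + 1)) (fun a b hab => by simpa using hab)
      (fun k _ => by positivity) (fun m => ?_) (hs j).hasSum hp
    have hm : (1 : ℝ) ≤ (m : ℝ) + 1 := by linarith [(Nat.cast_nonneg m : (0 : ℝ) ≤ m)]
    rw [SmoothLoop.vec_apply, hd, norm_mul, norm_mul, norm_mul, mul_pow, mul_pow, Complex.norm_real,
      Complex.norm_I, one_mul, Complex.norm_intCast, Real.norm_eq_abs, sq_abs, sq_abs,
      Real.sq_sqrt (by positivity)]
    refine mul_le_mul_of_nonneg_right ?_ (by positivity)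
    push_cast
    nlinarith
  have h4 : ∑ j : Fin n, (2 * Real.pi)⁻¹ * ∫ θ in (0)..(2 * Real.pi), (deriv f.toFun θ j) ^ 2
      = (2 * Real.pi)⁻¹ * ∫ θ in (0)..(2 * Real.pi), ‖deriv f.toFun θ‖ ^ 2 := by
    have hi : ∀ j ∈ (Finset.univ : Finset (Fin n)), IntervalIntegrable
        (fun θ => (deriv f.toFun θ j) ^ 2) volume 0 (2 * Real.pi) :=
      fun j _ => ((hc j).pow 2).intervalIntegrable _ _
    rw [← Finset.mul_sum, ← intervalIntegral.integral_finsetSum hi]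
    congr 2
    funext θ
    simp [EuclideanSpace.norm_sq_eq]
  have h5 : ∫ θ in (0)..(2 * Real.pi), ‖deriv f.toFun θ‖ ^ 2
      ≤ ∫ _ in (0)..(2 * Real.pi), ε ^ 2 := by
    refine intervalIntegral.integral_mono (by positivity)
      ((f.continuous_deriv.norm.pow 2).intervalIntegrable _ _) (by simp) fun θ => ?_
    exact pow_le_pow_left₀ (norm_nonneg _) (hf θ) 2
  rw [intervalIntegral.integral_const, sub_zero, smul_eq_mul] at h5
  refine (pow_le_pow_iff_left₀ (norm_nonneg _) hε two_ne_zero).1 ?_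
  calc ‖f.vec‖ ^ 2 = _ := h2
    _ ≤ _ := Finset.sum_le_sum fun j _ => h3 j
    _ = _ := h4
    _ ≤ (2 * Real.pi)⁻¹ * (2 * Real.pi * ε ^ 2) := by gcongr
    _ = ε ^ 2 := by field_simp

/-- By `inner_coherent`, `‖e^η - e^ξ‖²` is an explicit continuous function of `η` that vanishes at
`ξ`. -/
theorem continuous_coherent {κ : Type*} : Continuous (coherent : Ell2 κ → Fock κ) := by
  rw [continuous_iff_continuousAt]
  intro ξ
  rw [ContinuousAt, tendsto_iff_norm_sub_tendsto_zero]
  have h : ∀ η : Ell2 κ, ‖coherent η - coherent ξ‖ = Real.sqrt ((Complex.exp (inner ℂ η η)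
      - Complex.exp (inner ℂ η ξ) - Complex.exp (inner ℂ ξ η) + Complex.exp (inner ℂ ξ ξ)).re) := by
    intro η
    rw [@norm_eq_sqrt_re_inner ℂ, inner_sub_left, inner_sub_right, inner_sub_right]
    simp only [inner_coherent]
    congr 1
    simp only [RCLike.re_to_complex]
    simp only [Complex.sub_re, Complex.add_re]
    ring
  simp only [h]
  have hc : Continuous fun η : Ell2 κ => Real.sqrt ((Complex.exp (inner ℂ η η)
      - Complex.exp (inner ℂ η ξ) - Complex.exp (inner ℂ ξ η) + Complex.exp (inner ℂ ξ ξ)).re) := by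
    fun_prop
  simpa using hc.tendsto ξ

theorem continuous_weyl_coherent {κ : Type*} (η : Ell2 κ) :
    Continuous fun ξ : Ell2 κ => weyl ξ (coherent η) := by
  simp only [weyl_coherent]
  exact (by fun_prop : Continuous fun ξ : Ell2 κ =>
    Complex.exp (-(‖ξ‖ ^ 2 : ℝ) / 2 - inner ℂ ξ η)).smul
      (continuous_coherent.comp (continuous_id.add continuous_const))

/-- The set of `ξ` such that `W(ξ)` commutes with a given operator is closed. -/
theorem isClosed_commute_weyl {κ : Type*} (y : Fock κ →L[ℂ] Fock κ) :
    IsClosed {ξ : Ell2 κ | y * weyl ξ = weyl ξ * y} := by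
  -- Commutation is tested on matrix elements between coherent vectors. On the right `W(ξ)` is moved
  -- across as `W(-ξ)`, so that Weyl operators only ever act on coherent vectors, where continuity
  -- in `ξ` is known.
  have h : {ξ : Ell2 κ | y * weyl ξ = weyl ξ * y} = ⋂ (a : Ell2 κ) (b : Ell2 κ),
      {ξ | inner ℂ (coherent a) (y (weyl ξ (coherent b)))
        = inner ℂ (weyl (-ξ) (coherent a)) (y (coherent b))} := by
    ext ξ
    simp only [Set.mem_iInter, Set.mem_ofPred_eq]
    have e : ∀ a b : Ell2 κ, inner ℂ (weyl (-ξ) (coherent a)) (y (coherent b))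
        = inner ℂ (coherent a) (weyl ξ (y (coherent b))) := by
      intro a b
      rw [← star_weyl, ContinuousLinearMap.star_eq_adjoint,
        ContinuousLinearMap.adjoint_inner_left]
    constructor
    · intro hξ a b
      rw [e]
      exact congrArg (fun T : Fock κ →L[ℂ] Fock κ => inner ℂ (coherent a) (T (coherent b))) hξ
    · intro hξ
      refine ext_coherent fun b => ?_
      rw [← sub_eq_zero]
      refine eq_zero_of_inner_coherent _ fun a => ?_
      rw [inner_sub_right, sub_eq_zero]
      exact (hξ a b).trans (e a b)
  rw [h]
  refine isClosed_iInter fun a => isClosed_iInter fun b => isClosed_eq ?_ ?_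
  · exact continuous_const.inner (y.continuous.comp (continuous_weyl_coherent b))
  · exact ((continuous_weyl_coherent a).comp continuous_neg).inner continuous_const

/-- Membership in `M = M''` is commutation with every `y ∈ M'`, and each of these conditions is
closed in `ξ`. -/
theorem isClosed_weyl_mem {κ : Type*} (M : VonNeumannAlgebra (Fock κ)) :
    IsClosed {ξ : Ell2 κ | weyl ξ ∈ M} := by
  have h : {ξ : Ell2 κ | weyl ξ ∈ M} = ⋂ y ∈ Set.centralizer (M : Set (Fock κ →L[ℂ] Fock κ)),
      {ξ | y * weyl ξ = weyl ξ * y} := by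
    ext ξ
    have hM : weyl ξ ∈ M ↔ weyl ξ ∈ Set.centralizer
        (Set.centralizer (M : Set (Fock κ →L[ℂ] Fock κ))) := by
      rw [M.centralizer_centralizer]; rfl
    rw [Set.mem_ofPred_eq, hM, Set.mem_centralizer_iff]
    simp only [Set.mem_iInter, Set.mem_ofPred_eq]
  rw [h]
  exact isClosed_biInter fun y _ => isClosed_commute_weyl y

/-! ### Arcs of the circle -/

theorem exists_exp_eq_mem_Ico (z : Circle) (t : ℝ) :
    ∃ θ ∈ Set.Ico t (t + 2 * Real.pi), Circle.exp θ = z := by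
  obtain ⟨s, rfl⟩ := Circle.exp_surjective z
  refine ⟨toIcoMod Real.two_pi_pos t s, toIcoMod_mem_Ico _ _ _, ?_⟩
  rw [Circle.exp_eq_exp]
  exact ⟨-toIcoDiv Real.two_pi_pos t s, by
    rw [toIcoMod, zsmul_eq_mul]; push_cast; ring⟩

theorem exp_injOn_Ico_two_pi (t : ℝ) : Set.InjOn Circle.exp (Set.Ico t (t + 2 * Real.pi)) :=
  Circle.exp_injOn_Ico (by linarith)

theorem exp_injOn_Ioc_two_pi (t : ℝ) : Set.InjOn Circle.exp (Set.Ioc t (t + 2 * Real.pi)) :=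
  Circle.exp_injOn_Ioc (by linarith)

theorem isOpenMap_circleExp : IsOpenMap Circle.exp := isLocalHomeomorph_circleExp.isOpenMap

/-- The arc `[a, b]` may reach both ends of the period, where `Circle.exp` identifies `t` with `t +
2π`. Since `θ` is an interior point, injectivity on one of the two half-open periods decides each
case. -/
theorem exp_mem_image_Icc {t a b θ : ℝ} (ha : t ≤ a) (hb : b ≤ t + 2 * Real.pi)
    (hθ : θ ∈ Set.Ioo t (t + 2 * Real.pi)) (h : Circle.exp θ ∈ Circle.exp '' Set.Icc a b) :
    θ ∈ Set.Icc a b := by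
  obtain ⟨s, hs, he⟩ := h
  rcases (hs.2.trans hb).lt_or_eq with hlt | heq
  · rwa [← exp_injOn_Ico_two_pi t ⟨ha.trans hs.1, hlt⟩ ⟨hθ.1.le, hθ.2⟩ he]
  · rwa [← exp_injOn_Ioc_two_pi t ⟨by linarith [Real.two_pi_pos], heq.le⟩ ⟨hθ.1, hθ.2.le⟩ he]

/-- A proper interval that omits the point `e^{it}` is an open arc of the cut circle. -/
theorem ProperInterval.exists_eq_image (K : ProperInterval) {t : ℝ}
    (ht : Circle.exp t ∉ K.carrier) :
    ∃ a b, t ≤ a ∧ a < b ∧ b ≤ t + 2 * Real.pi ∧ K.carrier = Circle.exp '' Set.Ioo a b := by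
  set S := Set.Ioo t (t + 2 * Real.pi) ∩ Circle.exp ⁻¹' K.carrier with hS
  have himg : Circle.exp '' S = K.carrier := by
    ext z
    constructor
    · rintro ⟨θ, hθ, rfl⟩
      exact hθ.2
    · intro hz
      obtain ⟨θ, hθ, rfl⟩ := exists_exp_eq_mem_Ico z t
      refine ⟨θ, ⟨⟨hθ.1.lt_of_ne ?_, hθ.2⟩, hz⟩, rfl⟩
      rintro rfl
      exact ht hz
  have hopen : IsOpen S := isOpen_Ioo.inter (K.isOpen.preimage Circle.exp.continuous)
  have hne : S.Nonempty := by
    have := K.isConnected.nonempty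
    rw [← himg] at this
    exact this.of_image
  -- A continuous inverse of `Circle.exp` on the circle without `e^{it}`: the point opposite to the
  -- cut is rotated to `1` and the argument is taken there.
  let g : Circle → ℝ := fun z => t + Real.pi + Complex.arg ((z * (Circle.exp (t + Real.pi))⁻¹ : Circle))
  have hgexp : ∀ θ ∈ Set.Ioo t (t + 2 * Real.pi), g (Circle.exp θ) = θ := by
    intro θ hθ
    simp only [g]
    rw [← Circle.exp_neg, ← Circle.exp_add, Circle.arg_exp (by linarith [hθ.1]) (by linarith [hθ.2])]
    ring
  have hg : ContinuousOn g K.carrier := by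
    intro z hz
    rw [← himg] at hz
    obtain ⟨θ, hθ, rfl⟩ := hz
    refine ContinuousAt.continuousWithinAt (continuousAt_const.add ?_)
    refine ContinuousAt.comp (f := fun z : Circle =>
      ((z * (Circle.exp (t + Real.pi))⁻¹ : Circle) : ℂ)) (Complex.continuousAt_arg ?_) ?_
    · rw [Complex.mem_slitPlane_iff_arg]
      refine ⟨?_, Circle.coe_ne_zero _⟩
      rw [← Circle.exp_neg, ← Circle.exp_add, Circle.arg_exp (by linarith [hθ.1.1])
        (by linarith [hθ.1.2])]
      have := hθ.1.2
      intro h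
      linarith
    · exact (by fun_prop : Continuous fun z : Circle =>
        ((z * (Circle.exp (t + Real.pi))⁻¹ : Circle) : ℂ)).continuousAt
  -- `S` is the image of `K` under `g`. Being also open and bounded, it is the open interval between
  -- its infimum and supremum.
  have hpre : IsPreconnected S := by
    have h := K.isConnected.isPreconnected.image g hg
    convert h using 1
    rw [← himg, ← Set.image_comp]
    refine (Set.EqOn.image_eq_self fun θ hθ => hgexp θ hθ.1).symm
  have hbb : BddBelow S := ⟨t, fun θ hθ => hθ.1.1.le⟩
  have hba : BddAbove S := ⟨t + 2 * Real.pi, fun θ hθ => hθ.1.2.le⟩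
  have hSI : S = Set.Ioo (sInf S) (sSup S) := by
    refine Set.Subset.antisymm (fun θ hθ => ?_) (IsConnected.Ioo_csInf_csSup_subset ⟨hne, hpre⟩ hbb hba)
    obtain ⟨ε, hε, hball⟩ := Metric.isOpen_iff.1 hopen θ hθ
    have h1 : θ - ε / 2 ∈ S := hball (by rw [Metric.mem_ball, Real.dist_eq, abs_lt]; constructor <;> linarith)
    have h2 : θ + ε / 2 ∈ S := hball (by rw [Metric.mem_ball, Real.dist_eq, abs_lt]; constructor <;> linarith)
    exact ⟨by linarith [csInf_le hbb h1], by linarith [le_csSup hba h2]⟩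
  refine ⟨sInf S, sSup S, le_csInf hne fun θ hθ => hθ.1.1.le, ?_,
    csSup_le hne fun θ hθ => hθ.1.2.le, by rw [← hSI, himg]⟩
  rw [hSI] at hne
  exact Set.nonempty_Ioo.1 hne

theorem closure_exp_image_Ioo {a b : ℝ} (hab : a < b) :
    closure (Circle.exp '' Set.Ioo a b) = Circle.exp '' Set.Icc a b := by
  refine Set.Subset.antisymm ?_ ?_
  · exact closure_minimal (Set.image_mono Set.Ioo_subset_Icc_self)
      (isCompact_Icc.image Circle.exp.continuous).isClosed
  · rw [← closure_Ioo hab.ne]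
    exact image_closure_subset_closure_image Circle.exp.continuous

/-- The arc `{e^{iθ} : a < θ < b}` for `a < b < a + 2π`. -/
def arc (a b : ℝ) (hab : a < b) (h : b < a + 2 * Real.pi) : ProperInterval where
  carrier := Circle.exp '' Set.Ioo a b
  isOpen := isOpenMap_circleExp _ isOpen_Ioo
  isConnected := ((isConnected_Ioo hab).image _ Circle.exp.continuous.continuousOn)
  not_dense hd := by
    have h1 := closure_exp_image_Ioo hab
    rw [hd.closure_eq] at h1
    -- The midpoint of the complementary gap is a point off the closed arc.
    set s := (b + (a + 2 * Real.pi)) / 2 with hs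
    have h2 : Circle.exp s ∈ Circle.exp '' Set.Icc a b := h1 ▸ Set.mem_univ _
    have h3 := exp_mem_image_Icc (t := a) le_rfl h.le ⟨by linarith, by linarith⟩ h2
    linarith [h3.2]

/-- A proper interval whose closure omits the point `e^{it}`. -/
theorem ProperInterval.exists_eq_image_of_notMem_closure (K : ProperInterval) {t : ℝ}
    (ht : Circle.exp t ∉ closure K.carrier) :
    ∃ a b, t < a ∧ a < b ∧ b < t + 2 * Real.pi ∧ K.carrier = Circle.exp '' Set.Ioo a b ∧
      closure K.carrier = Circle.exp '' Set.Icc a b := by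
  obtain ⟨a, b, ha, hab, hb, hK⟩ := K.exists_eq_image (fun h => ht (subset_closure h))
  have hcl : closure K.carrier = Circle.exp '' Set.Icc a b := by
    rw [hK, closure_exp_image_Ioo hab]
  refine ⟨a, b, ha.lt_of_ne ?_, hab, hb.lt_of_ne ?_, hK, hcl⟩
  · rintro rfl
    exact ht (hcl ▸ ⟨t, ⟨le_rfl, hab.le⟩, rfl⟩)
  · rintro rfl
    exact ht (hcl ▸ ⟨t + 2 * Real.pi, ⟨hab.le, le_rfl⟩, Circle.periodic_exp t⟩)

theorem ProperInterval.exists_notMem_closure (K : ProperInterval) :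
    ∃ t, Circle.exp t ∉ closure K.carrier := by
  obtain ⟨z, hz⟩ : ∃ z, z ∉ closure K.carrier := by
    by_contra! h
    exact K.not_dense h
  obtain ⟨t, rfl⟩ := Circle.exp_surjective z
  exact ⟨t, hz⟩

/-! ### Loops and their supports -/

theorem SmoothLoop.eq_of_exp_eq {E : Type*} [NormedAddCommGroup E] [NormedSpace ℝ E]
    (f : SmoothLoop E) {x y : ℝ} (h : Circle.exp x = Circle.exp y) : f x = f y := by
  obtain ⟨m, rfl⟩ := Circle.exp_eq_exp.1 h
  exact f.periodic.int_mul m y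

theorem SmoothLoop.SupportedIn.eq_zero {E : Type*} [NormedAddCommGroup E] [NormedSpace ℝ E]
    {f : SmoothLoop E} {K : Set Circle} (hf : f.SupportedIn K) {θ : ℝ}
    (hθ : Circle.exp θ ∉ K) : f θ = 0 := by
  by_contra h
  exact hθ (hf (subset_tsupport _ h))

theorem SmoothLoop.SupportedIn.mono {E : Type*} [NormedAddCommGroup E] [NormedSpace ℝ E]
    {f : SmoothLoop E} {K N : Set Circle} (hf : f.SupportedIn K) (h : K ⊆ N) : f.SupportedIn N :=
  hf.trans (Set.preimage_mono h)

theorem SmoothLoop.supportedIn_of_isClosed {E : Type*} [NormedAddCommGroup E] [NormedSpace ℝ E]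
    {f : SmoothLoop E} {C : Set Circle} (hC : IsClosed C)
    (h : ∀ θ, Circle.exp θ ∉ C → f θ = 0) : f.SupportedIn C := by
  refine closure_minimal (fun θ hθ => ?_) (hC.preimage Circle.exp.continuous)
  by_contra hn
  exact hθ (h θ hn)

/-- Pairing of a loop supported in the closure of `K` with densities that agree on `K`. -/
theorem integral_inner_congr {n : ℕ} {f : SmoothLoop (Euc n)} {K : ProperInterval}
    (hf : f.SupportedIn (closure K.carrier)) {u v : ℝ → Euc n} (hu : Continuous u)
    (hv : Continuous v) (h : ∀ θ, Circle.exp θ ∈ K.carrier → u θ = v θ) :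
    ∫ θ in (0)..(2 * Real.pi), inner ℝ (f θ) (u θ)
      = ∫ θ in (0)..(2 * Real.pi), inner ℝ (f θ) (v θ) := by
  refine intervalIntegral.integral_congr fun θ _ => ?_
  by_cases hθ : Circle.exp θ ∈ closure K.carrier
  · have hcl : θ ∈ closure (Circle.exp ⁻¹' K.carrier) := by
      rwa [← isOpenMap_circleExp.preimage_closure_eq_closure_preimage Circle.exp.continuous]
    have : Set.EqOn u v (closure (Circle.exp ⁻¹' K.carrier)) :=
      Set.EqOn.closure (fun x hx => h x hx) hu hv
    simp only [this hcl]
  · simp only [hf.eq_zero hθ, inner_zero_left]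

/-! ### The localized automorphisms -/

/-- The normalized pairing `(2π)⁻¹ ∫₀^{2π} ⟨f, ℓ⟩ dθ` of two functions on the circle. -/
def pairing {E : Type*} [NormedAddCommGroup E] [InnerProductSpace ℝ E] (f ℓ : ℝ → E) : ℝ :=
  (2 * Real.pi)⁻¹ * ∫ θ in (0)..(2 * Real.pi), inner ℝ (f θ) (ℓ θ)

theorem symp_eq_pairing {n : ℕ} (f g : SmoothLoop (Euc n)) :
    symp f g = pairing f.toFun (deriv g.toFun) := rfl

theorem SmoothLoop.deriv_smulVec {E : Type*} [NormedAddCommGroup E] [NormedSpace ℝ E]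
    (h : SmoothLoop ℝ) (q : E) (θ : ℝ) :
    deriv (h.smulVec q).toFun θ = deriv h.toFun θ • q :=
  ((h.hasDerivAt θ).smul_const q).deriv

theorem pairing_smul {n : ℕ} (u v : ℝ → ℝ) (q r : Euc n) :
    pairing (fun θ => u θ • q) (fun θ => v θ • r) = inner ℝ q r * pairing u v := by
  rw [pairing, pairing, mul_left_comm]
  congr 1
  rw [← intervalIntegral.integral_const_mul]
  congr 1
  funext θ
  rw [real_inner_smul_left, real_inner_smul_right]
  simp
  ring

theorem symp_smulVec {n : ℕ} (f g : SmoothLoop ℝ) (q r : Euc n) :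
    symp (f.smulVec q) (g.smulVec r) = inner ℝ q r * pairing f.toFun (deriv g.toFun) := by
  rw [symp_eq_pairing, ← pairing_smul, funext (g.deriv_smulVec r)]
  rfl

theorem pairing_smulVec_right {n : ℕ} (f : SmoothLoop (Euc n)) (ℓ : SmoothLoop ℝ) (q r : Euc n) :
    pairing f.toFun (ℓ.smulVec (q + r)).toFun
      = pairing f.toFun (ℓ.smulVec q).toFun + pairing f.toFun (ℓ.smulVec r).toFun := by
  have h : ∀ s : Euc n, IntervalIntegrable
      (fun θ => inner ℝ (f θ) ((ℓ.smulVec s).toFun θ)) volume 0 (2 * Real.pi) := fun s =>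
    (f.continuous.inner (ℓ.smulVec s).continuous).intervalIntegrable _ _
  rw [pairing, pairing, pairing, ← mul_add, ← intervalIntegral.integral_add (h q) (h r)]
  congr 2
  funext θ
  simp only [SmoothLoop.smulVec, smul_add, inner_add_right]

theorem weyl_neg_mul {κ : Type*} (ξ : Ell2 κ) : weyl (-ξ) * weyl ξ = 1 := by
  simpa using weyl_mul_weyl_neg (-ξ)

theorem weyl_mem_unitary {κ : Type*} (ξ : Ell2 κ) : weyl ξ ∈ unitary (Fock κ →L[ℂ] Fock κ) :=
  Unitary.mem_iff.2 ⟨by rw [star_weyl, weyl_neg_mul], by rw [star_weyl, weyl_mul_weyl_neg]⟩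

theorem star_commute_of_unitary {R : Type*} [Monoid R] [StarMul R] {u y : R} (hu : u ∈ unitary R)
    (h : u * y = y * u) : star u * y = y * star u := by
  obtain ⟨h1, h2⟩ := Unitary.mem_iff.1 hu
  calc star u * y = star u * (y * u) * star u := by rw [mul_assoc, mul_assoc, h2, mul_one]
    _ = y * star u := by rw [← h, ← mul_assoc, h1, one_mul]

/-- An operator that commutes with the Weyl unitaries of `K` commutes with `𝒜_F(K)`. -/
theorem commute_localAlg {n : ℕ} {K : ProperInterval} {y : FockF n →L[ℂ] FockF n}
    (hy : ∀ f : SmoothLoop (Euc n), f.SupportedIn K.carrier → weyl f.vec * y = y * weyl f.vec)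
    {a : FockF n →L[ℂ] FockF n} (ha : a ∈ localAlg n K) : y * a = a * y := by
  rw [localAlg, mem_vonNeumannGenerated_iff] at ha
  refine ha y ?_
  rintro _ ⟨f, hf, rfl⟩
  exact ⟨hy f hf, star_commute_of_unitary (weyl_mem_unitary _) (hy f hf)⟩

/-- Two inner automorphisms that agree on the Weyl unitaries of `K` agree on `𝒜_F(K)`. -/
theorem conj_eq_on_localAlg {n : ℕ} {K : ProperInterval} {U V : FockF n →L[ℂ] FockF n}
    (hU : U ∈ unitary (FockF n →L[ℂ] FockF n)) (hV : V ∈ unitary (FockF n →L[ℂ] FockF n))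
    (h : ∀ f : SmoothLoop (Euc n), f.SupportedIn K.carrier →
      U * weyl f.vec * star U = V * weyl f.vec * star V)
    {a : FockF n →L[ℂ] FockF n} (ha : a ∈ localAlg n K) : U * a * star U = V * a * star V := by
  obtain ⟨hU1, hU2⟩ := Unitary.mem_iff.1 hU
  obtain ⟨hV1, hV2⟩ := Unitary.mem_iff.1 hV
  -- `V*U` commutes with the generators precisely because both conjugations agree on them.
  have hy : (star V * U) * a = a * (star V * U) := by
    refine commute_localAlg (fun f hf => ?_) ha
    calc weyl f.vec * (star V * U) = star V * (V * weyl f.vec * star V) * U := by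
          simp only [mul_assoc]; rw [← mul_assoc (star V) V, hV1, one_mul]
      _ = star V * U * weyl f.vec := by
          rw [← h f hf]; simp only [mul_assoc]; rw [hU1, mul_one]
  calc U * a * star U = V * ((star V * U) * a) * star U := by
        simp only [mul_assoc]; rw [← mul_assoc V (star V), hV2, one_mul]
    _ = V * a * star V := by
        rw [hy]; simp only [mul_assoc]; rw [hU2, mul_one]

/-- The loop whose Weyl unitary implements `ρ_q` on `𝒜_F(K)`. -/
def gaugeLoop {n : ℕ} (ℓ₁ : SmoothLoop ℝ) (K : ProperInterval) (q : Euc n) : SmoothLoop (Euc n) :=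
  primitive (ℓ₁.smulVec q) K

theorem rho_coe {n : ℕ} (ℓ₁ : SmoothLoop ℝ) (K : ProperInterval) (q : Euc n) (a : localAlg n K) :
    (rho ℓ₁ K q a : FockF n →L[ℂ] FockF n)
      = weyl (gaugeLoop ℓ₁ K q).vec * a * star (weyl (gaugeLoop ℓ₁ K q).vec) := by
  rw [star_weyl]; rfl

theorem deriv_gaugeLoop {n : ℕ} (ℓ₁ : SmoothLoop ℝ) (K : ProperInterval) (q : Euc n) {θ : ℝ}
    (hθ : Circle.exp θ ∈ K.carrier) :
    deriv (gaugeLoop ℓ₁ K q).toFun θ = (ℓ₁.smulVec q).toFun θ :=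
  (exists_primitive (ℓ₁.smulVec q) K).choose_spec θ hθ

/-- The action of `ρ_q` on Weyl unitaries of loops supported in the closure of the interval. -/
theorem gaugeLoop_conj {n : ℕ} (ℓ₁ : SmoothLoop ℝ) (K : ProperInterval) (q : Euc n)
    {f : SmoothLoop (Euc n)} (hf : f.SupportedIn (closure K.carrier)) :
    weyl (gaugeLoop ℓ₁ K q).vec * weyl f.vec * star (weyl (gaugeLoop ℓ₁ K q).vec)
      = Complex.exp (Complex.I * pairing f.toFun (ℓ₁.smulVec q).toFun) • weyl f.vec := by
  rw [star_weyl, weyl_vec_conj, symp_antisymm, symp_eq_pairing, pairing, pairing,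
    integral_inner_congr hf (gaugeLoop ℓ₁ K q).continuous_deriv (ℓ₁.smulVec q).continuous
      fun θ hθ => deriv_gaugeLoop ℓ₁ K q hθ]
  push_cast
  congr 2
  ring

theorem rho_weyl {n : ℕ} (ℓ₁ : SmoothLoop ℝ) (K : ProperInterval) (q : Euc n)
    {f : SmoothLoop (Euc n)} (hf : f.SupportedIn (closure K.carrier)) (hm : weyl f.vec ∈ localAlg n K) :
    (rho ℓ₁ K q ⟨weyl f.vec, hm⟩ : FockF n →L[ℂ] FockF n)
      = Complex.exp (Complex.I * pairing f.toFun (ℓ₁.smulVec q).toFun) • weyl f.vec := by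
  rw [rho_coe]
  exact gaugeLoop_conj ℓ₁ K q hf

/-- The primitives for `q + r`, `q` and `r` are chosen independently, so the implementing loops need
not add up. On Weyl unitaries only the phase matters, and the pairing with `ℓ_q` is additive in `q`.
-/
theorem rho_add {n : ℕ} (ℓ₁ : SmoothLoop ℝ) (K : ProperInterval) (q r : Euc n)
    (a : localAlg n K) : rho ℓ₁ K (q + r) a = rho ℓ₁ K q (rho ℓ₁ K r a) := by
  apply Subtype.ext
  rw [rho_coe, rho_coe, rho_coe]
  have h := conj_eq_on_localAlg (K := K) (weyl_mem_unitary (gaugeLoop ℓ₁ K (q + r)).vec)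
    (mul_mem (weyl_mem_unitary (gaugeLoop ℓ₁ K q).vec) (weyl_mem_unitary (gaugeLoop ℓ₁ K r).vec))
    (fun f hf => ?_) a.2
  · rw [h, star_mul]; simp only [mul_assoc]
  · have hf' := hf.mono subset_closure
    have e : weyl (gaugeLoop ℓ₁ K q).vec * weyl (gaugeLoop ℓ₁ K r).vec * weyl f.vec *
          star (weyl (gaugeLoop ℓ₁ K q).vec * weyl (gaugeLoop ℓ₁ K r).vec)
        = weyl (gaugeLoop ℓ₁ K q).vec * (weyl (gaugeLoop ℓ₁ K r).vec * weyl f.vec *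
          star (weyl (gaugeLoop ℓ₁ K r).vec)) * star (weyl (gaugeLoop ℓ₁ K q).vec) := by
      rw [star_mul]; simp only [mul_assoc]
    rw [e, gaugeLoop_conj ℓ₁ K _ hf', gaugeLoop_conj ℓ₁ K r hf', mul_smul_comm, smul_mul_assoc,
      gaugeLoop_conj ℓ₁ K q hf', smul_smul, ← Complex.exp_add, pairing_smulVec_right]
    push_cast
    congr 2
    ring

/-! ### Isotony, locality and the effect of charge transporters on `𝒜_F` -/

theorem localAlg_mono {n : ℕ} {J₁ J₂ : ProperInterval} (h : J₁.carrier ⊆ J₂.carrier)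
    {a : FockF n →L[ℂ] FockF n} (ha : a ∈ localAlg n J₁) : a ∈ localAlg n J₂ := by
  rw [localAlg, mem_vonNeumannGenerated_iff] at ha ⊢
  refine fun y hy => ha y ?_
  rintro _ ⟨f, hf, rfl⟩
  exact hy _ ⟨f, hf.mono h, rfl⟩

/-- The automorphisms `ρ_q` of the local algebras are compatible with inclusions. -/
theorem rho_compatible {n : ℕ} (ℓ₁ : SmoothLoop ℝ) {J₁ J₂ : ProperInterval}
    (h : J₁.carrier ⊆ J₂.carrier) (q : Euc n) (a₁ : localAlg n J₁) (a₂ : localAlg n J₂)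
    (ha : (a₁ : FockF n →L[ℂ] FockF n) = a₂) :
    (rho ℓ₁ J₁ q a₁ : FockF n →L[ℂ] FockF n) = rho ℓ₁ J₂ q a₂ := by
  rw [rho_coe, rho_coe, ← ha]
  refine conj_eq_on_localAlg (weyl_mem_unitary _) (weyl_mem_unitary _) (fun f hf => ?_) a₁.2
  rw [gaugeLoop_conj ℓ₁ J₁ q (hf.mono subset_closure),
    gaugeLoop_conj ℓ₁ J₂ q (hf.mono (h.trans subset_closure))]

/-- Locality of the net `𝒜_F`. -/
theorem localAlg_commute {n : ℕ} {J₁ J₂ : ProperInterval}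
    (h : Disjoint J₁.carrier J₂.carrier) {a b : FockF n →L[ℂ] FockF n}
    (ha : a ∈ localAlg n J₁) (hb : b ∈ localAlg n J₂) : a * b = b * a := by
  refine commute_localAlg (fun g hg => ?_) hb
  refine commute_localAlg (fun f hf => ?_) ha
  have h0 : symp f g = 0 := by
    rw [symp, intervalIntegral.integral_congr (g := fun _ => (0 : ℝ)), intervalIntegral.integral_zero,
      mul_zero]
    intro θ _
    by_cases hθ : Circle.exp θ ∈ J₁.carrier
    · have h1 : deriv g.toFun θ = 0 := by
        by_contra hne
        have : Circle.exp θ ∈ J₂.carrier :=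
          hg (tsupport_deriv_subset (subset_tsupport _ hne))
        exact Set.disjoint_left.1 h hθ this
      simp only [h1, inner_zero_right]
    · simp only [hf.eq_zero hθ, inner_zero_left]
  rw [weyl_vec_comm, h0]
  simp

/-- Charge transporters to `J` trivialize `ρ_q` on intervals disjoint from `J`. -/
theorem transporter_rho {n : ℕ} {ℓ₁ : SmoothLoop ℝ} {p : Circle} {J K N : ProperInterval}
    {Λ : SmoothLoop ℝ} (h : IsTransport ℓ₁ p J K Λ) (hN : Disjoint N.carrier J.carrier)
    (q : Euc n) (a : localAlg n N) :
    (transporter h q : FockF n →L[ℂ] FockF n) * rho ℓ₁ N q a *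
      star (transporter h q : FockF n →L[ℂ] FockF n) = a := by
  show weyl (Λ.smulVec q).vec * (rho ℓ₁ N q a : FockF n →L[ℂ] FockF n) *
    star (weyl (Λ.smulVec q).vec) = a
  rw [rho_coe]
  have e : ∀ b : FockF n →L[ℂ] FockF n, weyl (Λ.smulVec q).vec *
      (weyl (gaugeLoop ℓ₁ N q).vec * b * star (weyl (gaugeLoop ℓ₁ N q).vec)) *
        star (weyl (Λ.smulVec q).vec)
      = (weyl (Λ.smulVec q).vec * weyl (gaugeLoop ℓ₁ N q).vec) * b *
        star (weyl (Λ.smulVec q).vec * weyl (gaugeLoop ℓ₁ N q).vec) := fun b => by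
    rw [star_mul]; simp only [mul_assoc]
  have hc := conj_eq_on_localAlg (K := N) (U := weyl (Λ.smulVec q).vec *
    weyl (gaugeLoop ℓ₁ N q).vec) (V := 1)
    (mul_mem (weyl_mem_unitary _) (weyl_mem_unitary _)) (one_mem _) (fun f hf => ?_) a.2
  · rw [e, hc]; simp
  · rw [← e, gaugeLoop_conj ℓ₁ N q (hf.mono subset_closure), mul_smul_comm, smul_mul_assoc,
      star_weyl, weyl_vec_conj, smul_smul, ← Complex.exp_add, symp_antisymm]
    -- The two phases combine to the pairing of `f` with `(Λ' + ℓ₁) q`. The second factor vanishes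
    -- on `N`: an open set disjoint from `J` is disjoint from the closure of `J₀ ⊆ J`.
    have h0 : symp f (Λ.smulVec q) + pairing f.toFun (ℓ₁.smulVec q).toFun = 0 := by
      rw [symp_eq_pairing, pairing, pairing, ← mul_add, ← intervalIntegral.integral_add
        ((f.continuous.inner (Λ.smulVec q).continuous_deriv).intervalIntegrable _ _)
        ((f.continuous.inner (ℓ₁.smulVec q).continuous).intervalIntegrable _ _),
        intervalIntegral.integral_congr (g := fun _ => (0 : ℝ)), intervalIntegral.integral_zero,
        mul_zero]
      intro θ _
      by_cases hθ : Circle.exp θ ∈ N.carrier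
      · obtain ⟨J₀, hJ, -, hl⟩ := h.localized
        have hn : Circle.exp θ ∉ closure J₀.carrier := fun hc =>
          Set.disjoint_left.1 (hN.closure_right N.isOpen) hθ (closure_mono hJ hc)
        simp only
        rw [← inner_add_right, SmoothLoop.deriv_smulVec]
        show inner ℝ (f θ) (deriv Λ.toFun θ • q + ℓ₁ θ • q) = 0
        have hz : deriv Λ.toFun θ + ℓ₁ θ = 0 := hl θ hn
        rw [← add_smul, hz, zero_smul, inner_zero_right]
      · simp only [hf.eq_zero hθ, inner_zero_left, add_zero]
    have h1 : -Complex.I * ((-symp f (Λ.smulVec q) : ℝ) : ℂ)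
        + Complex.I * (pairing f.toFun (ℓ₁.smulVec q).toFun : ℂ) = 0 := by
      rw [← mul_zero Complex.I, ← Complex.ofReal_zero, ← h0]
      push_cast
      ring
    rw [add_comm, add_comm] at h1
    rw [add_comm, h1]
    simp

/-! ### Charge transport and the braiding phase -/

theorem LocalizedIn.eq_zero_of_mem {E : Type*} [Zero E] {h : ℝ → E} {J : ProperInterval}
    (hJ : LocalizedIn h J) {t a b θ : ℝ} (hJab : J.carrier = Circle.exp '' Set.Ioo a b)
    (hab : a < b) (ha : t ≤ a) (hb : b ≤ t + 2 * Real.pi)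
    (hθ : θ ∈ Set.Ioo t (t + 2 * Real.pi)) (hn : θ ∉ Set.Icc a b) : h θ = 0 := by
  refine hJ θ fun hc => hn ?_
  rw [hJab, closure_exp_image_Ioo hab] at hc
  exact exp_mem_image_Icc ha hb hθ hc

theorem integral_shift_of_periodic {u : ℝ → ℝ} (hu : Function.Periodic u (2 * Real.pi)) (t : ℝ) :
    ∫ θ in (0)..(2 * Real.pi), u θ = ∫ θ in t..(t + 2 * Real.pi), u θ := by
  rw [hu.intervalIntegral_add_eq t 0, zero_add]

/-- The braiding phase: for densities `λᵢ = Λᵢ' + ℓ₁` of charge one whose localization regions are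
disjoint intervals of the circle cut at `p`, the sign depends only on their order. -/
theorem braiding_phase {ℓ₁ : SmoothLoop ℝ} (hcharge : ℓ₁.charge = 1) {p : Circle}
    {J₁ J₂ K₁ K₂ : ProperInterval} {Λ₁ Λ₂ : SmoothLoop ℝ} (h₁ : IsTransport ℓ₁ p J₁ K₁ Λ₁)
    (h₂ : IsTransport ℓ₁ p J₂ K₂ Λ₂) (hd : Disjoint J₁.carrier J₂.carrier) :
    pairing Λ₂.toFun ℓ₁.toFun - pairing Λ₁.toFun ℓ₁.toFun - pairing Λ₁.toFun (deriv Λ₂.toFun)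
        = Real.pi ∨
      pairing Λ₂.toFun ℓ₁.toFun - pairing Λ₁.toFun ℓ₁.toFun - pairing Λ₁.toFun (deriv Λ₂.toFun)
        = -Real.pi := by
  obtain ⟨t, rfl⟩ := Circle.exp_surjective p
  have hpi := Real.two_pi_pos
  obtain ⟨I₁, hI₁, hp₁, hl₁⟩ := h₁.localized
  obtain ⟨I₂, hI₂, hp₂, hl₂⟩ := h₂.localized
  obtain ⟨a₁, b₁, ha₁, hab₁, hb₁, hc₁⟩ := I₁.exists_eq_image hp₁
  obtain ⟨a₂, b₂, ha₂, hab₂, hb₂, hc₂⟩ := I₂.exists_eq_image hp₂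
  have hdis : Disjoint (Set.Ioo a₁ b₁) (Set.Ioo a₂ b₂) := by
    rw [Set.disjoint_left]
    intro x hx₁ hx₂
    have m₁ : Circle.exp x ∈ I₁.carrier := hc₁ ▸ ⟨x, hx₁, rfl⟩
    have m₂ : Circle.exp x ∈ I₂.carrier := hc₂ ▸ ⟨x, hx₂, rfl⟩
    exact Set.disjoint_left.1 hd (hI₁ m₁) (hI₂ m₂)
  have hcl := ℓ₁.continuous
  have hdl : ∀ x, HasDerivAt (fun x => ∫ y in t..x, ℓ₁ y) (ℓ₁ x) x := fun x =>
    intervalIntegral.integral_hasDerivAt_right (hcl.intervalIntegrable _ _)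
      (hcl.stronglyMeasurableAtFilter _ _) hcl.continuousAt
  -- A primitive of `ℓ₁` on the cut circle. It is not a loop: charge one makes it gain `2π` over one
  -- turn.
  set L : ℝ → ℝ := fun x => ∫ y in t..x, ℓ₁ y with hL
  have hLt : L t = 0 := by simp [hL]
  have hLe : L (t + 2 * Real.pi) = 2 * Real.pi := by
    have : ∫ y in (0)..(2 * Real.pi), ℓ₁ y = 2 * Real.pi := by
      rw [SmoothLoop.charge] at hcharge
      field_simp at hcharge
      exact hcharge
    simp only [hL]
    rw [← integral_shift_of_periodic ℓ₁.periodic, this]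
  have hcL : Continuous L := continuous_iff_continuousAt.2 fun x => (hdl x).continuousAt
  have hc1 := Λ₁.continuous
  have hc2 := Λ₂.continuous
  have hcd1 := Λ₁.continuous_deriv
  have hcd2 := Λ₂.continuous_deriv
  have z₁ : Λ₁ t = 0 := h₁.supported.eq_zero h₁.cut
  have z₂ : Λ₂ t = 0 := h₂.supported.eq_zero h₂.cut
  have e₁ : Λ₁ (t + 2 * Real.pi) = 0 := by rw [Λ₁.periodic, z₁]
  have e₂ : Λ₂ (t + 2 * Real.pi) = 0 := by rw [Λ₂.periodic, z₂]
  -- the primitive of the second density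
  have hA : ∀ x, HasDerivAt (fun x => Λ₂ x + L x) (deriv Λ₂.toFun x + ℓ₁ x) x := fun x =>
    (Λ₂.hasDerivAt x).add (hdl x)
  have hcA : Continuous fun x => Λ₂ x + L x := hc2.add hcL
  have hconst : ∀ x y, x ≤ y → (∀ θ ∈ Set.Ioo x y, deriv Λ₂.toFun θ + ℓ₁ θ = 0) →
      Λ₂ y + L y = Λ₂ x + L x := by
    intro x y hxy h0
    have h := intervalIntegral.integral_eq_sub_of_hasDerivAt (a := x) (b := y) (fun θ _ => hA θ)
      ((hcd2.add hcl).intervalIntegrable _ _)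
    rw [intervalIntegral.integral_congr_Ioo_of_le (g := fun _ => (0 : ℝ)) hxy h0,
      intervalIntegral.integral_zero] at h
    linarith
  -- `Λ₂ + L` runs from `0` at `t` to `2π` at `t + 2π` and is constant off `[a₂, b₂]`. On `[a₁, b₁]`
  -- it is thus `0` if `I₁` comes before `I₂` and `2π` if it comes after; off `[a₁, b₁]` the factor
  -- `Λ₁' + ℓ₁` vanishes.
  have key : ∃ c : ℝ, (c = 0 ∨ c = 2 * Real.pi) ∧ ∀ θ ∈ Set.Ioo t (t + 2 * Real.pi),
      (Λ₂ θ + L θ) * (deriv Λ₁.toFun θ + ℓ₁ θ) = c * (deriv Λ₁.toFun θ + ℓ₁ θ) := by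
    have hord : b₁ ≤ a₂ ∨ b₂ ≤ a₁ := by
      rw [Set.Ioo_disjoint_Ioo, min_le_iff, le_max_iff, le_max_iff] at hdis
      rcases hdis with (h | h) | (h | h)
      · exact absurd h (not_le.2 hab₁)
      · exact Or.inl h
      · exact Or.inr h
      · exact absurd h (not_le.2 hab₂)
    have hz : ∀ θ ∈ Set.Ioo t (t + 2 * Real.pi), θ ∉ Set.Icc a₂ b₂ →
        deriv Λ₂.toFun θ + ℓ₁ θ = 0 := fun θ hθ hn => hl₂.eq_zero_of_mem hc₂ hab₂ ha₂ hb₂ hθ hn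
    rcases hord with h | h
    · refine ⟨0, Or.inl rfl, fun θ hθ => ?_⟩
      by_cases hm : θ ∈ Set.Icc a₁ b₁
      · have := hconst t θ hθ.1.le fun x hx => hz x ⟨hx.1, hx.2.trans hθ.2⟩ fun hx' => by
          linarith [hx'.1, hx.2, hm.2]
        rw [this, z₂, hLt, add_zero]
      · have hz₁ : deriv Λ₁.toFun θ + ℓ₁ θ = 0 := hl₁.eq_zero_of_mem hc₁ hab₁ ha₁ hb₁ hθ hm
        rw [hz₁, mul_zero, mul_zero]
    · refine ⟨2 * Real.pi, Or.inr rfl, fun θ hθ => ?_⟩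
      by_cases hm : θ ∈ Set.Icc a₁ b₁
      · have := hconst θ (t + 2 * Real.pi) hθ.2.le fun x hx => hz x ⟨hθ.1.trans hx.1, hx.2⟩
          fun hx' => by linarith [hx'.2, hx.1, hm.1]
        rw [← this, e₂, hLe, zero_add]
      · have hz₁ : deriv Λ₁.toFun θ + ℓ₁ θ = 0 := hl₁.eq_zero_of_mem hc₁ hab₁ ha₁ hb₁ hθ hm
        rw [hz₁, mul_zero, mul_zero]
  obtain ⟨c, hc, hkey⟩ := key
  have i1 := intervalIntegral.integral_congr_Ioo_of_le (μ := volume)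
    (by linarith : t ≤ t + 2 * Real.pi) hkey
  have i2 : ∫ θ in t..(t + 2 * Real.pi), c * (deriv Λ₁.toFun θ + ℓ₁ θ) = c * (2 * Real.pi) := by
    rw [intervalIntegral.integral_const_mul, intervalIntegral.integral_eq_sub_of_hasDerivAt
      (f := fun x => Λ₁ x + L x) (fun θ _ => (Λ₁.hasDerivAt θ).add (hdl θ))
      ((hcd1.add hcl).intervalIntegrable _ _), z₁, e₁, hLt, hLe]
    ring
  -- An exact derivative, of `Λ₂Λ₁ + LΛ₁ + L²/2`. At the cut both `Λᵢ` vanish, so only `L²/2`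
  -- contributes, namely `(2π)²/2`.
  have i3 : ∫ θ in t..(t + 2 * Real.pi), (deriv Λ₂.toFun θ * Λ₁ θ + Λ₂ θ * deriv Λ₁.toFun θ
      + (ℓ₁ θ * Λ₁ θ + L θ * deriv Λ₁.toFun θ) + L θ * ℓ₁ θ) = 2 * Real.pi * Real.pi := by
    rw [intervalIntegral.integral_eq_sub_of_hasDerivAt
      (f := fun x => Λ₂ x * Λ₁ x + L x * Λ₁ x + L x * L x / 2) (fun θ _ => ?_)
      (Continuous.intervalIntegrable (by fun_prop) _ _), z₁, e₁, hLt, hLe]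
    · ring
    · refine ((((Λ₂.hasDerivAt θ).mul (Λ₁.hasDerivAt θ)).add
        ((hdl θ).mul (Λ₁.hasDerivAt θ))).add (((hdl θ).mul (hdl θ)).div_const 2)).congr_deriv ?_
      ring
  have i4 : pairing Λ₂.toFun ℓ₁.toFun - pairing Λ₁.toFun ℓ₁.toFun
      - pairing Λ₁.toFun (deriv Λ₂.toFun) = (2 * Real.pi)⁻¹ *
        ∫ θ in t..(t + 2 * Real.pi), (Λ₂ θ * ℓ₁ θ - Λ₁ θ * ℓ₁ θ - Λ₁ θ * deriv Λ₂.toFun θ) := by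
    rw [pairing, pairing, pairing, ← mul_sub, ← mul_sub, ← intervalIntegral.integral_sub,
      ← intervalIntegral.integral_sub]
    · rw [← integral_shift_of_periodic]
      · congr 2
        funext θ
        simp [mul_comm]
      · intro θ
        simp only [Λ₁.periodic θ, Λ₂.periodic θ, ℓ₁.periodic θ, Λ₂.periodic_deriv θ]
    all_goals exact Continuous.intervalIntegrable (by fun_prop) _ _
  -- The integrand is `(Λ₂ + L)(Λ₁' + ℓ₁)` minus that exact derivative. After division by `2π` the
  -- value is `c - π`.
  have i5 : ∫ θ in t..(t + 2 * Real.pi), (Λ₂ θ * ℓ₁ θ - Λ₁ θ * ℓ₁ θ - Λ₁ θ * deriv Λ₂.toFun θ)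
      = c * (2 * Real.pi) - 2 * Real.pi * Real.pi := by
    rw [← i2, ← i1, ← i3, ← intervalIntegral.integral_sub]
    · congr 1
      funext θ
      ring
    all_goals exact Continuous.intervalIntegrable (by fun_prop) _ _
  rw [i4, i5]
  rcases hc with rfl | rfl
  · right; field_simp; ring
  · left; field_simp; ring

/-! ### Existence of transport data -/

/-- Bump functions on the circle of charge one, localized near a given point. -/
theorem exists_bump (m δ : ℝ) (hδ : 0 < δ) (hδ' : δ < Real.pi) :
    ∃ β : SmoothLoop ℝ, β.charge = 1 ∧
      ∀ θ, Circle.exp θ ∉ Circle.exp '' Set.Icc (m - δ) (m + δ) → β θ = 0 := by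
  -- Periodic and smooth by construction; positive exactly where `cos (θ - m) > cos δ`, that is
  -- within `δ` of `m` modulo `2π`.
  let β : ℝ → ℝ := fun θ => expNegInvGlue (Real.cos (θ - m) - Real.cos δ)
  have hβs : ContDiff ℝ ∞ β := expNegInvGlue.contDiff.comp (by fun_prop)
  have hβp : Function.Periodic β (2 * Real.pi) := fun θ => by
    have : θ + 2 * Real.pi - m = θ - m + 2 * Real.pi := by ring
    simp only [β, this, Real.cos_add_two_pi]
  have hβm : 0 < β m := by
    apply expNegInvGlue.pos_of_pos
    have := Real.cos_lt_cos_of_nonneg_of_le_pi le_rfl hδ'.le hδ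
    simp only [sub_self]
    linarith
  have hc0 : 0 < ∫ θ in (0)..(2 * Real.pi), β θ := by
    rw [integral_shift_of_periodic hβp m]
    exact intervalIntegral.integral_pos (by linarith [Real.pi_pos]) hβs.continuous.continuousOn
      (fun θ _ => expNegInvGlue.nonneg _) ⟨m, ⟨le_rfl, by linarith [Real.pi_pos]⟩, hβm⟩
  set c : ℝ := (2 * Real.pi)⁻¹ * ∫ θ in (0)..(2 * Real.pi), β θ with hc
  have hcpos : 0 < c := by positivity
  refine ⟨⟨fun θ => c⁻¹ * β θ, contDiff_const.mul hβs, fun θ => by simp only [hβp θ]⟩, ?_, ?_⟩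
  · rw [SmoothLoop.charge]
    simp only
    rw [intervalIntegral.integral_const_mul, mul_left_comm, ← hc, inv_mul_cancel₀ hcpos.ne']
  · intro θ hθ
    obtain ⟨s, hs, he⟩ := exists_exp_eq_mem_Ico (Circle.exp θ) (m - Real.pi)
    have h0 : β s = 0 := by
      apply expNegInvGlue.zero_of_nonpos
      rw [sub_nonpos, ← Real.cos_abs (s - m)]
      refine Real.cos_le_cos_of_nonneg_of_le_pi hδ.le ?_ ?_
      · rw [abs_le]; constructor <;> linarith [hs.1, hs.2]
      · by_contra! hlt
        rw [abs_lt] at hlt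
        exact hθ (he ▸ ⟨s, ⟨by linarith, by linarith⟩, rfl⟩)
    obtain ⟨k, rfl⟩ := Circle.exp_eq_exp.1 he
    show c⁻¹ * β θ = 0
    rw [← hβp.int_mul k θ, h0, mul_zero]

/-- Transport data exist. -/
theorem exists_isTransport {ℓ₁ : SmoothLoop ℝ} (hcharge : ℓ₁.charge = 1) {I : ProperInterval}
    (hloc : LocalizedIn ℓ₁.toFun I) {p : Circle} (hp : p ∉ closure I.carrier)
    (J : ProperInterval) : ∃ (K : ProperInterval) (Λ : SmoothLoop ℝ), IsTransport ℓ₁ p J K Λ := by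
  obtain ⟨t, rfl⟩ := Circle.exp_surjective p
  have hpi := Real.two_pi_pos
  obtain ⟨a, b, hta, hab, hbt, hI, -⟩ := I.exists_eq_image_of_notMem_closure hp
  -- A small arc of `J` whose closure avoids the cut. The given point of `J` may be `p` itself, so
  -- the centre is moved to its right by `η/2` and the radius is `η/4`.
  obtain ⟨m, δ, hδ, htm, hmt, hδπ, hJ⟩ : ∃ m δ : ℝ, 0 < δ ∧ t < m - δ ∧ m + δ < t + 2 * Real.pi ∧
      δ < Real.pi ∧ Circle.exp '' Set.Ioo (m - δ) (m + δ) ⊆ J.carrier := by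
    obtain ⟨z, hz⟩ := J.isConnected.nonempty
    obtain ⟨θ₀, hθ₀, rfl⟩ := exists_exp_eq_mem_Ico z t
    obtain ⟨ε, hε, hball⟩ := Metric.isOpen_iff.1 (J.isOpen.preimage Circle.exp.continuous) θ₀ hz
    set η := min ε (t + 2 * Real.pi - θ₀) with hη
    have hη0 : 0 < η := lt_min hε (by linarith [hθ₀.2])
    have h1 : η ≤ ε := min_le_left _ _
    have h2 : η ≤ t + 2 * Real.pi - θ₀ := min_le_right _ _
    refine ⟨θ₀ + η / 2, η / 4, by positivity, by linarith [hθ₀.1], by linarith,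
      by linarith [hθ₀.1], ?_⟩
    rintro _ ⟨x, hx, rfl⟩
    apply hball
    rw [Metric.mem_ball, Real.dist_eq, abs_lt]
    constructor <;> linarith [hx.1, hx.2]
  obtain ⟨β, hβ1, hβ0⟩ := exists_bump m δ hδ hδπ
  have hcβ := β.continuous
  have hcl := ℓ₁.continuous
  -- `β` and `ℓ₁` have the same charge, so the primitive of `β - ℓ₁` is a loop `Λ`, and `Λ' + ℓ₁ =
  -- β` is localized in the small arc.
  let g : ℝ → ℝ := fun θ => β θ - ℓ₁ θ
  have hgs : ContDiff ℝ ∞ g := β.smooth.sub ℓ₁.smooth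
  have hgp : Function.Periodic g (2 * Real.pi) := fun θ => by
    simp only [g, β.periodic θ, ℓ₁.periodic θ]
  have hg0 : ∀ x, ∫ θ in x..(x + 2 * Real.pi), g θ = 0 := by
    intro x
    rw [← integral_shift_of_periodic hgp, intervalIntegral.integral_sub
      (hcβ.intervalIntegrable _ _) (hcl.intervalIntegrable _ _)]
    have h1 := hβ1.trans hcharge.symm
    rw [SmoothLoop.charge, SmoothLoop.charge] at h1
    rw [mul_left_cancel₀ (by positivity) h1, sub_self]
  have hderiv : ∀ θ, HasDerivAt (fun x => ∫ y in t..x, g y) (g θ) θ := fun θ =>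
    intervalIntegral.integral_hasDerivAt_right (hgs.continuous.intervalIntegrable _ _)
      (hgs.continuous.stronglyMeasurableAtFilter _ _) hgs.continuous.continuousAt
  have hder : deriv (fun x => ∫ y in t..x, g y) = g := funext fun θ => (hderiv θ).deriv
  have hper : Function.Periodic (fun x => ∫ y in t..x, g y) (2 * Real.pi) := by
    intro x
    have h1 := intervalIntegral.integral_add_adjacent_intervals
      (hgs.continuous.intervalIntegrable (μ := volume) t x)
      (hgs.continuous.intervalIntegrable (μ := volume) x (x + 2 * Real.pi))
    simp only
    rw [← h1, hg0, add_zero]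
  let Λ : SmoothLoop ℝ := ⟨fun x => ∫ y in t..x, g y, by
    rw [contDiff_infty_iff_deriv, hder]
    exact ⟨fun θ => (hderiv θ).differentiableAt, hgs⟩, hper⟩
  -- `[A, B]` is the hull, in the cut circle, of the localization arcs of `ℓ₁` and `β`. It stays
  -- away from both ends, and outside it `Λ` vanishes.
  set A := min a (m - δ) with hA
  set B := max b (m + δ) with hB
  have hA1 : A ≤ a := min_le_left _ _
  have hA2 : A ≤ m - δ := min_le_right _ _
  have hB1 : b ≤ B := le_max_left _ _
  have hB2 : m + δ ≤ B := le_max_right _ _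
  have htA : t < A := lt_min hta htm
  have hBt : B < t + 2 * Real.pi := max_lt hbt hmt
  have hgz : ∀ θ ∈ Set.Ioo t (t + 2 * Real.pi), θ ∉ Set.Icc A B → g θ = 0 := by
    intro θ hθ hn
    have h1 : ℓ₁ θ = 0 := hloc.eq_zero_of_mem hI hab hta.le hbt.le hθ
      fun h => hn ⟨hA1.trans h.1, h.2.trans hB1⟩
    have h2 : β θ = 0 := hβ0 θ fun h => hn <| by
      have := exp_mem_image_Icc htm.le hmt.le hθ h
      exact ⟨hA2.trans this.1, this.2.trans hB2⟩
    simp only [g, h1, h2, sub_self]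
  have hΛ1 : ∀ x ∈ Set.Ico t A, Λ x = 0 := by
    intro x hx
    show ∫ y in t..x, g y = 0
    rw [intervalIntegral.integral_congr_Ioo_of_le (g := fun _ => (0 : ℝ)) hx.1,
      intervalIntegral.integral_zero]
    exact fun y hy => hgz y ⟨hy.1, by linarith [hy.2, hx.2]⟩ fun h => by linarith [h.1, hy.2, hx.2]
  have hΛ2 : ∀ x ∈ Set.Ioo B (t + 2 * Real.pi), Λ x = 0 := by
    intro x hx
    show ∫ y in t..x, g y = 0
    have h1 := intervalIntegral.integral_add_adjacent_intervals
      (hgs.continuous.intervalIntegrable (μ := volume) t x)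
      (hgs.continuous.intervalIntegrable (μ := volume) x (t + 2 * Real.pi))
    rw [hg0, intervalIntegral.integral_congr_Ioo_of_le (a := x) (g := fun _ => (0 : ℝ)) hx.2.le,
      intervalIntegral.integral_zero, add_zero] at h1
    · exact h1
    · exact fun y hy => hgz y ⟨by linarith [hy.1, hx.1], hy.2⟩ fun h => by linarith [h.2, hy.1, hx.1]
  have hsupp : Λ.SupportedIn (Circle.exp '' Set.Icc A B) := by
    refine SmoothLoop.supportedIn_of_isClosed
      (isCompact_Icc.image Circle.exp.continuous).isClosed fun θ hθ => ?_
    obtain ⟨s, hs, he⟩ := exists_exp_eq_mem_Ico (Circle.exp θ) t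
    rw [← Λ.eq_of_exp_eq he]
    rcases lt_or_ge s A with h | h
    · exact hΛ1 s ⟨hs.1, h⟩
    · refine hΛ2 s ⟨?_, hs.2⟩
      by_contra! h'
      exact hθ (he ▸ ⟨s, ⟨h, h'⟩, rfl⟩)
  -- The endpoints of `K` lie halfway between the hull and the cut, so `K` contains the closed arc
  -- `[A, B]` and omits `p`.
  refine ⟨arc ((t + A) / 2) ((B + (t + 2 * Real.pi)) / 2) (by linarith) (by linarith), Λ, ?_, ?_,
    arc (m - δ) (m + δ) (by linarith) (by linarith), hJ, ?_, ?_⟩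
  · rintro ⟨s, hs, he⟩
    have := exp_injOn_Ico_two_pi t ⟨by linarith [hs.1], by linarith [hs.2]⟩
      ⟨le_rfl, by linarith⟩ he
    linarith [hs.1]
  · exact hsupp.mono (Set.image_mono (Set.Icc_subset_Ioo (by linarith) (by linarith)))
  · rintro ⟨s, hs, he⟩
    have := exp_injOn_Ico_two_pi t ⟨by linarith [hs.1], by linarith [hs.2]⟩
      ⟨le_rfl, by linarith⟩ he
    linarith [hs.1]
  · intro θ hθ
    show deriv (fun x => ∫ y in t..x, g y) θ + ℓ₁ θ = 0
    rw [hder]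
    have : β θ = 0 := hβ0 θ fun h => hθ <| by
      show _ ∈ closure (Circle.exp '' Set.Ioo (m - δ) (m + δ))
      rwa [closure_exp_image_Ioo (by linarith)]
    simp only [g, this]
    ring

/-! ### Weyl unitaries of loops supported in the closure of an interval -/

theorem exists_bound_of_periodic {E : Type*} [NormedAddCommGroup E] {u : ℝ → E}
    (hu : Continuous u) (hp : Function.Periodic u (2 * Real.pi)) :
    ∃ C, 0 ≤ C ∧ ∀ x, ‖u x‖ ≤ C := by
  obtain ⟨C, hC⟩ := (isCompact_Icc (a := (0 : ℝ)) (b := 2 * Real.pi)).exists_bound_of_continuousOn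
    hu.continuousOn
  refine ⟨C, (norm_nonneg _).trans (hC 0 ⟨le_rfl, Real.two_pi_pos.le⟩), fun x => ?_⟩
  obtain ⟨y, hy, hxy⟩ := hp.exists_mem_Ico₀ Real.two_pi_pos x
  rw [hxy]
  exact hC y ⟨hy.1, hy.2.le⟩

/-- The lift `θ ↦ θ + s sin(θ - m)` of a map of the circle that fixes `m` and `m + π` and moves
points away from `m` when `s > 0`. -/
def flow (m s θ : ℝ) : ℝ := θ + s * Real.sin (θ - m)

theorem flow_add_int_mul (m s θ : ℝ) (k : ℤ) :
    flow m s (θ + k * (2 * Real.pi)) = flow m s θ + k * (2 * Real.pi) := by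
  rw [flow, flow, show θ + k * (2 * Real.pi) - m = θ - m + k * (2 * Real.pi) by ring,
    Real.sin_add_int_mul_two_pi]
  ring

theorem hasDerivAt_flow (m s θ : ℝ) : HasDerivAt (flow m s) (1 + s * Real.cos (θ - m)) θ := by
  have h := (hasDerivAt_id θ).add ((((hasDerivAt_id θ).sub_const m).sin).const_mul s)
  refine h.congr_deriv ?_
  simp

theorem contDiff_flow (m s : ℝ) : ContDiff ℝ ∞ (flow m s) := by
  unfold flow
  fun_prop

theorem monotone_flow {m s : ℝ} (hs : 0 ≤ s) (hs1 : s ≤ 1) : Monotone (flow m s) := by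
  refine monotone_of_deriv_nonneg (fun θ => (hasDerivAt_flow m s θ).differentiableAt) fun θ => ?_
  rw [(hasDerivAt_flow m s θ).deriv]
  nlinarith [Real.neg_one_le_cos (θ - m)]

/-- The pull-back of a loop along the flow. -/
def SmoothLoop.compFlow {E : Type*} [NormedAddCommGroup E] [NormedSpace ℝ E] (f : SmoothLoop E)
    (m s : ℝ) : SmoothLoop E where
  toFun θ := f (flow m s θ)
  smooth := f.smooth.comp (contDiff_flow m s)
  periodic θ := by
    have h := flow_add_int_mul m s θ 1
    rw [Int.cast_one, one_mul] at h
    simp only [h, f.periodic (flow m s θ)]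

/-- The derivative of `f ∘ flow` differs from `f'` by `O(s)`: a bound on `f''` controls the
displaced argument, a bound on `f'` the chain-rule factor `s cos(θ - m)`. Then `norm_vec_le`
applies. -/
theorem SmoothLoop.norm_vec_compFlow_sub_le {n : ℕ} (f : SmoothLoop (Euc n)) (m : ℝ) :
    ∃ C, 0 ≤ C ∧ ∀ s, 0 ≤ s → ‖(f.compFlow m s).vec - f.vec‖ ≤ s * C := by
  have hd2 : ContDiff ℝ ∞ (deriv (deriv f.toFun)) := (contDiff_infty_iff_deriv.1 f.contDiff_deriv).2
  obtain ⟨C, hC0, hC⟩ := exists_bound_of_periodic f.continuous_deriv f.periodic_deriv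
  obtain ⟨D, hD0, hD⟩ := exists_bound_of_periodic hd2.continuous (u := deriv (deriv f.toFun))
    (fun θ => by rw [← deriv_comp_add_const, funext f.periodic_deriv])
  refine ⟨C + D, by positivity, fun s hs => ?_⟩
  rw [← SmoothLoop.vec_sub]
  refine SmoothLoop.norm_vec_le _ (by positivity) fun θ => ?_
  have h1 : deriv ((f.compFlow m s).sub f).toFun θ
      = (1 + s * Real.cos (θ - m)) • deriv f.toFun (flow m s θ) - deriv f.toFun θ :=
    (((f.hasDerivAt (flow m s θ)).scomp θ (hasDerivAt_flow m s θ)).sub (f.hasDerivAt θ)).deriv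
  have h2 : ‖deriv f.toFun (flow m s θ) - deriv f.toFun θ‖ ≤ D * ‖flow m s θ - θ‖ :=
    Convex.norm_image_sub_le_of_norm_deriv_le (s := Set.univ)
      (fun x _ => (f.contDiff_deriv.differentiable (by simp) x)) (fun x _ => hD x) convex_univ
      (Set.mem_univ _) (Set.mem_univ _)
  have h3 : ‖flow m s θ - θ‖ ≤ s := by
    rw [flow, add_sub_cancel_left, Real.norm_eq_abs, abs_mul, abs_of_nonneg hs]
    exact mul_le_of_le_one_right hs (Real.abs_sin_le_one _)
  rw [h1, show (1 + s * Real.cos (θ - m)) • deriv f.toFun (flow m s θ) - deriv f.toFun θ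
    = (deriv f.toFun (flow m s θ) - deriv f.toFun θ)
      + (s * Real.cos (θ - m)) • deriv f.toFun (flow m s θ) by rw [add_smul, one_smul]; abel]
  refine (norm_add_le _ _).trans ?_
  have h4 : ‖(s * Real.cos (θ - m)) • deriv f.toFun (flow m s θ)‖ ≤ s * C := by
    rw [norm_smul, Real.norm_eq_abs, abs_mul, abs_of_nonneg hs]
    exact mul_le_mul (mul_le_of_le_one_right hs (Real.abs_cos_le_one _)) (hC _) (norm_nonneg _) hs
  have h5 : D * ‖flow m s θ - θ‖ ≤ D * s := by gcongr
  linarith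

/-- The flow away from the midpoint pushes both endpoints outwards, so the preimage of the closed
arc, and with it the support of the pull-back, lies inside the open arc. The bound `s ≤ 1` keeps the
flow monotone. -/
theorem SmoothLoop.SupportedIn.compFlow {E : Type*} [NormedAddCommGroup E] [NormedSpace ℝ E]
    {f : SmoothLoop E} {a b s : ℝ} (hab : a < b) (hb : b < a + 2 * Real.pi)
    (hf : f.SupportedIn (Circle.exp '' Set.Icc a b)) (hs : 0 < s) (hs1 : s ≤ 1) :
    (f.compFlow ((a + b) / 2) s).SupportedIn (Circle.exp '' Set.Ioo a b) := by
  set m := (a + b) / 2 with hm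
  have hcont : Continuous (flow m s) := (contDiff_flow m s).continuous
  have h1 : tsupport (f.compFlow m s).toFun ⊆
      flow m s ⁻¹' (Circle.exp ⁻¹' (Circle.exp '' Set.Icc a b)) := by
    refine closure_minimal (fun θ hθ => hf (subset_tsupport _ hθ)) ?_
    exact ((isCompact_Icc.image Circle.exp.continuous).isClosed.preimage
      Circle.exp.continuous).preimage hcont
  intro θ hθ
  have h2 := h1 hθ
  by_contra hn
  obtain ⟨x, hx, he⟩ := exists_exp_eq_mem_Ico (Circle.exp θ) b
  obtain ⟨k, rfl⟩ := Circle.exp_eq_exp.1 he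
  have hsin : 0 < Real.sin ((b - a) / 2) :=
    Real.sin_pos_of_pos_of_lt_pi (by linarith) (by linarith)
  set x := θ + k * (2 * Real.pi) with hxdef
  -- A point off the open arc lifts to the closed gap `[b, a + 2π]`, which the flow maps into the
  -- open gap.
  have hxa : x ≤ a + 2 * Real.pi := by
    by_contra! hlt
    refine hn ⟨x - 2 * Real.pi, ⟨by linarith, by linarith [hx.2]⟩, ?_⟩
    rw [Circle.exp_sub_two_pi, he]
  have hlow : b < flow m s x := by
    refine lt_of_lt_of_le ?_ (monotone_flow hs.le hs1 hx.1)
    rw [flow, show b - m = (b - a) / 2 by rw [hm]; ring]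
    linarith [mul_pos hs hsin]
  have hupp : flow m s x < a + 2 * Real.pi := by
    refine lt_of_le_of_lt (monotone_flow hs.le hs1 hxa) ?_
    rw [flow, show a + 2 * Real.pi - m = -((b - a) / 2) + 2 * Real.pi by rw [hm]; ring,
      Real.sin_add_two_pi, Real.sin_neg]
    linarith [mul_pos hs hsin]
  have h3 : Circle.exp (flow m s x) = Circle.exp (flow m s θ) := by
    rw [hxdef, flow_add_int_mul]
    exact Circle.exp_eq_exp.2 ⟨k, rfl⟩
  have h4 : Circle.exp (flow m s x) ∈ Circle.exp '' Set.Icc a b := h3 ▸ h2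
  have h5 := exp_mem_image_Icc (t := a) le_rfl hb.le ⟨by linarith, hupp⟩ h4
  linarith [h5.2]

/-- The local algebra of `K` contains the Weyl unitaries of all loops supported in the closure
of `K`. -/
theorem weyl_mem_localAlg {n : ℕ} {K : ProperInterval} {f : SmoothLoop (Euc n)}
    (hf : f.SupportedIn (closure K.carrier)) : weyl f.vec ∈ localAlg n K := by
  obtain ⟨t, ht⟩ := K.exists_notMem_closure
  obtain ⟨a, b, hta, hab, hbt, hK, hcl⟩ := K.exists_eq_image_of_notMem_closure ht
  rw [hcl] at hf
  obtain ⟨C, hC0, hC⟩ := f.norm_vec_compFlow_sub_le ((a + b) / 2)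
  refine (isClosed_weyl_mem (localAlg n K)).closure_subset (Metric.mem_closure_iff.2 fun ε hε => ?_)
  -- `C + 1` rather than `C`, because `C` may be zero; it also makes the final inequality strict.
  set s := min 1 (ε / (C + 1)) with hs
  have hs0 : 0 < s := lt_min one_pos (by positivity)
  refine ⟨(f.compFlow ((a + b) / 2) s).vec, subset_vonNeumannGenerated _ ⟨_, ?_, rfl⟩, ?_⟩
  · rw [hK]
    exact hf.compFlow hab (by linarith) hs0 (min_le_left _ _)
  · rw [dist_comm, dist_eq_norm]
    refine (hC s hs0.le).trans_lt ?_
    calc s * C < s * (C + 1) := by nlinarith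
      _ ≤ ε / (C + 1) * (C + 1) := by gcongr; exact min_le_right _ _
      _ = ε := by field_simp

/-- A scalar loop whose derivative is localized in `I` and that vanishes at a point off the closure
of `I` is supported in the closure of `I`. -/
theorem supportedIn_closure_of_deriv {I : ProperInterval} {t : ℝ}
    (ht : Circle.exp t ∉ closure I.carrier) {Λ : SmoothLoop ℝ} (h0 : Λ t = 0)
    (hd : LocalizedIn (deriv Λ.toFun) I) : Λ.SupportedIn (closure I.carrier) := by
  obtain ⟨a, b, hta, hab, hbt, hI, hcl⟩ := I.exists_eq_image_of_notMem_closure ht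
  refine SmoothLoop.supportedIn_of_isClosed isClosed_closure fun θ hθ => ?_
  obtain ⟨x, hx, he⟩ := exists_exp_eq_mem_Ico (Circle.exp θ) t
  rw [← Λ.eq_of_exp_eq he]
  have hconst : ∀ x y, x ≤ y → (∀ θ ∈ Set.Ioo x y, deriv Λ.toFun θ = 0) → Λ y = Λ x := by
    intro x y hxy hz
    have h := intervalIntegral.integral_eq_sub_of_hasDerivAt (a := x) (b := y)
      (fun θ _ => Λ.hasDerivAt θ) (Λ.continuous_deriv.intervalIntegrable _ _)
    rw [intervalIntegral.integral_congr_Ioo_of_le (g := fun _ => (0 : ℝ)) hxy hz,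
      intervalIntegral.integral_zero] at h
    linarith
  have hz : ∀ y ∈ Set.Ioo t (t + 2 * Real.pi), y ∉ Set.Icc a b → deriv Λ.toFun y = 0 :=
    fun y hy hn => hd.eq_zero_of_mem hI hab hta.le hbt.le hy hn
  rcases lt_or_ge x a with h | h
  · rw [hconst t x hx.1 fun y hy => hz y ⟨hy.1, by linarith [hy.2]⟩ fun hn => by
      linarith [hn.1, hy.2], h0]
  · have hxb : b < x := by
      by_contra! hle
      rw [← he, hcl] at hθ
      exact hθ ⟨x, ⟨h, hle⟩, rfl⟩
    rw [← hconst x (t + 2 * Real.pi) hx.2.le fun y hy => hz y ⟨by linarith [hy.1], hy.2⟩ fun hn => by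
      linarith [hn.2, hy.1], Λ.periodic, h0]

/-! ### Generated von Neumann algebras -/

theorem vonNeumannGenerated_subset {H : Type*} [NormedAddCommGroup H] [InnerProductSpace ℂ H]
    [CompleteSpace H] {S : Set (H →L[ℂ] H)} {M : VonNeumannAlgebra H}
    (h : S ⊆ (M : Set (H →L[ℂ] H))) :
    (vonNeumannGenerated S : Set (H →L[ℂ] H)) ⊆ (M : Set (H →L[ℂ] H)) := by
  intro a ha
  rw [SetLike.mem_coe, mem_vonNeumannGenerated_iff] at ha
  rw [← M.centralizer_centralizer, Set.mem_centralizer_iff]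
  intro y hy
  rw [Set.mem_centralizer_iff] at hy
  exact ha y fun s hs => ⟨hy s (h hs), hy (star s) (star_mem (S := VonNeumannAlgebra H) (h hs))⟩

/-- The bicommutant description is used twice, first for `x` and then for `y`. Taking adjoints
yields the missing relations with `star s`. -/
theorem vonNeumannGenerated_commute {H : Type*} [NormedAddCommGroup H] [InnerProductSpace ℂ H]
    [CompleteSpace H] {S T : Set (H →L[ℂ] H)}
    (h : ∀ s ∈ S, ∀ t ∈ T, s * t = t * s ∧ s * star t = star t * s) {x y : H →L[ℂ] H}
    (hx : x ∈ vonNeumannGenerated S) (hy : y ∈ vonNeumannGenerated T) : x * y = y * x := by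
  rw [mem_vonNeumannGenerated_iff] at hx hy
  refine hy x fun t ht => ⟨hx t fun s hs => ⟨(h s hs t ht).1, ?_⟩,
    hx (star t) fun s hs => ⟨(h s hs t ht).2, ?_⟩⟩
  · simpa using congrArg star (h s hs t ht).2.symm
  · simpa using congrArg star (h s hs t ht).1.symm

/-! ### Representations on direct sums -/

theorem crossedRep_apply {G H : Type*} [AddCommGroup G] [NormedAddCommGroup H]
    [InnerProductSpace ℂ H] [CompleteSpace H] (M : VonNeumannAlgebra H) (α : G → (M ≃⋆ₐ[ℂ] M))
    (a : M) (ξ : CrossedSpace G H) (x : G) :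
    crossedRep M α a ξ x = (α (-x) a : H →L[ℂ] H) (ξ x) := rfl

theorem implementer_apply {G H : Type*} [AddCommGroup G] [NormedAddCommGroup H]
    [InnerProductSpace ℂ H] (b : G → G → Circle) (g : G) (ξ : CrossedSpace G H) (x : G) :
    implementer b g ξ x = (b g (x - g) : ℂ) • ξ (x - g) := rfl

theorem norm_implementer {G H : Type*} [AddCommGroup G] [NormedAddCommGroup H]
    [InnerProductSpace ℂ H] (b : G → G → Circle) (g : G) (ξ : CrossedSpace G H) :
    ‖implementer b g ξ‖ = ‖ξ‖ := by
  rw [lp.norm_eq_tsum_rpow (by norm_num), lp.norm_eq_tsum_rpow (by norm_num) ξ,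
    ← (Equiv.subRight g).tsum_eq (fun x => ‖ξ x‖ ^ (2 : ENNReal).toReal)]
  congr 1
  refine tsum_congr fun x => ?_
  rw [implementer_apply, norm_smul, Circle.norm_coe, one_mul, Equiv.subRight_apply]

/-- The component at `0` already recovers `a`, because each `α_x` is injective. -/
theorem crossedRep_injective {G H : Type*} [AddCommGroup G] [NormedAddCommGroup H]
    [InnerProductSpace ℂ H] [CompleteSpace H] (M : VonNeumannAlgebra H) (α : G → (M ≃⋆ₐ[ℂ] M)) :
    Function.Injective (crossedRep M α) := by
  classical
  intro a b hab
  apply (α (-0)).injective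
  apply Subtype.ext
  refine ContinuousLinearMap.ext fun v => ?_
  have h := congrArg (fun T : CrossedSpace G H →L[ℂ] CrossedSpace G H =>
    T (lp.single 2 0 v) 0) hab
  simp only [crossedRep_apply, lp.single_apply_self] at h
  exact h

/-- The operator with the single matrix entry `T` at the place `(x, y)`. -/
def matrixEntry {G H : Type*} [DecidableEq G] [NormedAddCommGroup H] [InnerProductSpace ℂ H]
    (x y : G) (T : H →L[ℂ] H) : CrossedSpace G H →L[ℂ] CrossedSpace G H :=
  (lp.singleContinuousLinearMap ℂ (fun _ : G => H) 2 x) ∘L T ∘L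
    (lp.evalCLM ℂ (fun _ : G => H) 2 y)

theorem matrixEntry_apply {G H : Type*} [DecidableEq G] [NormedAddCommGroup H]
    [InnerProductSpace ℂ H] (x y : G) (T : H →L[ℂ] H) (ξ : CrossedSpace G H) :
    matrixEntry x y T ξ = lp.single 2 x (T (ξ y)) := rfl

/-- If the action is implemented by unitaries, the range of `ι` is a von Neumann algebra. -/
theorem exists_vonNeumannAlgebra_eq_range_crossedRep {G H : Type*} [AddCommGroup G]
    [NormedAddCommGroup H] [InnerProductSpace ℂ H] [CompleteSpace H] (M : VonNeumannAlgebra H)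
    (α : G → (M ≃⋆ₐ[ℂ] M)) (W : G → (H →L[ℂ] H)) (hW : ∀ x, W x ∈ unitary (H →L[ℂ] H))
    (hα : ∀ x a, (α x a : H →L[ℂ] H) = W x * a * star (W x)) :
    ∃ N : VonNeumannAlgebra (CrossedSpace G H),
      (N : Set (CrossedSpace G H →L[ℂ] CrossedSpace G H)) = Set.range (crossedRep M α) := by
  classical
  refine ⟨vonNeumannGenerated (Set.range (crossedRep M α)),
    Set.Subset.antisymm (fun T hT => ?_) (subset_vonNeumannGenerated _)⟩
  rw [SetLike.mem_coe, mem_vonNeumannGenerated_iff] at hT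
  -- With `V_x = W_{-x}`, `ι(a)` is the diagonal operator with entries `V_x a V_x*`, matching the
  -- `α_{-x}` in its definition.
  set V : G → (H →L[ℂ] H) := fun x => W (-x) with hV
  have hV1 : ∀ x v, star (V x) (V x v) = v := fun x v =>
    congrArg (fun A : H →L[ℂ] H => A v) (Unitary.mem_iff.1 (hW (-x))).1
  have hV2 : ∀ x v, V x (star (V x) v) = v := fun x v =>
    congrArg (fun A : H →L[ℂ] H => A v) (Unitary.mem_iff.1 (hW (-x))).2
  have hι : ∀ (a : M) (ξ : CrossedSpace G H) (x : G),
      crossedRep M α a ξ x = V x ((a : H →L[ℂ] H) (star (V x) (ξ x))) := fun a ξ x => by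
    rw [crossedRep_apply, hα]; rfl
  -- For `c ∈ M'` the single entry `V_x c V_y*` at `(x, y)` commutes with `ι(M)`, hence with every
  -- `T` in the bicommutant.
  have hcomm : ∀ c : H →L[ℂ] H, (∀ a : M, (a : H →L[ℂ] H) * c = c * a) → ∀ x y : G,
      matrixEntry x y (V x * c * star (V y)) * T = T * matrixEntry x y (V x * c * star (V y)) := by
    intro c hc x y
    have hca : ∀ (a : M) (v : H), (a : H →L[ℂ] H) (c v) = c ((a : H →L[ℂ] H) v) := fun a v =>
      congrArg (fun A : H →L[ℂ] H => A v) (hc a)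
    have hs : ∀ a : M, crossedRep M α a * matrixEntry x y (V x * c * star (V y))
        = matrixEntry x y (V x * c * star (V y)) * crossedRep M α a := by
      intro a
      refine ContinuousLinearMap.ext fun ξ => lp.ext (funext fun z => ?_)
      rw [mul_apply_eq_comp, mul_apply_eq_comp, hι, matrixEntry_apply, matrixEntry_apply, hι]
      by_cases hz : z = x
      · subst hz
        rw [lp.single_apply_self, lp.single_apply_self]
        simp only [mul_apply_eq_comp, hV1, hca]
      · rw [lp.single_apply_ne _ _ _ hz, lp.single_apply_ne _ _ _ hz]
        simp only [map_zero]
    refine hT _ ?_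
    rintro _ ⟨a, rfl⟩
    refine ⟨hs a, ?_⟩
    rw [← map_star]
    exact hs (star a)
  set E : H →L[ℂ] H := (lp.evalCLM ℂ (fun _ : G => H) 2 0) ∘L T ∘L
    (lp.singleContinuousLinearMap ℂ (fun _ : G => H) 2 0) with hE
  have hEapp : ∀ v, E v = T (lp.single 2 0 v) 0 := fun v => rfl
  -- The candidate preimage: the `(0, 0)` entry of `T` with the twist removed. Entries at `(0, 0)`
  -- with `c ∈ M'` show that it lies in `M'' = M`.
  set a : H →L[ℂ] H := star (V 0) * E * V 0 with ha
  have hVa : ∀ v, V 0 (a v) = E (V 0 v) := fun v => hV2 0 _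
  have haM : a ∈ M := by
    rw [← SetLike.mem_coe, ← M.centralizer_centralizer, Set.mem_centralizer_iff]
    intro c hc
    rw [Set.mem_centralizer_iff] at hc
    have h := hcomm c (fun b => hc b b.2) 0 0
    refine ContinuousLinearMap.ext fun v => ?_
    have h1 := congrArg (fun A : CrossedSpace G H →L[ℂ] CrossedSpace G H =>
      A (lp.single 2 0 (V 0 v)) 0) h
    simp only [mul_apply_eq_comp, matrixEntry_apply, lp.single_apply_self, ← hEapp, hV1,
      ← hVa] at h1
    have h2 := congrArg (fun v => (star (V 0) : H →L[ℂ] H) v) h1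
    simp only [hV1] at h2
    exact h2
  refine ⟨⟨a, haM⟩, ContinuousLinearMap.ext fun ξ => lp.ext (funext fun x => ?_)⟩
  rw [hι]
  -- The entry at `(0, x)` with `c = 1` compares component `x` of `Tξ` with the `(0, 0)` entry of
  -- `T` and gives `(Tξ)_x = V_x a V_x* ξ_x`; off-diagonal entries are excluded at the same time.
  have h := hcomm 1 (fun b => by rw [mul_one, one_mul]) 0 x
  have h1 := congrArg (fun A : CrossedSpace G H →L[ℂ] CrossedSpace G H => A ξ 0) h
  simp only [mul_apply_eq_comp, matrixEntry_apply, lp.single_apply_self, ← hEapp,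
    mul_one, ← hVa] at h1
  have h2 := congrArg (fun v => V x ((star (V 0) : H →L[ℂ] H) v)) h1
  simp only [hV1, hV2] at h2
  exact h2.symm

/-! ### The lattice and its bicharacter -/

/-- Polarization: `2⟨x, y⟩ = ⟨x+y, x+y⟩ - ⟨x, x⟩ - ⟨y, y⟩` is even. -/
theorem IsEvenLattice.exists_inner_eq_int {n : ℕ} {e : Module.Basis (Fin n) ℝ (Euc n)}
    (h : IsEvenLattice e) (x y : lattice e) :
    ∃ m : ℤ, inner ℝ (x : Euc n) (y : Euc n) = (m : ℝ) := by
  obtain ⟨a, ha⟩ := h x x.2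
  obtain ⟨b, hb⟩ := h y y.2
  obtain ⟨c, hc⟩ := h ((x : Euc n) + y) (add_mem x.2 y.2)
  refine ⟨c - a - b, ?_⟩
  rw [inner_add_left, inner_add_right, inner_add_right, real_inner_comm (x : Euc n) (y : Euc n)] at hc
  push_cast
  linarith

theorem lattice_induction {n : ℕ} {e : Module.Basis (Fin n) ℝ (Euc n)} {P : lattice e → Prop}
    (hb : ∀ i, P ⟨e i, Submodule.subset_span ⟨i, rfl⟩⟩) (hz : P 0)
    (ha : ∀ x y, P x → P y → P (x + y)) (hn : ∀ x, P x → P (-x)) (x : lattice e) : P x := by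
  let S : AddSubgroup (lattice e) :=
    { carrier := {x | P x}, add_mem' := fun {x y} hx hy => ha x y hx hy, zero_mem' := hz,
      neg_mem' := fun {x} hx => hn x hx }
  have h : (⊤ : Submodule ℤ (lattice e)) ≤ AddSubgroup.toIntSubmodule S := by
    rw [← (e.restrictScalars ℤ).span_eq, Submodule.span_le]
    rintro _ ⟨i, rfl⟩
    have : e.restrictScalars ℤ i = ⟨e i, Submodule.subset_span ⟨i, rfl⟩⟩ :=
      Subtype.ext (e.restrictScalars_apply ℤ i)
    rw [this]
    exact hb i
  exact h (Submodule.mem_top (x := x))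

theorem latticeCocycle_zero_left {n : ℕ} (e : Module.Basis (Fin n) ℝ (Euc n)) (x : lattice e) :
    latticeCocycle e 0 x = 1 := by simp [latticeCocycle]

theorem latticeCocycle_zero_right {n : ℕ} (e : Module.Basis (Fin n) ℝ (Euc n)) (x : lattice e) :
    latticeCocycle e x 0 = 1 := by simp [latticeCocycle]

theorem latticeCocycle_neg_left {n : ℕ} (e : Module.Basis (Fin n) ℝ (Euc n)) (x y : lattice e) :
    latticeCocycle e (-x) y = (latticeCocycle e x y)⁻¹ := by simp [latticeCocycle]

theorem latticeCocycle_neg_right {n : ℕ} (e : Module.Basis (Fin n) ℝ (Euc n)) (x y : lattice e) :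
    latticeCocycle e x (-y) = (latticeCocycle e x y)⁻¹ := by simp [latticeCocycle]

/-- The commutator of the bicharacter is `(-1)^⟨x, y⟩`. -/
theorem latticeCocycle_comm {n : ℕ} {e : Module.Basis (Fin n) ℝ (Euc n)} (h : IsEvenLattice e)
    (x y : lattice e) : latticeCocycle e x y =
      Circle.exp (Real.pi * inner ℝ (x : Euc n) (y : Euc n)) * latticeCocycle e y x := by
  -- Both sides are multiplicative in each variable, so only pairs of basis vectors remain.
  induction x using lattice_induction with
  | hz => simp [latticeCocycle_zero_left, latticeCocycle_zero_right]
  | ha x x' hx hx' =>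
    rw [latticeCocycle_add_left, latticeCocycle_add_right, hx, hx', Submodule.coe_add,
      inner_add_left, mul_add, Circle.exp_add]
    exact mul_mul_mul_comm _ _ _ _
  | hn x hx =>
    rw [latticeCocycle_neg_left, latticeCocycle_neg_right, hx, Submodule.coe_neg, inner_neg_left,
      mul_neg, Circle.exp_neg, mul_inv]
  | hb i =>
    induction y using lattice_induction with
    | hz => simp [latticeCocycle_zero_left, latticeCocycle_zero_right]
    | ha y y' hy hy' =>
      rw [latticeCocycle_add_left, latticeCocycle_add_right, hy, hy', Submodule.coe_add,
        inner_add_right, mul_add, Circle.exp_add]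
      exact mul_mul_mul_comm _ _ _ _
    | hn y hy =>
      rw [latticeCocycle_neg_left, latticeCocycle_neg_right, hy, Submodule.coe_neg,
        inner_neg_right, mul_neg, Circle.exp_neg, mul_inv]
    | hb j =>
      rw [latticeCocycle_basis, latticeCocycle_basis]
      rcases lt_trichotomy i j with hij | rfl | hij
      · rw [if_pos hij, if_neg hij.not_gt, mul_one]
      -- On the diagonal `b` is symmetric, so the sign `e^{iπ⟨e_i, e_i⟩}` must be `1`; this is
      -- evenness.
      · rw [if_neg (lt_irrefl i), mul_one]
        obtain ⟨m, hm⟩ := h (e i) (Submodule.subset_span ⟨i, rfl⟩)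
        rw [hm, show Real.pi * (2 * (m : ℝ)) = m * (2 * Real.pi) by ring,
          Circle.exp_int_mul_two_pi]
      -- For `j < i` the sign occurs twice, and its square is `1` by integrality.
      · rw [if_neg hij.not_gt, if_pos hij, real_inner_comm (e i) (e j), ← Circle.exp_add]
        obtain ⟨m, hm⟩ := h.exists_inner_eq_int ⟨e i, Submodule.subset_span ⟨i, rfl⟩⟩
          ⟨e j, Submodule.subset_span ⟨j, rfl⟩⟩
        simp only at hm
        rw [hm, show Real.pi * (m : ℝ) + Real.pi * m = m * (2 * Real.pi) by ring,
          Circle.exp_int_mul_two_pi]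

/-! ### The relations of the twisted crossed product -/

section Relations

variable {n : ℕ} (e : Module.Basis (Fin n) ℝ (Euc n)) (ℓ₁ : SmoothLoop ℝ)

theorem psi_apply (q : lattice e) (ξ : ExtSpace e) (x : lattice e) :
    psi e q ξ x = (latticeCocycle e q (x - q) : ℂ) • ξ (x - q) := rfl

theorem extRep_apply (K : ProperInterval) (a : localAlg n K) (ξ : ExtSpace e) (x : lattice e) :
    extRep e ℓ₁ K a ξ x = (rho ℓ₁ K ((-x : lattice e) : Euc n) a : FockF n →L[ℂ] FockF n) (ξ x) :=
  rfl

/-- The cocycle identity in bicharacter form: with `y = x - q - r`, `b(q, y + r) b(r, y) = b(q, r)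
b(q + r, y)`. -/
theorem psi_mul (q r : lattice e) :
    psi e q * psi e r = (latticeCocycle e q r : ℂ) • psi e (q + r) := by
  refine ContinuousLinearMap.ext fun ξ => lp.ext (funext fun x => ?_)
  rw [mul_apply_eq_comp, smul_apply, lp.coeFn_smul, Pi.smul_apply,
    psi_apply, psi_apply, psi_apply, smul_smul, smul_smul, ← Circle.coe_mul, ← Circle.coe_mul,
    sub_sub]
  congr 2
  have h : x - q = (x - (q + r)) + r := by abel
  rw [h, latticeCocycle_add_right, latticeCocycle_add_left]
  ac_rfl

theorem psi_zero : psi e 0 = 1 := by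
  refine ContinuousLinearMap.ext fun ξ => lp.ext (funext fun x => ?_)
  rw [psi_apply, sub_zero, latticeCocycle_zero_left, Circle.coe_one, one_smul]
  rfl

/-- An isometry with a right inverse, namely a multiple of `ψ_{-q}`. -/
theorem psi_mem_unitary (q : lattice e) : psi e q ∈ unitary (ExtSpace e →L[ℂ] ExtSpace e) := by
  have h1 : star (psi e q) * psi e q = 1 := by
    rw [ContinuousLinearMap.star_eq_adjoint]
    exact (ContinuousLinearMap.norm_map_iff_adjoint_comp_self (psi e q)).1
      fun ξ => norm_implementer _ q ξ
  have h2 : psi e q * ((latticeCocycle e q (-q) : ℂ)⁻¹ • psi e (-q)) = 1 := by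
    rw [mul_smul_comm, psi_mul, smul_smul, inv_mul_cancel₀ (Circle.coe_ne_zero _), one_smul,
      add_neg_cancel, psi_zero]
  rw [Unitary.mem_iff]
  refine ⟨h1, ?_⟩
  rw [left_inv_eq_right_inv h1 h2, h2]

/-- `ψ_q` carries component `x - q` to component `x`, and `ρ_{-(x-q)} = ρ_{-x} ρ_q`. -/
theorem psi_extRep (K : ProperInterval) (q : lattice e) (a : localAlg n K) :
    psi e q * extRep e ℓ₁ K a = extRep e ℓ₁ K (rho ℓ₁ K q a) * psi e q := by
  refine ContinuousLinearMap.ext fun ξ => lp.ext (funext fun x => ?_)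
  rw [mul_apply_eq_comp, mul_apply_eq_comp, psi_apply, extRep_apply, extRep_apply, psi_apply,
    ← rho_add, map_smul]
  have h : ((-(x - q) : lattice e) : Euc n) = ((-x : lattice e) : Euc n) + q := by
    push_cast
    abel
  rw [h]

variable {e}

theorem psi_mul_comm (heven : IsEvenLattice e) (q r : lattice e) :
    psi e q * psi e r = Complex.exp (Complex.I * Real.pi * (inner ℝ (q : Euc n) (r : Euc n) : ℝ)) •
      (psi e r * psi e q) := by
  rw [psi_mul, psi_mul, smul_smul, latticeCocycle_comm heven, Circle.coe_mul, Circle.coe_exp,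
    add_comm q r]
  congr 3
  push_cast
  ring

end Relations

/-! ### Charged fields -/

section Charged

variable {n : ℕ} {ℓ₁ : SmoothLoop ℝ} {p : Circle} {J J₁ J₂ K K₁ K₂ : ProperInterval}
  {Λ Λ₁ Λ₂ : SmoothLoop ℝ}

theorem coe_transporter (h : IsTransport ℓ₁ p J K Λ) (q : Euc n) :
    (transporter h q : FockF n →L[ℂ] FockF n) = weyl (Λ.smulVec q).vec := rfl

theorem pairing_smulVec (f g : SmoothLoop ℝ) (q r : Euc n) :
    pairing (f.smulVec q).toFun (g.smulVec r).toFun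
      = inner ℝ q r * pairing f.toFun g.toFun := pairing_smul _ _ _ _

theorem rho_transporter (h : IsTransport ℓ₁ p J K Λ) (q r : Euc n) :
    rho ℓ₁ K r (transporter h q) = Complex.exp (Complex.I *
      (inner ℝ q r * pairing Λ.toFun ℓ₁.toFun : ℝ)) • transporter h q := by
  apply Subtype.ext
  have h1 := rho_weyl ℓ₁ K r ((h.supported.smulVec q).mono subset_closure) (transporter h q).2
  rw [pairing_smulVec] at h1
  exact h1

theorem transporter_mem_unitary (h : IsTransport ℓ₁ p J K Λ) (q : Euc n) :
    transporter h q ∈ unitary (localAlg n K) := by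
  obtain ⟨h1, h2⟩ := Unitary.mem_iff.1 (weyl_mem_unitary (Λ.smulVec q).vec)
  exact Unitary.mem_iff.2 ⟨Subtype.ext h1, Subtype.ext h2⟩

/-- The exchange relation of charge transporters. -/
theorem transporter_comm (h₁ : IsTransport ℓ₁ p J₁ K₁ Λ₁) (h₂ : IsTransport ℓ₁ p J₂ K₂ Λ₂)
    (q r : Euc n) : (transporter h₁ q : FockF n →L[ℂ] FockF n) * transporter h₂ r
      = Complex.exp (-Complex.I * (inner ℝ q r * pairing Λ₁.toFun (deriv Λ₂.toFun) : ℝ)) •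
        ((transporter h₂ r : FockF n →L[ℂ] FockF n) * transporter h₁ q) := by
  rw [coe_transporter, coe_transporter, weyl_vec_comm, symp_smulVec]

variable {e : Module.Basis (Fin n) ℝ (Euc n)}

/-- The two possible values `±π` of the bracket differ by `2π` and are multiplied by the integer
`⟨q, r⟩`, so the order of the arcs drops out. -/
theorem exp_braiding_phase (hcharge : ℓ₁.charge = 1) (heven : IsEvenLattice e)
    (h₁ : IsTransport ℓ₁ p J₁ K₁ Λ₁) (h₂ : IsTransport ℓ₁ p J₂ K₂ Λ₂)
    (hd : Disjoint J₁.carrier J₂.carrier) (q r : lattice e) :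
    Complex.exp (Complex.I * (inner ℝ (q : Euc n) (r : Euc n) *
      (pairing Λ₂.toFun ℓ₁.toFun - pairing Λ₁.toFun ℓ₁.toFun
        - pairing Λ₁.toFun (deriv Λ₂.toFun)) : ℝ))
      = Complex.exp (Complex.I * Real.pi * (inner ℝ (q : Euc n) (r : Euc n) : ℝ)) := by
  obtain ⟨m, hm⟩ := heven.exists_inner_eq_int q r
  rw [hm, Complex.exp_eq_exp_iff_exists_int]
  rcases braiding_phase hcharge h₁ h₂ hd with h | h <;> rw [h]
  · exact ⟨0, by push_cast; ring⟩
  · exact ⟨-m, by push_cast; ring⟩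

/-- The statistics operator `ε(ρ_q, ρ_r)` is the scalar `e^{iπ⟨q, r⟩}`. -/
theorem braiding_eq (hcharge : ℓ₁.charge = 1) (heven : IsEvenLattice e)
    (h₁ : IsTransport ℓ₁ p J₁ K Λ₁) (h₂ : IsTransport ℓ₁ p J₂ K Λ₂)
    (hd : Disjoint J₁.carrier J₂.carrier) (q r : lattice e) :
    rho ℓ₁ K r (star (transporter h₁ (q : Euc n))) * star (transporter h₂ (r : Euc n)) *
        transporter h₁ (q : Euc n) * rho ℓ₁ K q (transporter h₂ (r : Euc n))
      = Complex.exp (Complex.I * Real.pi * (inner ℝ (q : Euc n) (r : Euc n) : ℝ)) •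
        (1 : localAlg n K) := by
  rw [map_star, rho_transporter, rho_transporter]
  set u := transporter h₁ (q : Euc n)
  set v := transporter h₂ (r : Euc n)
  obtain ⟨hu1, hu2⟩ := Unitary.mem_iff.1 (transporter_mem_unitary h₁ (q : Euc n))
  obtain ⟨hv1, hv2⟩ := Unitary.mem_iff.1 (transporter_mem_unitary h₂ (r : Euc n))
  have huv : u * v = Complex.exp (-Complex.I * (inner ℝ (q : Euc n) (r : Euc n) *
      pairing Λ₁.toFun (deriv Λ₂.toFun) : ℝ)) • (v * u) :=
    Subtype.ext (transporter_comm h₁ h₂ (q : Euc n) (r : Euc n))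
  have h4 : star u * star v * u * v = Complex.exp (-Complex.I *
      (inner ℝ (q : Euc n) (r : Euc n) * pairing Λ₁.toFun (deriv Λ₂.toFun) : ℝ)) • 1 := by
    rw [mul_assoc, huv, mul_smul_comm, mul_assoc, ← mul_assoc (star v), hv1, one_mul, hu1]
  -- Three scalars are collected: the conjugated phase of `ρ_r` on `u`, the phase of `ρ_q` on `v`,
  -- and the group commutator `u* v* u v`. Their exponents add up to the bracket of `braiding_phase`
  -- times `⟨q, r⟩`.
  rw [star_smul, smul_mul_assoc, smul_mul_assoc, smul_mul_assoc, mul_smul_comm, h4, smul_smul,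
    smul_smul, Complex.star_def, ← Complex.exp_conj, ← Complex.exp_add, ← Complex.exp_add,
    ← exp_braiding_phase hcharge heven h₁ h₂ hd q r]
  congr 2
  rw [map_mul, Complex.conj_I, Complex.conj_ofReal, real_inner_comm (q : Euc n) (r : Euc n)]
  push_cast
  ring

theorem extRep_smul_one (c : ℂ) : extRep e ℓ₁ K (c • 1) = c • 1 := by
  rw [map_smul, map_one]

/-- `ι(𝒜_F(J₁))` and `ι(𝒜_F(J₂))` commute for disjoint intervals. -/
theorem extRep_commute (hd : Disjoint J₁.carrier J₂.carrier) (a : localAlg n J₁)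
    (b : localAlg n J₂) :
    extRep e ℓ₁ J₁ a * extRep e ℓ₁ J₂ b = extRep e ℓ₁ J₂ b * extRep e ℓ₁ J₁ a := by
  refine ContinuousLinearMap.ext fun ξ => lp.ext (funext fun x => ?_)
  rw [mul_apply_eq_comp, mul_apply_eq_comp, extRep_apply, extRep_apply, extRep_apply, extRep_apply]
  exact congrArg (fun A : FockF n →L[ℂ] FockF n => A (ξ x))
    (localAlg_commute hd (rho ℓ₁ J₁ ((-x : lattice e) : Euc n) a).2
      (rho ℓ₁ J₂ ((-x : lattice e) : Euc n) b).2)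

/-- The charged field `ι(z_q) ψ_q`. -/
def chargedField (e : Module.Basis (Fin n) ℝ (Euc n)) (h : IsTransport ℓ₁ p J K Λ)
    (q : lattice e) : ExtSpace e →L[ℂ] ExtSpace e :=
  extRep e ℓ₁ K (transporter h (q : Euc n)) * psi e q

theorem chargedField_mem_unitary (h : IsTransport ℓ₁ p J K Λ) (q : lattice e) :
    chargedField e h q ∈ unitary (ExtSpace e →L[ℂ] ExtSpace e) :=
  mul_mem (Unitary.map_mem (extRep e ℓ₁ K) (transporter_mem_unitary h (q : Euc n)))
    (psi_mem_unitary e q)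

theorem extRep_transporter_apply (h : IsTransport ℓ₁ p J K Λ) (q : Euc n) (ξ : ExtSpace e)
    (x : lattice e) : extRep e ℓ₁ K (transporter h q) ξ x = Complex.exp (Complex.I *
      (inner ℝ q ((-x : lattice e) : Euc n) * pairing Λ.toFun ℓ₁.toFun : ℝ)) •
        (transporter h q : FockF n →L[ℂ] FockF n) (ξ x) := by
  rw [extRep_apply, rho_transporter]
  rfl

/-- Charged fields localized in `J` commute with `ι(𝒜_F(N))` for `N` disjoint from `J`. -/
theorem extRep_chargedField_commute {N : ProperInterval} (h : IsTransport ℓ₁ p J K Λ)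
    (hd : Disjoint N.carrier J.carrier) (a : localAlg n N) (q : lattice e) :
    extRep e ℓ₁ N a * chargedField e h q = chargedField e h q * extRep e ℓ₁ N a := by
  -- `K` and `N` need not lie in a common proper interval, so the relation is checked in each
  -- component, where it is `transporter_rho` for `ρ_{-x}(a)`. The resulting `ρ_q` is absorbed by
  -- moving `ψ_q` across.
  have key : extRep e ℓ₁ N a * extRep e ℓ₁ K (transporter h (q : Euc n))
      = extRep e ℓ₁ K (transporter h (q : Euc n)) * extRep e ℓ₁ N (rho ℓ₁ N q a) := by
    refine ContinuousLinearMap.ext fun ξ => lp.ext (funext fun x => ?_)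
    rw [mul_apply_eq_comp, mul_apply_eq_comp, extRep_apply, extRep_transporter_apply,
      extRep_transporter_apply, extRep_apply, map_smul, ← rho_add,
      add_comm ((-x : lattice e) : Euc n), rho_add]
    have h1 := transporter_rho h hd (q : Euc n) (rho ℓ₁ N ((-x : lattice e) : Euc n) a)
    have h2 : star (transporter h (q : Euc n) : FockF n →L[ℂ] FockF n) *
        (transporter h (q : Euc n) : FockF n →L[ℂ] FockF n) = 1 :=
      (Unitary.mem_iff.1 (weyl_mem_unitary (Λ.smulVec (q : Euc n)).vec)).1
    have h3 := congrArg (fun A : FockF n →L[ℂ] FockF n => A *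
      (transporter h (q : Euc n) : FockF n →L[ℂ] FockF n)) h1
    simp only [mul_assoc, h2, mul_one] at h3
    have h4 := congrArg (fun A : FockF n →L[ℂ] FockF n => A (ξ x)) h3.symm
    simp only [mul_apply_eq_comp] at h4
    rw [h4]
  rw [chargedField, ← mul_assoc, key, mul_assoc, ← psi_extRep, mul_assoc]

theorem ext_smul_mul {G H : Type*} [NormedAddCommGroup H] [InnerProductSpace ℂ H]
    {A B : CrossedSpace G H →L[ℂ] CrossedSpace G H} {c : ℂ}
    (h : ∀ ξ x, A (B ξ) x = c • B (A ξ) x) : A * B = c • (B * A) :=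
  ContinuousLinearMap.ext fun ξ => lp.ext (funext fun x => h ξ x)

theorem smul_map_smul_comm {H : Type*} [NormedAddCommGroup H] [NormedSpace ℂ H] {U V : H →L[ℂ] H}
    (α β c : ℂ) (w : H) (h : U (V w) = c • V (U w)) :
    α • U (β • V w) = c • β • V (α • U w) := by
  rw [map_smul, map_smul, h]
  module

/-- Charged fields localized in disjoint intervals commute. -/
theorem chargedField_commute (hcharge : ℓ₁.charge = 1) (heven : IsEvenLattice e)
    (h₁ : IsTransport ℓ₁ p J₁ K₁ Λ₁) (h₂ : IsTransport ℓ₁ p J₂ K₂ Λ₂)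
    (hd : Disjoint J₁.carrier J₂.carrier) (q r : lattice e) :
    chargedField e h₁ q * chargedField e h₂ r = chargedField e h₂ r * chargedField e h₁ q := by
  have hι : extRep e ℓ₁ K₁ (transporter h₁ (q : Euc n)) *
      extRep e ℓ₁ K₂ (transporter h₂ (r : Euc n))
      = Complex.exp (-Complex.I * (inner ℝ (q : Euc n) (r : Euc n) *
        pairing Λ₁.toFun (deriv Λ₂.toFun) : ℝ)) •
        (extRep e ℓ₁ K₂ (transporter h₂ (r : Euc n)) *
          extRep e ℓ₁ K₁ (transporter h₁ (q : Euc n))) := by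
    -- In component `x` both orders carry the same phases from `ρ_{-x}`, which leaves the Weyl
    -- exchange phase alone.
    have hx : ∀ (ξ : ExtSpace e) (x : lattice e),
        extRep e ℓ₁ K₁ (transporter h₁ (q : Euc n))
          (extRep e ℓ₁ K₂ (transporter h₂ (r : Euc n)) ξ) x
        = Complex.exp (-Complex.I * (inner ℝ (q : Euc n) (r : Euc n) *
          pairing Λ₁.toFun (deriv Λ₂.toFun) : ℝ)) •
          (extRep e ℓ₁ K₂ (transporter h₂ (r : Euc n))
            (extRep e ℓ₁ K₁ (transporter h₁ (q : Euc n)) ξ) x) := by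
      intro ξ x
      rw [extRep_transporter_apply, extRep_transporter_apply, extRep_transporter_apply,
        extRep_transporter_apply]
      refine smul_map_smul_comm _ _ _ _ ?_
      exact congrArg (fun A : FockF n →L[ℂ] FockF n => A (ξ x))
        (transporter_comm h₁ h₂ (q : Euc n) (r : Euc n))
    exact ext_smul_mul hx
  -- Moving `ψ_q` past `ι(z_r)` applies `ρ_q` to the transporter, which costs only a scalar.
  have expand : ∀ {J J' K K' : ProperInterval} {Λ Λ' : SmoothLoop ℝ}
      (h : IsTransport ℓ₁ p J K Λ) (h' : IsTransport ℓ₁ p J' K' Λ') (q r : lattice e),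
      chargedField e h q * chargedField e h' r = Complex.exp (Complex.I *
        (inner ℝ (r : Euc n) (q : Euc n) * pairing Λ'.toFun ℓ₁.toFun : ℝ)) •
        (extRep e ℓ₁ K (transporter h (q : Euc n)) * extRep e ℓ₁ K' (transporter h' (r : Euc n)) *
          (psi e q * psi e r)) := by
    intro J J' K K' Λ Λ' h h' q r
    rw [chargedField, chargedField, mul_assoc, ← mul_assoc (psi e q), psi_extRep, rho_transporter,
      map_smul, smul_mul_assoc, smul_mul_assoc, mul_smul_comm]
    simp only [mul_assoc]
  rw [expand, expand, hι, psi_mul_comm heven q r, ← exp_braiding_phase hcharge heven h₁ h₂ hd q r,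
    smul_mul_assoc, mul_smul_comm, smul_smul, smul_smul, ← Complex.exp_add, ← Complex.exp_add]
  -- The two exponents differ by `2i⟨q, r⟩` times the bracket of `braiding_phase`: once from the
  -- transporters and once from the commutator of the `ψ`. As the bracket is `±π` and `⟨q, r⟩ = m`,
  -- this is `±2πi m`.
  obtain ⟨m, hm⟩ := heven.exists_inner_eq_int q r
  congr 1
  rw [Complex.exp_eq_exp_iff_exists_int, real_inner_comm (q : Euc n) (r : Euc n), hm]
  have hD := braiding_phase hcharge h₁ h₂ hd
  rcases hD with h | h
  · refine ⟨m, ?_⟩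
    have h' : pairing Λ₁.toFun (deriv Λ₂.toFun)
      = pairing Λ₂.toFun ℓ₁.toFun - pairing Λ₁.toFun ℓ₁.toFun - Real.pi := by linarith
    rw [h']; push_cast; ring
  · refine ⟨-m, ?_⟩
    have h' : pairing Λ₁.toFun (deriv Λ₂.toFun)
      = pairing Λ₂.toFun ℓ₁.toFun - pairing Λ₁.toFun ℓ₁.toFun + Real.pi := by linarith
    rw [h']; push_cast; ring

end Charged

/-! ### The extended net -/

section Net

variable {n : ℕ} {e : Module.Basis (Fin n) ℝ (Euc n)} {ℓ₁ : SmoothLoop ℝ} {p : Circle}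

theorem extRep_compatible {J₁ J₂ : ProperInterval} (h : J₁.carrier ⊆ J₂.carrier)
    (a₁ : localAlg n J₁) (a₂ : localAlg n J₂) (ha : (a₁ : FockF n →L[ℂ] FockF n) = a₂) :
    extRep e ℓ₁ J₁ a₁ = extRep e ℓ₁ J₂ a₂ := by
  refine ContinuousLinearMap.ext fun ξ => lp.ext (funext fun x => ?_)
  rw [extRep_apply, extRep_apply, rho_compatible ℓ₁ h _ a₁ a₂ ha]

theorem extRep_mem_extNet (J : ProperInterval) (a : localAlg n J) :
    extRep e ℓ₁ J a ∈ extNet e ℓ₁ p J :=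
  subset_vonNeumannGenerated _ (Or.inl ⟨a, rfl⟩)

theorem IsTransport.mono {J₁ J₂ K : ProperInterval} {Λ : SmoothLoop ℝ}
    (h : IsTransport ℓ₁ p J₁ K Λ) (hJ : J₁.carrier ⊆ J₂.carrier) : IsTransport ℓ₁ p J₂ K Λ where
  cut := h.cut
  supported := h.supported
  localized := by
    obtain ⟨J₀, h0, h1⟩ := h.localized
    exact ⟨J₀, h0.trans hJ, h1⟩

theorem extNet_mono {J₁ J₂ : ProperInterval} (hJ : J₁.carrier ⊆ J₂.carrier) :
    (extNet e ℓ₁ p J₁ : Set (ExtSpace e →L[ℂ] ExtSpace e)) ⊆ extNet e ℓ₁ p J₂ := by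
  refine vonNeumannGenerated_subset ?_
  rintro T (⟨a, rfl⟩ | ⟨q, K, Λ, h, rfl⟩)
  · rw [extRep_compatible hJ a ⟨a, localAlg_mono hJ a.2⟩ rfl]
    exact extRep_mem_extNet _ _
  · exact subset_vonNeumannGenerated _ (Or.inr ⟨q, K, Λ, h.mono hJ, rfl⟩)

theorem extNet_commute (hcharge : ℓ₁.charge = 1) (heven : IsEvenLattice e) {J₁ J₂ : ProperInterval}
    (hd : Disjoint J₁.carrier J₂.carrier) {x y : ExtSpace e →L[ℂ] ExtSpace e}
    (hx : x ∈ extNet e ℓ₁ p J₁) (hy : y ∈ extNet e ℓ₁ p J₂) : x * y = y * x := by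
  refine vonNeumannGenerated_commute ?_ hx hy
  rintro s (⟨a, rfl⟩ | ⟨q, K, Λ, h, rfl⟩) t (⟨b, rfl⟩ | ⟨r, K', Λ', h', rfl⟩)
  · refine ⟨extRep_commute hd a b, ?_⟩
    rw [← map_star]
    exact extRep_commute hd a (star b)
  · have hc := extRep_chargedField_commute (e := e) h' hd a r
    exact ⟨hc, (star_commute_of_unitary (chargedField_mem_unitary h' r) hc.symm).symm⟩
  · refine ⟨(extRep_chargedField_commute h hd.symm b q).symm, ?_⟩
    rw [← map_star]
    exact (extRep_chargedField_commute h hd.symm (star b) q).symm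
  · have hc := chargedField_commute (e := e) hcharge heven h h' hd q r
    exact ⟨hc, (star_commute_of_unitary (chargedField_mem_unitary h' r) hc.symm).symm⟩

/-- The zero loop. -/
def SmoothLoop.zero (E : Type*) [NormedAddCommGroup E] [NormedSpace ℝ E] : SmoothLoop E where
  toFun _ := 0
  smooth := contDiff_const
  periodic _ := rfl

/-- `ℓ₁` is already localized in `I`, so nothing has to be transported; this makes `ψ_q` itself a
charged field of `𝒜_L(I)`. -/
theorem isTransport_zero {I : ProperInterval} (hloc : LocalizedIn ℓ₁.toFun I)
    (hp : p ∉ closure I.carrier) : IsTransport ℓ₁ p I I (SmoothLoop.zero ℝ) where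
  cut h := hp (subset_closure h)
  supported := by
    have : tsupport (SmoothLoop.zero ℝ).toFun = ∅ := tsupport_eq_empty_iff.2 rfl
    rw [SmoothLoop.SupportedIn, this]
    exact Set.empty_subset _
  localized := by
    refine ⟨I, subset_rfl, fun h => hp (subset_closure h), fun θ hθ => ?_⟩
    have h0 : deriv (SmoothLoop.zero ℝ).toFun θ = 0 := deriv_const θ (0 : ℝ)
    show deriv (SmoothLoop.zero ℝ).toFun θ + ℓ₁ θ = 0
    rw [h0, zero_add]
    exact hloc θ hθ

theorem transporter_zero {J K : ProperInterval} (h : IsTransport ℓ₁ p J K (SmoothLoop.zero ℝ))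
    (q : Euc n) : transporter h q = 1 := by
  apply Subtype.ext
  have h0 : ((SmoothLoop.zero ℝ).smulVec q).vec = 0 := by
    rw [← norm_le_zero_iff]
    refine SmoothLoop.norm_vec_le _ le_rfl fun θ => ?_
    have : deriv (SmoothLoop.zero ℝ).toFun θ = 0 := deriv_const θ (0 : ℝ)
    rw [SmoothLoop.deriv_smulVec, this, zero_smul, norm_zero]
  rw [coe_transporter, h0, weyl_zero]
  rfl

/-- For transport within `I`, the charge transporters lie in `𝒜_F(I)`. -/
theorem extRep_transporter_mem_range {I K : ProperInterval} {Λ : SmoothLoop ℝ}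
    (hloc : LocalizedIn ℓ₁.toFun I) (hp : p ∉ closure I.carrier) (h : IsTransport ℓ₁ p I K Λ)
    (q : Euc n) : ∃ a : localAlg n I,
      extRep e ℓ₁ I a = extRep e ℓ₁ K (transporter h q) := by
  obtain ⟨t, rfl⟩ := Circle.exp_surjective p
  have hd : LocalizedIn (deriv Λ.toFun) I := by
    obtain ⟨J₀, hJ, -, hl⟩ := h.localized
    intro θ hθ
    have h1 : deriv Λ.toFun θ + ℓ₁ θ = 0 := hl θ fun hc => hθ (closure_mono hJ hc)
    rw [hloc θ hθ, add_zero] at h1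
    exact h1
  -- `Λ'` is localized in `I` and `Λ` vanishes at the cut, but its support may touch the boundary of
  -- `I`; hence the appeal to `weyl_mem_localAlg` below.
  have hs := (supportedIn_closure_of_deriv hp (h.supported.eq_zero h.cut) hd).smulVec q
  refine ⟨⟨_, weyl_mem_localAlg hs⟩, ?_⟩
  refine ContinuousLinearMap.ext fun ξ => lp.ext (funext fun x => ?_)
  rw [extRep_transporter_apply, extRep_apply, rho_weyl ℓ₁ I _ hs, pairing_smulVec]
  rfl

/-- Each set of generators lies in the other algebra: transporters within `I` come from `𝒜_F(I)`,
and `ψ_q` is the charged field for `Λ = 0`. -/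
theorem extNet_eq_twistedCrossedProduct {I : ProperInterval} (hloc : LocalizedIn ℓ₁.toFun I)
    (hp : p ∉ closure I.carrier) : extNet e ℓ₁ p I =
      twistedCrossedProduct (localAlg n I) (fun x : lattice e => rho ℓ₁ I x)
        (latticeCocycle e) := by
  refine SetLike.coe_injective (Set.Subset.antisymm ?_ ?_)
  · refine vonNeumannGenerated_subset ?_
    rintro T (⟨a, rfl⟩ | ⟨q, K, Λ, h, rfl⟩)
    · exact subset_vonNeumannGenerated _ (Or.inl ⟨a, rfl⟩)
    · obtain ⟨a, ha⟩ := extRep_transporter_mem_range (e := e) hloc hp h (q : Euc n)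
      rw [← ha]
      exact mul_mem (S := VonNeumannAlgebra (ExtSpace e))
        (subset_vonNeumannGenerated _ (Or.inl ⟨a, rfl⟩))
        (subset_vonNeumannGenerated _ (Or.inr ⟨q, rfl⟩))
  · refine vonNeumannGenerated_subset ?_
    rintro T (⟨a, rfl⟩ | ⟨q, rfl⟩)
    · exact extRep_mem_extNet I a
    · refine subset_vonNeumannGenerated _ (Or.inr ⟨q, I, _, isTransport_zero hloc hp, ?_⟩)
      rw [transporter_zero, map_one, one_mul]
      rfl

theorem extRep_injective (J : ProperInterval) : Function.Injective (extRep e ℓ₁ J) :=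
  crossedRep_injective (localAlg n J) fun x : lattice e => rho ℓ₁ J (x : Euc n)

theorem exists_vonNeumannAlgebra_eq_range_extRep (J : ProperInterval) :
    ∃ N : VonNeumannAlgebra (ExtSpace e),
      (N : Set (ExtSpace e →L[ℂ] ExtSpace e)) = Set.range (extRep e ℓ₁ J) :=
  exists_vonNeumannAlgebra_eq_range_crossedRep (localAlg n J)
    (fun x : lattice e => rho ℓ₁ J (x : Euc n))
    (fun x : lattice e => weyl (gaugeLoop ℓ₁ J (x : Euc n)).vec) (fun _ => weyl_mem_unitary _)
    fun x a => rho_coe ℓ₁ J (x : Euc n) a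

theorem isLocalExtension_extNet (hcharge : ℓ₁.charge = 1) (heven : IsEvenLattice e) :
    IsLocalExtension (localAlg n) (extNet e ℓ₁ p) (extRep e ℓ₁) where
  base_isotony _ _ h _ ha := localAlg_mono h ha
  injective J := extRep_injective J
  normal J := exists_vonNeumannAlgebra_eq_range_extRep J
  compatible _ _ h a₁ a₂ ha := extRep_compatible h a₁ a₂ ha
  embeds J a := extRep_mem_extNet J a
  isotony _ _ h := extNet_mono h
  locality _ _ hd x hx y hy := extNet_commute hcharge heven hd (x := x) (y := y) hx hy

end Net

end

end LatticeNet

/-! ### The proposition -/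

theorem mainTheorem6 {n : ℕ} (e : Module.Basis (Fin n) ℝ (LatticeNet.Euc n))
    (heven : LatticeNet.IsEvenLattice e)
    (I : LatticeNet.ProperInterval) (ℓ₁ : LatticeNet.SmoothLoop ℝ)
    (hcharge : ℓ₁.charge = 1) (hloc : LatticeNet.LocalizedIn ℓ₁.toFun I)
    (p : Circle) (hp : p ∉ closure I.carrier) :
    -- the localized automorphisms, and the action of `F` by them
    (∀ (K : LatticeNet.ProperInterval) (q : LatticeNet.Euc n)
      (f : LatticeNet.SmoothLoop (LatticeNet.Euc n)) (hf : f.SupportedIn K.carrier),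
      LatticeNet.rho ℓ₁ K q (LatticeNet.localWeyl K f hf) =
        Complex.exp (Complex.I * ((2 * Real.pi)⁻¹ *
          ∫ θ in (0)..(2 * Real.pi), inner ℝ (f θ) (ℓ₁ θ • q) : ℝ)) •
            LatticeNet.localWeyl K f hf) ∧
    (∀ (K : LatticeNet.ProperInterval) (q r : LatticeNet.Euc n) (a : LatticeNet.localAlg n K),
      LatticeNet.rho ℓ₁ K (q + r) a = LatticeNet.rho ℓ₁ K q (LatticeNet.rho ℓ₁ K r a)) ∧
    -- the relations of the twisted crossed product
    (∀ q : LatticeNet.lattice e, LatticeNet.psi e q ∈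
      unitary (LatticeNet.ExtSpace e →L[ℂ] LatticeNet.ExtSpace e)) ∧
    (∀ (K : LatticeNet.ProperInterval) (q : LatticeNet.lattice e) (a : LatticeNet.localAlg n K),
      LatticeNet.psi e q * LatticeNet.extRep e ℓ₁ K a =
        LatticeNet.extRep e ℓ₁ K (LatticeNet.rho ℓ₁ K q a) * LatticeNet.psi e q) ∧
    (∀ q r : LatticeNet.lattice e, LatticeNet.psi e q * LatticeNet.psi e r =
      (LatticeNet.latticeCocycle e q r : ℂ) • LatticeNet.psi e (q + r)) ∧
    -- charge transporters to every interval exist, and they transport the charges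
    (∀ J : LatticeNet.ProperInterval, ∃ (K : LatticeNet.ProperInterval)
      (Λ : LatticeNet.SmoothLoop ℝ), LatticeNet.IsTransport ℓ₁ p J K Λ) ∧
    (∀ (J K N : LatticeNet.ProperInterval) (Λ : LatticeNet.SmoothLoop ℝ)
      (h : LatticeNet.IsTransport ℓ₁ p J K Λ), Disjoint N.carrier J.carrier →
      ∀ (q : LatticeNet.Euc n) (a : LatticeNet.localAlg n N),
        (LatticeNet.transporter h q : LatticeNet.FockF n →L[ℂ] LatticeNet.FockF n) *
            LatticeNet.rho ℓ₁ N q a *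
            star (LatticeNet.transporter h q : LatticeNet.FockF n →L[ℂ] LatticeNet.FockF n) =
          (a : LatticeNet.FockF n →L[ℂ] LatticeNet.FockF n)) ∧
    -- the charged fields commute up to the braiding, `ψ_q ψ_r = ε(ρ_q, ρ_r) ψ_r ψ_q`, where
    -- `ε(ρ_q, ρ_r) = ρ_r(u*) v* u ρ_q(v)`
    (∀ (J₁ J₂ K : LatticeNet.ProperInterval) (Λ₁ Λ₂ : LatticeNet.SmoothLoop ℝ)
      (h₁ : LatticeNet.IsTransport ℓ₁ p J₁ K Λ₁) (h₂ : LatticeNet.IsTransport ℓ₁ p J₂ K Λ₂),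
      Disjoint J₁.carrier J₂.carrier → ∀ q r : LatticeNet.lattice e,
        LatticeNet.psi e q * LatticeNet.psi e r =
          LatticeNet.extRep e ℓ₁ K
            (LatticeNet.rho ℓ₁ K r (star (LatticeNet.transporter h₁ (q : LatticeNet.Euc n))) *
              star (LatticeNet.transporter h₂ (r : LatticeNet.Euc n)) *
              LatticeNet.transporter h₁ (q : LatticeNet.Euc n) *
              LatticeNet.rho ℓ₁ K q (LatticeNet.transporter h₂ (r : LatticeNet.Euc n))) *
          (LatticeNet.psi e r * LatticeNet.psi e q)) ∧
    (∀ q r : LatticeNet.lattice e, LatticeNet.psi e q * LatticeNet.psi e r =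
      Complex.exp (Complex.I * Real.pi *
        (inner ℝ (q : LatticeNet.Euc n) (r : LatticeNet.Euc n) : ℝ)) •
          (LatticeNet.psi e r * LatticeNet.psi e q)) ∧
    -- the twisted crossed product is the algebra of the interval `I` in a local extension
    LatticeNet.extNet e ℓ₁ p I =
      LatticeNet.twistedCrossedProduct (LatticeNet.localAlg n I)
        (fun x : LatticeNet.lattice e => LatticeNet.rho ℓ₁ I x) (LatticeNet.latticeCocycle e) ∧
    LatticeNet.IsLocalExtension (LatticeNet.localAlg n) (LatticeNet.extNet e ℓ₁ p)
      (LatticeNet.extRep e ℓ₁) := by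
  refine ⟨fun K q f hf => ?_, fun K q r a => LatticeNet.rho_add ℓ₁ K q r a,
    LatticeNet.psi_mem_unitary e, LatticeNet.psi_extRep e ℓ₁, LatticeNet.psi_mul e,
    LatticeNet.exists_isTransport hcharge hloc hp,
    fun J K N Λ h hd q a => LatticeNet.transporter_rho h hd q a,
    fun J₁ J₂ K Λ₁ Λ₂ h₁ h₂ hd q r => ?_, LatticeNet.psi_mul_comm heven,
    LatticeNet.extNet_eq_twistedCrossedProduct hloc hp,
    LatticeNet.isLocalExtension_extNet hcharge heven⟩
  · exact Subtype.ext (LatticeNet.rho_weyl ℓ₁ K q (hf.mono subset_closure) _)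
  -- The statistics operator is a scalar, so the relation becomes the commutation relation of the
  -- `ψ`.
  · rw [LatticeNet.braiding_eq hcharge heven h₁ h₂ hd q r, LatticeNet.extRep_smul_one,
      smul_mul_assoc, one_mul]
    exact LatticeNet.psi_mul_comm heven q r
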